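/- **Setting.** For a compact interval $\mathcal T=[\alpha,\beta]\subset\mathbb R$ let $\mathcal H(\mathcal T,\mathbb R^p)=L^2(\mathcal T;\mathbb R^p)$ with its norm $\|\cdot\|_{\mathcal H}$. An activation $a:\mathbb R\to\mathbb R$ is a Tauber–Wiener function if on every compact interval $I$ every continuous function is a uniform limit of finite sums $\sum_q k_q\,a(w_q x+b_q)$. A functional decoder with activation $a$ is a map $\mathcal D:\mathbb R^s\to\mathcal H(\mathcal T,\mathbb R^p)$ of the form $$y_1(t)=a\big(W_1(t)x+b_1(t)\big),\quad y_2(t)=a\big(W_2(t)y_1(t)+b_2(t)\big),\quad \mathcal D(x)(t)=W_3(t)\,y_2(t),$$ where $a$ acts componentwise, the two hidden widths are arbitrary, and the matrix-valued weights $W_j$ and the vector-valued biases $b_j$ are continuous on $\mathcal T$. **Theorem.** (1) Let $a$ be a Tauber–Wiener function and $f:\mathbb R^s\to\mathcal H(\mathcal T,\mathbb R^p)$ continuous. For every $\epsilon\in(0,1)$ and every compact $E\subset\mathbb R^s$ there is a functional decoder $\mathcal D$ with activation $a$ such that $\sup_{x\in E}\|\mathcal D(x)-f(x)\|_{\mathcal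 H}<\epsilon$. (2) Let $\mathcal M$ be a compact connected smooth Riemannian manifold and $\iota:\mathcal M\to\mathbb R^p$ a smooth embedding that is isometric (it preserves lengths of tangent vectors); let $\mathcal H(\mathcal T,\mathcal M)$ be the set of $h\in\mathcal H(\mathcal T,\mathbb R^p)$ with $h(t)\in\iota(\mathcal M)$ for almost every $t$. Write $\mathrm{Exp}_y:T_y\mathcal M\to\mathcal M$ for the Riemannian exponential map, $\mathrm{inj}_{\mathcal M}(y)$ for the injectivity radius at $y$, $B_r(y)=\mathrm{Exp}_y(\{v:\|v\|<r\})$ for geodesic balls, and $P_y:\mathbb R^p\to T_y\mathcal M$ for the orthogonal projection onto $d\iota(T_y\mathcal M)$ followed by its identification with $T_y\mathcal M$. (a) There are finitely many anchor points $y_1,\dots,y_N\in\mathcal M$ and radii $0<r_i\le\mathrm{inj}_{\mathcal M}(y_i)$ with $\bigcup_i B_{r_i}(y_i)=\mathcal M$. Fix any such family. For a measurable patch selection $\sigma:\mathbb R\to\{1,\dots,N\}$ and a continuous $f:\mathbb R^s\to\mathcal H(\mathcal T,\mathcal M)$, call a compact set $E\subset\mathbb R^s$ *controlled* (for $f$ and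 $\sigma$) if for every $x\in E$ one has $f(x)(t)\in \iota\big(B_{r_{\sigma(t)}}(y_{\sigma(t)})\big)$ for almost every $t\in\mathcal T$. (b) There is $\delta>0$, depending only on the embedded manifold and the anchor family, such that, for every $\mathcal T$, $s$ and continuous $f:\mathbb R^s\to\mathcal H(\mathcal T,\mathcal M)$, every compact $E$ of small diameter in the following sense is controlled for some measurable $\sigma$: there is a nondecreasing $\eta:\mathbb R\to\mathbb R$ with $\|f(x)(t)-f(x')(t)\|\le\eta(\|x-x'\|)$ for all $x,x'\in E$ and almost every $t\in\mathcal T$, and $\eta(\mathrm{diam}\,E)<\delta$. (c) For every $\mathcal T$ and measurable $\sigma$ there is a readout map $\rho:\mathcal H(\mathcal T,\mathbb R^p)\to\mathcal H(\mathcal T,\mathcal M)$ given by the exponential maps at the anchor points, $$\rho(h)(t)=\iota\Big(\mathrm{Exp}_{y_{\sigma(t)}}\big(P_{y_{\sigma(t)}}h(t)\big)\Big)\quad\text{for almost every }t,$$ such that for every Tauber–Wiener function $a$, every $s$, every continuous $f:\mathbb R^s\to\mathcal H(\mathcal T,\mathcal M)$, every $\epsilon\in(0,1)$ and every compact $E\subset\mathbb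 R^s$ that is controlled for $f$ and $\sigma$, there is a functional decoder $\mathcal D$ with activation $a$ such that $\sup_{x\in E}\|\rho(\mathcal D(x))-f(x)\|_{\mathcal H}<\epsilon$. -/

import Mathlib

open MeasureTheory Set Bundle
open scoped Manifold ContDiff ENNReal Matrix

noncomputable section

namespace FunctionalDecoder

/-! ### The function space and the functional decoder -/

/-- `H(𝒯, ℝ^p) = L²(𝒯; ℝ^p)` for the compact interval `𝒯 = [α, β]`, with Lebesgue measure. -/
abbrev FunSpace (α β : ℝ) (p : ℕ) : Type :=
  Lp (EuclideanSpace ℝ (Fin p)) 2 ((volume : Measure ℝ).restrict (Icc α β))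

/-- `a` is a Tauber-Wiener function: on every compact interval `[c, d]` the linear combinations
of the functions `x ↦ a (w * x + b)` approximate every continuous function uniformly. -/
def IsTauberWiener (a : ℝ → ℝ) : Prop :=
  ∀ (c d : ℝ) (g : ℝ → ℝ), ContinuousOn g (Icc c d) → ∀ ε > 0,
    ∃ (m : ℕ) (k w b : Fin m → ℝ), ∀ x ∈ Icc c d, |∑ q, k q * a (w q * x + b q) - g x| < ε

/-- The parameters of a functional network with two hidden layers, of widths `m₁` and `m₂`:
matrix-valued weights and vector-valued biases which are continuous functions on `[α, β]`. -/
structure Network (α β : ℝ) (s p : ℕ) where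
  m₁ : ℕ
  m₂ : ℕ
  W₁ : ℝ → Matrix (Fin m₁) (Fin s) ℝ
  b₁ : ℝ → Fin m₁ → ℝ
  W₂ : ℝ → Matrix (Fin m₂) (Fin m₁) ℝ
  b₂ : ℝ → Fin m₂ → ℝ
  W₃ : ℝ → Matrix (Fin p) (Fin m₂) ℝ
  continuousOn_W₁ : ContinuousOn W₁ (Icc α β)
  continuousOn_b₁ : ContinuousOn b₁ (Icc α β)
  continuousOn_W₂ : ContinuousOn W₂ (Icc α β)
  continuousOn_b₂ : ContinuousOn b₂ (Icc α β)
  continuousOn_W₃ : ContinuousOn W₃ (Icc α β)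

namespace Network

variable {α β : ℝ} {s p : ℕ}

/-- First hidden layer, `y₁(t) = a(W₁(t) x + b₁(t))`. -/
def layer₁ (𝒩 : Network α β s p) (a : ℝ → ℝ) (x : EuclideanSpace ℝ (Fin s)) (t : ℝ) :
    Fin 𝒩.m₁ → ℝ :=
  fun i => a ((𝒩.W₁ t *ᵥ x.ofLp) i + 𝒩.b₁ t i)

/-- Second hidden layer, `y₂(t) = a(W₂(t) y₁(t) + b₂(t))`. -/
def layer₂ (𝒩 : Network α β s p) (a : ℝ → ℝ) (x : EuclideanSpace ℝ (Fin s)) (t : ℝ) :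
    Fin 𝒩.m₂ → ℝ :=
  fun i => a ((𝒩.W₂ t *ᵥ 𝒩.layer₁ a x t) i + 𝒩.b₂ t i)

/-- Linear output layer without bias, `y(t) = W₃(t) y₂(t)`. -/
def output (𝒩 : Network α β s p) (a : ℝ → ℝ) (x : EuclideanSpace ℝ (Fin s)) (t : ℝ) :
    EuclideanSpace ℝ (Fin p) :=
  WithLp.toLp 2 (𝒩.W₃ t *ᵥ 𝒩.layer₂ a x t)

end Network

/-- `D : ℝ^s → L²([α, β]; ℝ^p)` is the map realised by a functional network with activation `a`. -/
def IsDecoder (a : ℝ → ℝ) {α β : ℝ} {s p : ℕ}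
    (D : EuclideanSpace ℝ (Fin s) → FunSpace α β p) : Prop :=
  ∃ 𝒩 : Network α β s p, ∀ x,
    ⇑(D x) =ᵐ[(volume : Measure ℝ).restrict (Icc α β)] 𝒩.output a x

/-! ### Geodesics, exponential map, injectivity radius -/

section Riemannian

variable {d : ℕ} {M : Type*} [TopologicalSpace M] [ChartedSpace (EuclideanSpace ℝ (Fin d)) M]
  [IsManifold (𝓡 d) ∞ M] [RiemannianBundle (fun x : M => TangentSpace (𝓡 d) x)]

/-- The Riemannian metric read in the preferred chart at `x₀`, at the point of coordinates `e`:
`g_e(v, w)` for coordinate vectors `v`, `w`. -/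
def chartMetric (x₀ : M) (e v w : EuclideanSpace ℝ (Fin d)) : ℝ :=
  inner ℝ
    (mfderiv 𝓘(ℝ, EuclideanSpace ℝ (Fin d)) (𝓡 d) (extChartAt (𝓡 d) x₀).symm e v)
    (mfderiv 𝓘(ℝ, EuclideanSpace ℝ (Fin d)) (𝓡 d) (extChartAt (𝓡 d) x₀).symm e w)

/-- `γ : ℝ → M` is a geodesic: it is `C²`, and at every time `t₀` its coordinate expression `u` in
the chart at `γ t₀` satisfies the geodesic equation in covariant (Euler-Lagrange) form,
`d/dt [g_{u(t)}(u'(t), z)] = ½ ∂_z g_{u(t)}(u'(t), u'(t))` for every constant vector `z`.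
Written out with Christoffel symbols this is `u'' + Γ_u(u', u') = 0`. -/
def IsGeodesic (γ : ℝ → M) : Prop :=
  ContMDiff 𝓘(ℝ, ℝ) (𝓡 d) 2 γ ∧
  ∀ t₀ : ℝ, ∀ z : EuclideanSpace ℝ (Fin d),
    let u : ℝ → EuclideanSpace ℝ (Fin d) := fun t => extChartAt (𝓡 d) (γ t₀) (γ t)
    HasDerivAt (fun t => chartMetric (γ t₀) (u t) (deriv u t) z)
      (1 / 2 * fderiv ℝ (fun e => chartMetric (γ t₀) e (deriv u t₀) (deriv u t₀)) (u t₀) z) t₀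

/-- `γ` is a geodesic with `γ(0) = y` and `γ'(0) = v`. -/
def IsGeodesicFrom (y : M) (v : TangentSpace (𝓡 d) y) (γ : ℝ → M) : Prop :=
  IsGeodesic (d := d) γ ∧
  (⟨γ 0, mfderiv 𝓘(ℝ, ℝ) (𝓡 d) γ 0 (1 : ℝ)⟩ : TangentBundle (𝓡 d) M) = ⟨y, v⟩

open Classical in
/-- The Riemannian exponential map `Exp_y(v) = γ(1)`, where `γ` is the geodesic with `γ(0) = y` and
`γ'(0) = v`. (On a complete manifold this geodesic exists for all times and is unique.) -/
def riemExp (y : M) (v : TangentSpace (𝓡 d) y) : M :=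
  if h : ∃ γ : ℝ → M, IsGeodesicFrom y v γ then h.choose 1 else y

/-- `Exp_y` restricts to a diffeomorphism of the ball `{v ∈ T_y M : ‖v‖ < r}` onto an open subset
of `M`. -/
def IsNormalRadius (y : M) (r : ℝ) : Prop :=
  ∃ Φ : PartialDiffeomorph 𝓘(ℝ, TangentSpace (𝓡 d) y) (𝓡 d) (TangentSpace (𝓡 d) y) M ∞,
    Φ.source = Metric.ball 0 r ∧ EqOn Φ (riemExp y) (Metric.ball 0 r)

/-- The injectivity radius `inj_M(y)`: the supremum of the radii of the balls about `0` on which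
`Exp_y` is a diffeomorphism onto its image. -/
def injRadius (y : M) : ℝ≥0∞ :=
  ⨆ (r : ℝ) (_ : IsNormalRadius (d := d) y r), ENNReal.ofReal r

/-- The geodesic ball `B_r(y) = Exp_y({v ∈ T_y M : ‖v‖ < r})` (used for `r ≤ inj_M(y)`). -/
def geodesicBall (y : M) (r : ℝ) : Set M :=
  riemExp (d := d) y '' Metric.ball 0 r

/-- Anchor points `y_i` with radii `0 < r_i ≤ inj_M(y_i)` whose geodesic balls cover `M`. -/
def IsAnchorFamily {N : ℕ} (y : Fin N → M) (r : Fin N → ℝ) : Prop :=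
  (∀ i, 0 < r i ∧ ENNReal.ofReal (r i) ≤ injRadius (d := d) (y i)) ∧
  ⋃ i, geodesicBall (d := d) (y i) (r i) = univ

/-! ### Isometric embeddings, readout maps, controlled sets -/

variable {p : ℕ}

/-- The differential `T_y M → ℝ^p` of `ι : M → ℝ^p` at `y`. -/
def differential (ι : M → EuclideanSpace ℝ (Fin p)) (y : M) :
    TangentSpace (𝓡 d) y →L[ℝ] EuclideanSpace ℝ (Fin p) :=
  (NormedSpace.fromTangentSpace (𝕜 := ℝ) (ι y)).toContinuousLinearMap ∘L
    mfderiv (𝓡 d) 𝓘(ℝ, EuclideanSpace ℝ (Fin p)) ι y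

/-- `ι` is a smooth embedding of `M` in `ℝ^p` which is isometric in the sense of Riemannian
geometry: its differentials preserve lengths of tangent vectors. -/
def IsIsometricEmbedding (ι : M → EuclideanSpace ℝ (Fin p)) : Prop :=
  Manifold.IsSmoothEmbedding (𝓡 d) 𝓘(ℝ, EuclideanSpace ℝ (Fin p)) ∞ ι ∧
  ∀ (y : M) (v : TangentSpace (𝓡 d) y), ‖differential ι y v‖ = ‖v‖

/-- The tangential part at `y` of a vector of `ℝ^p`: the adjoint of the differential of `ι`. When
`ι` is isometric this is the orthogonal projection onto `dι(T_y M)`, read in `T_y M`. -/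
def tangentialPart (ι : M → EuclideanSpace ℝ (Fin p)) (y : M) :
    EuclideanSpace ℝ (Fin p) →ₗ[ℝ] TangentSpace (𝓡 d) y :=
  haveI : FiniteDimensional ℝ (TangentSpace (𝓡 d) y) :=
    inferInstanceAs (FiniteDimensional ℝ (EuclideanSpace ℝ (Fin d)))
  LinearMap.adjoint (differential ι y).toLinearMap

/-- `H(𝒯, M)`: the functions of `L²([α, β]; ℝ^p)` with values in (the copy in `ℝ^p` of) `M`. -/
def manifoldFun (ι : M → EuclideanSpace ℝ (Fin p)) (α β : ℝ) : Set (FunSpace α β p) :=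
  {h | ∀ᵐ t ∂((volume : Measure ℝ).restrict (Icc α β)), h t ∈ range ι}

/-- `ρ : L²([α, β]; ℝ^p) → L²([α, β]; ℝ^p)` is the readout map given by the exponential maps at
the anchor points `y_i`, the one with index `σ(t)` being used at time `t`:
`ρ(h)(t) = Exp_{y_{σ(t)}}(tangential part of h(t))`. -/
def IsReadout (ι : M → EuclideanSpace ℝ (Fin p)) {N : ℕ} (y : Fin N → M) (σ : ℝ → Fin N)
    {α β : ℝ} (ρ : FunSpace α β p → FunSpace α β p) : Prop :=
  ∀ h : FunSpace α β p, ⇑(ρ h) =ᵐ[(volume : Measure ℝ).restrict (Icc α β)]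
    fun t => ι (riemExp (d := d) (y (σ t)) (tangentialPart (d := d) ι (y (σ t)) (h t)))

/-- The set `E` is controlled for `f`, with patch selection `σ`: at almost every time `t`, the
values `f(x)(t)`, `x ∈ E`, lie in the geodesic ball of index `σ(t)`. -/
def IsControlled (ι : M → EuclideanSpace ℝ (Fin p)) {N : ℕ} (y : Fin N → M) (r : Fin N → ℝ)
    (σ : ℝ → Fin N) {α β : ℝ} {s : ℕ} (f : EuclideanSpace ℝ (Fin s) → FunSpace α β p)
    (E : Set (EuclideanSpace ℝ (Fin s))) : Prop :=
  ∀ x ∈ E, ∀ᵐ t ∂((volume : Measure ℝ).restrict (Icc α β)),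
    f x t ∈ ι '' geodesicBall (d := d) (y (σ t)) (r (σ t))

end Riemannian

end FunctionalDecoder

end

open FunctionalDecoder

noncomputable section

namespace FunctionalDecoder

/-! ### Universal approximation with Euclidean outputs -/

/-! Euclidean outputs. The Tauber-Wiener property approximates `exp` on an interval, hence each
function `exp (w ⬝ x)` on a compact set by ridge sums. These exponentials are closed under products
and separate points, so Stone-Weierstrass makes ridge sums dense in the continuous functions on a
compact set. A partition of unity replaces `f` on `E` by a finite sum of terms `c j x • φ j`, with
`φ j` continuous in time. The first hidden layer produces the `c j`, the second reproduces them by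
approximating the identity, and the `φ j` enter the output weights, the only weights that depend on
time (`exists_decoder_approx`).

Manifold outputs. On a controlled set, `f` is lifted through the logarithms at the anchor points
(`exists_log`). This lift `κ` and the readout `ρ` are superposition operators with bounded kernels,
continuous in `L²` by bounded convergence along almost everywhere convergent subsequences. Since `ρ
(κ (f x)) = f x` on `E`, it suffices to approximate `κ ∘ f` by a decoder and to use the uniform
continuity of `ρ` at the compact set of its values (`exists_isReadout`). Small sets are controlled
because the cover by geodesic balls has a Lebesgue number: the patch at time `t` is chosen from the
value at one reference point of `E`.

Geometry. All facts about `riemExp` are obtained in the ambient space. Geodesics are the curves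
whose acceleration is normal to the image (`isGeodesic_iff`), so they solve `x'' = B x x' x'` for a
smooth ambient extension `B` of the second fundamental form. Speed is constant and the image of `M`
is compact, so the field can be cut off outside a ball and made complete. Tangency is preserved,
which gives global geodesics, their uniqueness and the continuity of `Exp`. Normal balls of positive
radius come from the inverse function theorem in `C([-2, 2])`, applied to the integrated geodesic
equation (`exists_openPartialHomeomorph_timeOne`). -/

/-- The span of the ridge functions `x ↦ a (w ⬝ x + b)`. -/
def ridgeSpan (a : ℝ → ℝ) (s : ℕ) : Submodule ℝ (EuclideanSpace ℝ (Fin s) → ℝ) :=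
  Submodule.span ℝ (range fun q : (Fin s → ℝ) × ℝ => fun x : EuclideanSpace ℝ (Fin s) =>
    a (q.1 ⬝ᵥ x.ofLp + q.2))

/-- The functions that are uniform limits on `K` of elements of `ridgeSpan a s`. -/
def ridgeClosure (a : ℝ → ℝ) {s : ℕ} (K : Set (EuclideanSpace ℝ (Fin s))) :
    Submodule ℝ (EuclideanSpace ℝ (Fin s) → ℝ) where
  carrier := {g | ∀ ε > 0, ∃ r ∈ ridgeSpan a s, ∀ x ∈ K, |r x - g x| < ε}
  add_mem' := by
    intro g h hg hh ε hε
    obtain ⟨r, hr, hr'⟩ := hg (ε / 2) (by positivity)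
    obtain ⟨q, hq, hq'⟩ := hh (ε / 2) (by positivity)
    refine ⟨r + q, add_mem hr hq, fun x hx => ?_⟩
    have h1 := hr' x hx
    have h2 := hq' x hx
    have : (r + q) x - (g + h) x = (r x - g x) + (q x - h x) := by simp; ring
    rw [this]
    exact (abs_add_le _ _).trans_lt (by linarith)
  zero_mem' := fun ε hε => ⟨0, zero_mem _, fun x _ => by simpa using hε⟩
  smul_mem' := by
    intro c g hg ε hε
    obtain ⟨r, hr, hr'⟩ := hg (ε / (|c| + 1)) (by positivity)
    refine ⟨c • r, Submodule.smul_mem _ _ hr, fun x hx => ?_⟩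
    have h1 := hr' x hx
    have : (c • r) x - (c • g) x = c * (r x - g x) := by simp; ring
    rw [this, abs_mul]
    rw [lt_div_iff₀ (by positivity)] at h1
    have := abs_nonneg (r x - g x)
    nlinarith

/-- On `K` the linear form takes values in some `[-C, C]`. A one-variable approximation of `exp`
there, composed with the form, is a sum of ridge functions. -/
theorem exp_mem_ridgeClosure {a : ℝ → ℝ} (ha : IsTauberWiener a) {s : ℕ}
    {K : Set (EuclideanSpace ℝ (Fin s))} (hK : IsCompact K) (w : Fin s → ℝ) :
    (fun x : EuclideanSpace ℝ (Fin s) => Real.exp (w ⬝ᵥ x.ofLp)) ∈ ridgeClosure a K := by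
  intro ε hε
  have hcont : Continuous fun x : EuclideanSpace ℝ (Fin s) => w ⬝ᵥ x.ofLp := by
    simp only [dotProduct]
    fun_prop
  obtain ⟨C, hC⟩ := (hK.image hcont).isBounded.exists_norm_le
  obtain ⟨m, k, w', b, h⟩ := ha (-C) C Real.exp Real.continuous_exp.continuousOn ε hε
  refine ⟨∑ q, k q • fun x : EuclideanSpace ℝ (Fin s) => a ((w' q • w) ⬝ᵥ x.ofLp + b q), ?_, ?_⟩
  · refine Submodule.sum_mem _ fun q _ => Submodule.smul_mem _ _ (Submodule.subset_span ?_)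
    exact ⟨(w' q • w, b q), rfl⟩
  · intro x hx
    have h1 := hC _ (mem_image_of_mem _ hx)
    rw [Real.norm_eq_abs, abs_le] at h1
    simpa [smul_dotProduct] using h _ h1

/-- A Tauber-Wiener function generates ridge functions which are dense in `C(K)`. -/
theorem mem_ridgeClosure_of_continuousOn {a : ℝ → ℝ} (ha : IsTauberWiener a) {s : ℕ}
    {K : Set (EuclideanSpace ℝ (Fin s))} (hK : IsCompact K) {g : EuclideanSpace ℝ (Fin s) → ℝ}
    (hg : ContinuousOn g K) : g ∈ ridgeClosure a K := by
  intro ε hε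
  have : CompactSpace K := isCompact_iff_compactSpace.mp hK
  -- The exponentials form a multiplicative monoid, so the algebra they generate is merely their
  -- linear span, and membership in the closure need only be checked on generators.
  let e : Multiplicative (Fin s → ℝ) →* C(K, ℝ) :=
    { toFun := fun w => ⟨fun x => Real.exp (w.toAdd ⬝ᵥ x.1.ofLp), by
        simp only [dotProduct]
        fun_prop⟩
      map_one' := by ext; simp
      map_mul' := fun v w => by ext; simp [add_dotProduct, Real.exp_add] }
  let A : Subalgebra ℝ C(K, ℝ) := Algebra.adjoin ℝ (MonoidHom.mrange e : Set C(K, ℝ))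
  have hsep : A.SeparatesPoints := by
    intro x y hxy
    obtain ⟨i, hi⟩ : ∃ i, x.1.ofLp i ≠ y.1.ofLp i := by
      by_contra! h
      exact hxy (Subtype.ext (PiLp.ext h))
    refine ⟨e (Multiplicative.ofAdd (Pi.single i 1)),
      ⟨_, Algebra.subset_adjoin ⟨_, rfl⟩, rfl⟩, ?_⟩
    simpa [e] using hi
  obtain ⟨⟨h, hA⟩, hh⟩ := ContinuousMap.exists_mem_subalgebra_near_continuous_of_separatesPoints A
    hsep (fun x : K => g x) (continuousOn_iff_continuous_domRestrict.mp hg) (ε / 2) (by positivity)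
  have key : ∀ h ∈ Submodule.span ℝ (MonoidHom.mrange e : Set C(K, ℝ)),
      ∃ h' ∈ ridgeClosure a K, ∀ x : K, h' x = h x := by
    intro h hh
    induction hh using Submodule.span_induction with
    | mem x hx =>
      obtain ⟨w, rfl⟩ := hx
      exact ⟨_, exp_mem_ridgeClosure ha hK w.toAdd, fun x => rfl⟩
    | zero => exact ⟨0, zero_mem _, fun x => rfl⟩
    | add x y _ _ hx hy =>
      obtain ⟨x', h1, h2⟩ := hx
      obtain ⟨y', h3, h4⟩ := hy
      exact ⟨x' + y', add_mem h1 h3, fun z => by simp [h2, h4]⟩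
    | smul c x _ hx =>
      obtain ⟨x', h1, h2⟩ := hx
      exact ⟨c • x', Submodule.smul_mem _ _ h1, fun z => by simp [h2]⟩
  have hA' : h ∈ Submodule.span ℝ (MonoidHom.mrange e : Set C(K, ℝ)) := by
    have : h ∈ Subalgebra.toSubmodule A := hA
    rwa [Algebra.adjoin_eq_span, Submonoid.closure_eq] at this
  obtain ⟨h', hr, hh'⟩ := key h hA'
  obtain ⟨r, hr, hr'⟩ := hr (ε / 2) (by positivity)
  refine ⟨r, hr, fun x hx => ?_⟩
  have h1 := hr' x hx
  have h2 := hh ⟨x, hx⟩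
  rw [Real.norm_eq_abs] at h2
  rw [hh' ⟨x, hx⟩] at h1
  have : r x - g x = (r x - h ⟨x, hx⟩) + (h ⟨x, hx⟩ - g x) := by ring
  rw [this]
  exact (abs_add_le _ _).trans_lt (by simp at h1 h2 ⊢; linarith)

/-- Approximation of a continuous map on a compact set by finite sums `∑ c j x • v j` with the
`v j` in a dense set. -/
theorem exists_sum_smul_approx {X V : Type*} [TopologicalSpace X] [NormedAddCommGroup V]
    [NormedSpace ℝ V] {K : Set X} (hK : IsCompact K) {f : X → V} (hf : ContinuousOn f K)
    {T : Type*} {v : T → V} (hv : DenseRange v) {ε : ℝ} (hε : 0 < ε) :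
    ∃ (n : ℕ) (τ : Fin n → T) (c : Fin n → X → ℝ), (∀ j, ContinuousOn (c j) K) ∧
      ∀ x ∈ K, ‖∑ j, c j x • v (τ j) - f x‖ < ε := by
  obtain ⟨J, hJ⟩ := (hK.image_of_continuousOn hf).elim_finite_subcover
    (fun τ : T => Metric.ball (v τ) ε) (fun _ => Metric.isOpen_ball) (by
      rintro y -
      obtain ⟨τ, hτ⟩ := hv.exists_dist_lt y hε
      exact mem_iUnion.2 ⟨τ, hτ⟩)
  let e := J.equivFin.symm
  -- Tent functions: `d j` is positive exactly where `f x` is within `ε` of the `j`-th chosen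
  -- vector. Once normalised they form the partition of unity.
  let d : Fin J.card → X → ℝ := fun j x => max 0 (ε - ‖f x - v (e j)‖)
  have hd0 : ∀ j x, 0 ≤ d j x := fun j x => le_max_left _ _
  have hdc : ∀ j, ContinuousOn (d j) K := fun j => by
    refine ContinuousOn.sup continuousOn_const (continuousOn_const.sub ?_)
    exact (hf.sub continuousOn_const).norm
  have hpos : ∀ x ∈ K, 0 < ∑ j, d j x := by
    intro x hx
    have := hJ (mem_image_of_mem f hx)
    simp only [mem_iUnion] at this
    obtain ⟨τ, hτ, h⟩ := this
    refine Finset.sum_pos' (fun j _ => hd0 j x) ⟨e.symm ⟨τ, hτ⟩, Finset.mem_univ _, ?_⟩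
    rw [Metric.mem_ball, dist_eq_norm] at h
    simp only [d, Equiv.apply_symm_apply]
    exact lt_max_of_lt_right (by linarith)
  refine ⟨J.card, fun j => e j, fun j x => d j x / ∑ i, d i x, fun j => ?_, fun x hx => ?_⟩
  · exact (hdc j).div (continuousOn_finsetSum _ fun i _ => hdc i) fun x hx => (hpos x hx).ne'
  · set S := ∑ i, d i x with hS
    have hSp : 0 < S := hpos x hx
    have h1 : ∑ j, (d j x / S) • v (e j) - f x = ∑ j, (d j x / S) • (v (e j) - f x) := by
      simp only [smul_sub, Finset.sum_sub_distrib, ← Finset.sum_smul, ← Finset.sum_div]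
      rw [← hS, div_self hSp.ne', one_smul]
    rw [h1]
    refine (norm_sum_le _ _).trans_lt ?_
    -- Strictness where `d j x > 0` is recorded separately, since it makes the final bound `< ε`
    -- rather than `≤ ε`.
    have h2 : ∀ j, ‖(d j x / S) • (v (e j) - f x)‖ ≤ (d j x / S) * ε ∧
        (0 < d j x → ‖(d j x / S) • (v (e j) - f x)‖ < (d j x / S) * ε) := by
      intro j
      have hj : 0 < d j x → ‖(d j x / S) • (v (e j) - f x)‖ < (d j x / S) * ε := by
        intro hp
        rw [norm_smul, Real.norm_of_nonneg (by have := hd0 j x; positivity)]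
        refine mul_lt_mul_of_pos_left ?_ (by positivity)
        rw [norm_sub_rev]
        rcases lt_max_iff.1 hp with h | h
        · exact absurd h (lt_irrefl _)
        · linarith
      refine ⟨?_, hj⟩
      rcases (hd0 j x).eq_or_lt with h | h
      · simp [← h]
      · exact (hj h).le
    calc ∑ j, ‖(d j x / S) • (v (e j) - f x)‖ < ∑ j, (d j x / S) * ε := by
          obtain ⟨j, -, hj⟩ : ∃ j ∈ Finset.univ, 0 < d j x := by
            by_contra! h
            exact absurd hSp (not_lt.2 (Finset.sum_nonpos h))
          exact Finset.sum_lt_sum (fun i _ => (h2 i).1) ⟨j, Finset.mem_univ _, (h2 j).2 hj⟩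
      _ = ε := by rw [← Finset.sum_mul, ← Finset.sum_div, ← hS, div_self hSp.ne', one_mul]

/-- A network whose only time-dependent weights are those of the output layer, with hidden layers
indexed by arbitrary finite types. -/
theorem isDecoder_of_fintype (a : ℝ → ℝ) {α β : ℝ} {s p : ℕ} {I₁ I₂ : Type} [Fintype I₁]
    [Fintype I₂] (W₁ : I₁ → Fin s → ℝ) (b₁ : I₁ → ℝ) (W₂ : I₂ → I₁ → ℝ) (b₂ : I₂ → ℝ)
    (φ : I₂ → ℝ → EuclideanSpace ℝ (Fin p)) (hφ : ∀ i, Continuous (φ i))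
    {D : EuclideanSpace ℝ (Fin s) → FunSpace α β p}
    (hD : ∀ x, ⇑(D x) =ᵐ[(volume : Measure ℝ).restrict (Icc α β)] fun t =>
      ∑ i, a (∑ l, W₂ i l * a (W₁ l ⬝ᵥ x.ofLp + b₁ l) + b₂ i) • φ i t) :
    IsDecoder a D := by
  let e₁ := (Fintype.equivFin I₁).symm
  let e₂ := (Fintype.equivFin I₂).symm
  refine ⟨{ m₁ := Fintype.card I₁
            m₂ := Fintype.card I₂
            W₁ := fun _ i => W₁ (e₁ i)
            b₁ := fun _ i => b₁ (e₁ i)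
            W₂ := fun _ i l => W₂ (e₂ i) (e₁ l)
            b₂ := fun _ i => b₂ (e₂ i)
            W₃ := fun t k i => (φ (e₂ i) t).ofLp k
            continuousOn_W₁ := continuousOn_const
            continuousOn_b₁ := continuousOn_const
            continuousOn_W₂ := continuousOn_const
            continuousOn_b₂ := continuousOn_const
            continuousOn_W₃ := by
              refine Continuous.continuousOn (continuous_pi fun k => continuous_pi fun i => ?_)
              have := hφ (e₂ i)
              fun_prop }, fun x => (hD x).trans (Filter.Eventually.of_forall fun t => ?_)⟩
  ext k
  simp only [Network.output, Network.layer₂, Network.layer₁, Matrix.mulVec, dotProduct,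
    WithLp.ofLp_sum, Finset.sum_apply, WithLp.ofLp_smul, Pi.smul_apply, smul_eq_mul]
  rw [← e₂.sum_comp]
  refine Finset.sum_congr rfl fun i _ => ?_
  rw [mul_comm, ← e₁.sum_comp]

/-- A continuous map `E → L²` on a compact set is a uniform limit of functional decoders. -/
theorem exists_decoder_approx {a : ℝ → ℝ} (ha : IsTauberWiener a) {α β : ℝ} {s p : ℕ}
    {f : EuclideanSpace ℝ (Fin s) → FunSpace α β p} {E : Set (EuclideanSpace ℝ (Fin s))}
    (hE : IsCompact E) (hf : ContinuousOn f E) {ε : ℝ} (hε : 0 < ε) :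
    ∃ D : EuclideanSpace ℝ (Fin s) → FunSpace α β p, IsDecoder a D ∧
      ∀ x ∈ E, ‖D x - f x‖ < ε := by
  let μ := (volume : Measure ℝ).restrict (Icc α β)
  let T := BoundedContinuousFunction.toLp (E := EuclideanSpace ℝ (Fin p)) 2 μ ℝ
  obtain ⟨n, φ, c, hc, hcf⟩ := exists_sum_smul_approx hE hf
    (BoundedContinuousFunction.toLp_denseRange (EuclideanSpace ℝ (Fin p)) μ ℝ
      (ENNReal.ofNat_ne_top : (2 : ℝ≥0∞) ≠ ⊤)) (half_pos hε)
  let S := ∑ j, ‖T (φ j)‖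
  have hS : 0 ≤ S := Finset.sum_nonneg fun _ _ => norm_nonneg _
  -- Each coefficient will be off by less than `2 * η`, half from each hidden layer, which costs at
  -- most `2 * η * S ≤ ε / 2` in norm.
  set η := ε / (4 * (S + 1)) with hη
  have hη0 : 0 < η := by positivity
  have h1 : ∀ j, ∃ r ∈ ridgeSpan a s, ∀ x ∈ E, |r x - c j x| < η := fun j =>
    mem_ridgeClosure_of_continuousOn ha hE (hc j) η hη0
  choose r hr hrc using h1
  have h2 : ∀ j, ∃ C, ∀ x ∈ E, |c j x| ≤ C := fun j => by
    obtain ⟨C, hC⟩ := (hE.image_of_continuousOn (hc j)).isBounded.exists_norm_le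
    exact ⟨C, fun x hx => hC _ (mem_image_of_mem _ hx)⟩
  choose C hC using h2
  have hCη : ∀ j, ∀ x ∈ E, |r j x| ≤ ∑ i, |C i| + η := fun j x hx => by
    have h3 := hrc j x hx
    have h4 := hC j x hx
    have h5 : |C j| ≤ ∑ i, |C i| :=
      Finset.single_le_sum (f := fun i => |C i|) (fun i _ => abs_nonneg _) (Finset.mem_univ j)
    have h6 := le_abs_self (C j)
    have : r j x = (r j x - c j x) + c j x := by ring
    rw [this]
    exact (abs_add_le _ _).trans (by linarith)
  -- The second layer approximates the identity on an interval containing all values of the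
  -- approximate coefficients `r j`.
  obtain ⟨m, k, w, b, hkwb⟩ := ha (-(∑ i, |C i| + η)) (∑ i, |C i| + η) id continuousOn_id η hη0
  have h3 : ∀ j, ∃ (N : ℕ) (κ : Fin N → ℝ) (q : Fin N → (Fin s → ℝ) × ℝ),
      ∀ x, r j x = ∑ i, κ i * a ((q i).1 ⬝ᵥ x.ofLp + (q i).2) := by
    intro j
    obtain ⟨N, κ, g, hg⟩ := Submodule.mem_span_set'.1 (hr j)
    choose q hq using fun i => (g i).2
    refine ⟨N, κ, q, fun x => ?_⟩
    rw [← hg]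
    simp only [Finset.sum_apply, Pi.smul_apply, smul_eq_mul, ← hq]
  choose N κ q hq using h3
  let y : EuclideanSpace ℝ (Fin s) → Fin n → ℝ := fun x j => ∑ i, k i * a (w i * r j x + b i)
  have hy : ∀ x ∈ E, ∀ j, |y x j - c j x| < 2 * η := fun x hx j => by
    have h4 := hkwb (r j x) (abs_le.1 (hCη j x hx))
    have h5 := hrc j x hx
    have : y x j - c j x = (y x j - r j x) + (r j x - c j x) := by ring
    rw [this]
    exact (abs_add_le _ _).trans_lt (by simp only [id] at h4; linarith)
  refine ⟨fun x => ∑ j, y x j • T (φ j), ?_, fun x hx => ?_⟩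
  -- First-layer neurons are indexed by the ridge terms of all the `r j`, second-layer neurons by a
  -- coefficient and a term of the approximate identity. `W₂` is block diagonal, so that neuron `(j,
  -- i)` sees only `r j`.
  · refine isDecoder_of_fintype a (I₁ := Σ j : Fin n, Fin (N j)) (I₂ := Fin n × Fin m)
      (fun l => (q l.1 l.2).1) (fun l => (q l.1 l.2).2)
      (fun i l => if l.1 = i.1 then w i.2 * κ l.1 l.2 else 0) (fun i => b i.2)
      (fun i t => k i.2 • φ i.1 t) (fun i => (φ i.1).continuous.fun_const_smul _) fun x => ?_
    have h4 : ∀ i : Fin n × Fin m, ∑ l : (Σ j : Fin n, Fin (N j)),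
        (if l.1 = i.1 then w i.2 * κ l.1 l.2 else 0) * a ((q l.1 l.2).1 ⬝ᵥ x.ofLp + (q l.1 l.2).2)
        = w i.2 * r i.1 x := by
      intro i
      rw [Fintype.sum_sigma, Finset.sum_eq_single i.1]
      · simp only [if_true, hq, Finset.mul_sum, mul_assoc]
      · intro j _ hj
        simp [hj]
      · simp
    simp only [h4]
    have h5 : ∀ j, ⇑(y x j • T (φ j)) =ᵐ[μ] fun t => y x j • φ j t := fun j => by
      filter_upwards [Lp.coeFn_smul (y x j) (T (φ j)),
        BoundedContinuousFunction.coeFn_toLp 2 μ ℝ (φ j)] with t h6 h7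
      rw [h6, Pi.smul_apply]
      exact congrArg _ h7
    have h6 : ⇑(∑ j, y x j • T (φ j)) =ᵐ[μ] ∑ j, ⇑(y x j • T (φ j)) := Lp.coeFn_finsetSum _ _
    refine h6.trans ?_
    filter_upwards [ae_all_iff.2 h5] with t h7
    rw [Finset.sum_apply, Fintype.sum_prod_type]
    refine Finset.sum_congr rfl fun j _ => ?_
    rw [h7 j, Finset.sum_smul]
    refine Finset.sum_congr rfl fun i _ => ?_
    rw [smul_smul, mul_comm]
  · have h4 : ∑ j, y x j • T (φ j) - f x =
        ∑ j, (y x j - c j x) • T (φ j) + (∑ j, c j x • T (φ j) - f x) := by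
      simp only [sub_smul, Finset.sum_sub_distrib]
      abel
    rw [h4]
    have h5 : ‖∑ j, (y x j - c j x) • T (φ j)‖ ≤ 2 * η * S := by
      refine (norm_sum_le _ _).trans ?_
      rw [Finset.mul_sum]
      refine Finset.sum_le_sum fun j _ => ?_
      rw [norm_smul, Real.norm_eq_abs]
      exact mul_le_mul_of_nonneg_right (hy x hx j).le (norm_nonneg _)
    have h6 : 2 * η * S ≤ ε / 2 := by
      rw [hη, ← mul_div_assoc, div_mul_eq_mul_div, div_le_iff₀ (by positivity)]
      nlinarith
    exact (norm_add_le _ _).trans_lt (by have := hcf x hx; linarith)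

/-- A supremum of strict inequalities is only a weak one; the margin `ε / 2` restores strictness. -/
theorem iSup_enorm_lt_of_forall_norm_lt {X V : Type*} [NormedAddCommGroup V] {E : Set X}
    {u : X → V} {ε : ℝ} (hε : 0 < ε) (h : ∀ x ∈ E, ‖u x‖ < ε / 2) :
    ⨆ x ∈ E, ‖u x‖ₑ < ENNReal.ofReal ε := by
  refine lt_of_le_of_lt (iSup₂_le (a := ENNReal.ofReal (ε / 2)) fun x hx => ?_)
    ((ENNReal.ofReal_lt_ofReal_iff hε).2 (half_lt_self hε))
  rw [← ofReal_norm]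
  exact ENNReal.ofReal_le_ofReal (h x hx).le

open Filter Topology

/-! ### Superposition operators on `L²` -/

/-- Bounded convergence in `L²` of a finite measure. -/
theorem tendsto_Lp_two_of_ae_tendsto_of_bounded {Ω V : Type*} [MeasurableSpace Ω] {μ : Measure Ω}
    [IsFiniteMeasure μ] [NormedAddCommGroup V] {F : ℕ → Lp V 2 μ} {f : Lp V 2 μ} {C : ℝ}
    (hF : ∀ n, ∀ᵐ t ∂μ, ‖F n t‖ ≤ C)
    (hlim : ∀ᵐ t ∂μ, Tendsto (fun n => F n t) atTop (𝓝 (f t))) :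
    Tendsto F atTop (𝓝 f) := by
  rw [Lp.tendsto_Lp_iff_tendsto_eLpNorm']
  have hf : ∀ᵐ t ∂μ, ‖f t‖ ≤ C := by
    filter_upwards [hlim, ae_all_iff.2 hF] with t h1 h2
    exact le_of_tendsto h1.norm (Eventually.of_forall h2)
  have key : Tendsto (fun n => ∫⁻ t, ‖F n t - f t‖ₑ ^ (2 : ℝ) ∂μ) atTop
      (𝓝 (∫⁻ _, (0 : ℝ≥0∞) ∂μ)) := by
    refine tendsto_lintegral_of_dominated_convergence' (fun _ => ENNReal.ofReal (C + C) ^ (2 : ℝ))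
      (fun n => ?_) (fun n => ?_) ?_ ?_
    · exact ((((Lp.aestronglyMeasurable (F n)).sub (Lp.aestronglyMeasurable f)).enorm).pow_const _)
    · filter_upwards [hF n, hf] with t h1 h2
      gcongr
      rw [← ofReal_norm]
      exact ENNReal.ofReal_le_ofReal ((norm_sub_le _ _).trans (add_le_add h1 h2))
    · rw [lintegral_const]
      exact ENNReal.mul_ne_top (ENNReal.rpow_ne_top_of_nonneg (by norm_num) ENNReal.ofReal_ne_top)
        (measure_ne_top _ _)
    · filter_upwards [hlim] with t h
      have h1 : Tendsto (fun n => ‖F n t - f t‖ₑ) atTop (𝓝 0) := by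
        simpa using (h.sub_const (f t)).enorm
      have h2 := (ENNReal.continuous_rpow_const (y := (2 : ℝ))).tendsto 0 |>.comp h1
      simpa [Function.comp_def] using h2
  rw [lintegral_zero] at key
  have h3 := (ENNReal.continuous_rpow_const (y := (1 / 2 : ℝ))).tendsto 0 |>.comp key
  rw [ENNReal.zero_rpow_of_pos (by norm_num)] at h3
  refine h3.congr fun n => ?_
  rw [eLpNorm_eq_lintegral_rpow_enorm_toReal (by norm_num) (by norm_num)]
  simp

variable {p N : ℕ} {α β : ℝ}

/-- The superposition operator `h ↦ (t ↦ G (σ t) (h t))` of a bounded measurable family. -/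
theorem exists_superposition {G : Fin N → EuclideanSpace ℝ (Fin p) → EuclideanSpace ℝ (Fin p)}
    (hG : ∀ i, Measurable (G i)) {C : ℝ} (hC : ∀ i v, ‖G i v‖ ≤ C) {σ : ℝ → Fin N}
    (hσ : Measurable σ) : ∃ Φ : FunSpace α β p → FunSpace α β p, ∀ h,
      ⇑(Φ h) =ᵐ[(volume : Measure ℝ).restrict (Icc α β)] fun t => G (σ t) (h t) := by
  have hG' : Measurable fun q : Fin N × EuclideanSpace ℝ (Fin p) => G q.1 q.2 :=
    measurable_from_prod_countable_right hG
  have hmem : ∀ h : FunSpace α β p, MemLp (fun t => G (σ t) (h t)) 2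
      ((volume : Measure ℝ).restrict (Icc α β)) := fun h => by
    refine MemLp.of_bound ?_ C (Eventually.of_forall fun t => hC _ _)
    exact (hG'.comp_aemeasurable (hσ.aemeasurable.prodMk
      (Lp.aestronglyMeasurable h).aemeasurable)).aestronglyMeasurable
  exact ⟨fun h => (hmem h).toLp _, fun h => MemLp.coeFn_toLp _⟩

/-- Continuity of superposition operators, within the functions with values in given sets. -/
theorem continuousWithinAt_superposition
    {G : Fin N → EuclideanSpace ℝ (Fin p) → EuclideanSpace ℝ (Fin p)} {C : ℝ}
    (hC : ∀ i v, ‖G i v‖ ≤ C) {σ : ℝ → Fin N} {Φ : FunSpace α β p → FunSpace α β p}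
    (hΦ : ∀ h, ⇑(Φ h) =ᵐ[(volume : Measure ℝ).restrict (Icc α β)] fun t => G (σ t) (h t))
    {A : Fin N → Set (EuclideanSpace ℝ (Fin p))} {Q : Set (FunSpace α β p)}
    (hQ : ∀ h ∈ Q, ∀ᵐ t ∂((volume : Measure ℝ).restrict (Icc α β)), h t ∈ A (σ t))
    {h : FunSpace α β p}
    (hh : ∀ᵐ t ∂((volume : Measure ℝ).restrict (Icc α β)),
      ContinuousWithinAt (G (σ t)) (A (σ t)) (h t)) :
    ContinuousWithinAt Φ Q h := by
  refine tendsto_of_subseq_tendsto fun ns hns => ?_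
  obtain ⟨hns1, hns2⟩ := tendsto_nhdsWithin_iff.1 hns
  -- The shift by `k` puts every term of the sequence in `Q`, so that one null set serves for all of
  -- them.
  obtain ⟨k, hk⟩ := eventually_atTop.1 hns2
  have hns3 : Tendsto (fun n => ns (n + k)) atTop (𝓝 h) :=
    hns1.comp (tendsto_add_atTop_nat k)
  -- Convergence in `L²` implies convergence in measure, hence almost everywhere along a
  -- subsequence, where pointwise continuity of `G` applies.
  obtain ⟨ms, -, hms⟩ := (tendstoInMeasure_of_tendsto_Lp hns3).exists_seq_tendsto_ae
  refine ⟨fun n => ms n + k, tendsto_Lp_two_of_ae_tendsto_of_bounded (C := C) (fun n => ?_) ?_⟩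
  · filter_upwards [hΦ (ns (ms n + k))] with t ht
    rw [ht]
    exact hC _ _
  · filter_upwards [hms, hh, hΦ h, ae_all_iff.2 fun n => hΦ (ns (ms n + k)),
      ae_all_iff.2 fun n => hQ _ (hk (ms n + k) (Nat.le_add_left _ _))] with t h1 h2 h3 h4 h5
    rw [h3]
    simp only [h4]
    exact h2.tendsto.comp (tendsto_nhdsWithin_iff.2 ⟨h1, Eventually.of_forall h5⟩)

/-! ### Least squares inverses and smooth local inverses -/

section LeastSquares

variable {X V : Type*} [NormedAddCommGroup X] [InnerProductSpace ℝ X] [FiniteDimensional ℝ X]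
  [NormedAddCommGroup V] [InnerProductSpace ℝ V] [FiniteDimensional ℝ V]

/-- The least squares inverse `(A* A)⁻¹ A*` of an injective linear map. -/
def leastSquaresInv (A : X →L[ℝ] V) : V →L[ℝ] X :=
  haveI := FiniteDimensional.complete ℝ X
  haveI := FiniteDimensional.complete ℝ V
  (ContinuousLinearMap.inverse (ContinuousLinearMap.adjoint A ∘L A)) ∘L
    ContinuousLinearMap.adjoint A

/-- The identity `⟨A* A x, x⟩ = ‖A x‖²` makes the Gram operator injective, and an injective
endomorphism in finite dimension is invertible. -/
theorem isInvertible_gram {X V : Type*} [NormedAddCommGroup X] [InnerProductSpace ℝ X]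
    [FiniteDimensional ℝ X] [NormedAddCommGroup V] [InnerProductSpace ℝ V] [CompleteSpace X]
    [CompleteSpace V] {A : X →L[ℝ] V}
    (hA : Function.Injective A) :
    (ContinuousLinearMap.adjoint A ∘L A).IsInvertible := by
  have hinj : Function.Injective (ContinuousLinearMap.adjoint A ∘L A : X →L[ℝ] X) := by
    rw [injective_iff_map_eq_zero]
    intro x hx
    have h1 : inner ℝ (A x) (A x) = 0 := by
      rw [← ContinuousLinearMap.adjoint_inner_left]
      have : ContinuousLinearMap.adjoint A (A x) = 0 := hx
      rw [this, inner_zero_left]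
    exact (injective_iff_map_eq_zero A).1 hA x (inner_self_eq_zero.1 h1)
  refine ⟨(LinearEquiv.ofInjectiveEndo _ hinj).toContinuousLinearEquiv, ?_⟩
  ext x
  rfl

theorem leastSquaresInv_apply_apply {A : X →L[ℝ] V} (hA : Function.Injective A) (x : X) :
    leastSquaresInv A (A x) = x := by
  have := FiniteDimensional.complete ℝ X
  have := FiniteDimensional.complete ℝ V
  exact (isInvertible_gram hA).inverse_apply_self x

/-- The adjoint of `A` kills the residual. Thus `A ∘ leastSquaresInv A` is the orthogonal projection
onto the range of `A`, which separates tangential from normal parts below. -/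
theorem inner_apply_sub_leastSquaresInv {A : X →L[ℝ] V} (hA : Function.Injective A) (z : X)
    (v : V) : inner ℝ (A z) (v - A (leastSquaresInv A v)) = 0 := by
  have := FiniteDimensional.complete ℝ X
  have := FiniteDimensional.complete ℝ V
  rw [← ContinuousLinearMap.adjoint_inner_right, map_sub]
  have := (isInvertible_gram hA).self_apply_inverse (ContinuousLinearMap.adjoint A v)
  have h2 : ContinuousLinearMap.adjoint A (A (leastSquaresInv A v)) =
    ContinuousLinearMap.adjoint A v := this
  rw [h2, sub_self, inner_zero_right]

theorem contDiff_adjoint {X V : Type*} [NormedAddCommGroup X] [InnerProductSpace ℝ X]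
    [NormedAddCommGroup V] [InnerProductSpace ℝ V] [CompleteSpace X] [CompleteSpace V] {n : WithTop ℕ∞} :
    ContDiff ℝ n fun A : X →L[ℝ] V => ContinuousLinearMap.adjoint A := by
  refine IsBoundedLinearMap.contDiff ⟨⟨fun A B => by simp, fun c A => by simp⟩, 1, one_pos,
    fun A => ?_⟩
  simp

/-- The adjoint is a bounded real-linear operation and inversion is smooth at invertible operators.
Tangential and normal parts of derivatives therefore vary smoothly with the base point. -/
theorem contDiffAt_leastSquaresInv {A : X →L[ℝ] V} (hA : Function.Injective A)
    {n : WithTop ℕ∞} : ContDiffAt ℝ n (leastSquaresInv (X := X) (V := V)) A := by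
  have := FiniteDimensional.complete ℝ X
  have := FiniteDimensional.complete ℝ V
  have h1 : ContDiffAt ℝ n (fun A : X →L[ℝ] V => ContinuousLinearMap.adjoint A) A :=
    contDiff_adjoint.contDiffAt
  have h2 : ContDiffAt ℝ n
      (fun A : X →L[ℝ] V => ContinuousLinearMap.adjoint A ∘L A) A := h1.clm_comp contDiffAt_id
  have h3 : ContDiffAt ℝ n (fun A : X →L[ℝ] V =>
      ContinuousLinearMap.inverse (ContinuousLinearMap.adjoint A ∘L A)) A :=
    ContDiffAt.comp (g := ContinuousLinearMap.inverse) A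
      (isInvertible_gram hA).contDiffAt_map_inverse h2
  exact h3.clm_comp h1

end LeastSquares

/-- The inverse function theorem, with smoothness of the inverse on a whole neighbourhood. -/
theorem exists_openPartialHomeomorph_of_contDiffOn {X Y : Type*} [NormedAddCommGroup X]
    [NormedSpace ℝ X] [CompleteSpace X] [NormedAddCommGroup Y] [NormedSpace ℝ Y] {f : X → Y}
    {S : Set X} (hS : IsOpen S) (hf : ContDiffOn ℝ ∞ f S) {x : X} (hx : x ∈ S) {f' : X ≃L[ℝ] Y}
    (hf' : HasFDerivAt f (f' : X →L[ℝ] Y) x) :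
    ∃ e : OpenPartialHomeomorph X Y, x ∈ e.source ∧ e.source ⊆ S ∧ (∀ z, e z = f z) ∧
      ContDiffOn ℝ ∞ e.symm e.target := by
  have hfx : ContDiffAt ℝ ∞ f x := hf.contDiffAt (hS.mem_nhds hx)
  let e₀ := hfx.toOpenPartialHomeomorph f hf' (by simp)
  -- Invertibility of the derivative is an open condition; restricting to it makes the inverse
  -- smooth at every point of the target.
  let S' := S ∩ {z | fderiv ℝ f z ∈ range ((↑) : (X ≃L[ℝ] Y) → X →L[ℝ] Y)}
  have hS' : IsOpen S' :=
    (hf.continuousOn_fderiv_of_isOpen hS (by simp)).isOpen_inter_preimage hS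
      ContinuousLinearEquiv.isOpen
  let e := e₀.restrOpen S' hS'
  refine ⟨e, ⟨hfx.mem_toOpenPartialHomeomorph_source hf' (by simp), hx, f', hf'.fderiv.symm⟩,
    fun z hz => hz.2.1, fun z => rfl, fun y hy => ?_⟩
  have hy' := e.map_target hy
  obtain ⟨h1, h2, ⟨g', hg'⟩⟩ := hy'
  have h3 : ContDiffAt ℝ ∞ f (e.symm y) := hf.contDiffAt (hS.mem_nhds h2)
  refine (e.contDiffAt_symm hy (f₀' := g') ?_ h3).contDiffWithinAt
  change HasFDerivAt f _ _
  rw [hg']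
  exact (h3.differentiableAt (by simp)).hasFDerivAt

/-- An immersion of finite-dimensional spaces has a smooth left inverse near each image point. -/
theorem exists_smooth_leftInverse {X V : Type*} [NormedAddCommGroup X] [InnerProductSpace ℝ X]
    [FiniteDimensional ℝ X] [NormedAddCommGroup V] [InnerProductSpace ℝ V]
    [FiniteDimensional ℝ V] {F : X → V} {S : Set X} (hS : IsOpen S) (hF : ContDiffOn ℝ ∞ F S)
    {x : X} (hx : x ∈ S) (hinj : Function.Injective (fderiv ℝ F x)) :
    ∃ (L : V → X) (U : Set V) (S' : Set X), IsOpen U ∧ F x ∈ U ∧ ContDiffOn ℝ ∞ L U ∧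
      IsOpen S' ∧ x ∈ S' ∧ S' ⊆ S ∧ MapsTo L U S' ∧ ∀ z ∈ S', L (F z) = z := by
  have := FiniteDimensional.complete ℝ X
  -- The composite `q ∘ F` has derivative the identity at `x`, so it is a local diffeomorphism `e`,
  -- and `e.symm ∘ q` is the left inverse.
  let q := leastSquaresInv (fderiv ℝ F x)
  have hd : HasFDerivAt (q ∘ F) ((ContinuousLinearEquiv.refl ℝ X : X ≃L[ℝ] X) : X →L[ℝ] X) x := by
    have h1 := q.hasFDerivAt.comp x
      ((hF.contDiffAt (hS.mem_nhds hx)).differentiableAt (by simp)).hasFDerivAt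
    convert h1 using 1
    ext z
    simp [q, leastSquaresInv_apply_apply hinj]
  obtain ⟨e, h1, h2, h3, h4⟩ := exists_openPartialHomeomorph_of_contDiffOn hS
    (q.contDiff.comp_contDiffOn hF) hx hd
  have hxt : q (F x) ∈ e.target := by
    have := e.map_source h1
    rwa [h3] at this
  refine ⟨e.symm ∘ q, q ⁻¹' e.target, e.source, e.open_target.preimage q.continuous, hxt,
    h4.comp q.contDiff.contDiffOn (fun v hv => hv), e.open_source, h1, h2,
    fun v hv => e.map_target hv, fun z hz => ?_⟩
  have := e.left_inv hz
  rwa [h3] at this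

/-! ### Second derivatives along curves -/

section Curves

variable {X V : Type*} [NormedAddCommGroup X] [NormedSpace ℝ X] [NormedAddCommGroup V]
  [NormedSpace ℝ V]

theorem ContDiffAt.eventually_hasDerivAt_deriv {u : ℝ → X} {t₀ : ℝ} (hu : ContDiffAt ℝ 2 u t₀) :
    ∀ᶠ t in 𝓝 t₀, HasDerivAt u (deriv u t) t := by
  filter_upwards [hu.eventually (by simp)] with t ht
  exact (ht.differentiableAt (by simp)).hasDerivAt

theorem ContDiffAt.hasDerivAt_deriv_deriv {u : ℝ → X} {t₀ : ℝ} (hu : ContDiffAt ℝ 2 u t₀) :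
    HasDerivAt (deriv u) (deriv (deriv u) t₀) t₀ := by
  have h1 : ContDiffAt ℝ 1 (fderiv ℝ u) t₀ := hu.fderiv_right (by norm_num)
  have h2 : DifferentiableAt ℝ (deriv u) t₀ :=
    (h1.differentiableAt (by simp)).clm_apply (differentiableAt_const _)
  exact h2.hasDerivAt

variable {F : X → V} {S : Set X} {u : ℝ → X} {t₀ : ℝ}

theorem eventually_hasDerivAt_comp_curve (hS : IsOpen S) (hF : ContDiffOn ℝ ∞ F S)
    (hu : ContDiffAt ℝ 2 u t₀) (hut : u t₀ ∈ S) :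
    ∀ᶠ t in 𝓝 t₀, HasDerivAt (fun t => F (u t)) (fderiv ℝ F (u t) (deriv u t)) t := by
  filter_upwards [ContDiffAt.eventually_hasDerivAt_deriv hu,
    hu.continuousAt.eventually (hS.mem_nhds hut)] with t h1 h2
  exact ((hF.contDiffAt (hS.mem_nhds h2)).differentiableAt (by simp)).hasFDerivAt.comp_hasDerivAt
    t h1

theorem hasDerivAt_fderiv_comp_curve (hS : IsOpen S) (hF : ContDiffOn ℝ ∞ F S)
    (hu : ContDiffAt ℝ 2 u t₀) (hut : u t₀ ∈ S) :
    HasDerivAt (fun t => fderiv ℝ F (u t)) (fderiv ℝ (fderiv ℝ F) (u t₀) (deriv u t₀)) t₀ := by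
  have h1 : ContDiffAt ℝ 1 (fderiv ℝ F) (u t₀) :=
    (hF.contDiffAt (hS.mem_nhds hut)).fderiv_right (by norm_cast)
  exact (h1.differentiableAt (by simp)).hasFDerivAt.comp_hasDerivAt t₀
    (ContDiffAt.eventually_hasDerivAt_deriv hu).self_of_nhds

theorem hasDerivAt_deriv_comp_curve (hS : IsOpen S) (hF : ContDiffOn ℝ ∞ F S)
    (hu : ContDiffAt ℝ 2 u t₀) (hut : u t₀ ∈ S) :
    HasDerivAt (fun t => fderiv ℝ F (u t) (deriv u t))
      (fderiv ℝ (fderiv ℝ F) (u t₀) (deriv u t₀) (deriv u t₀)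
        + fderiv ℝ F (u t₀) (deriv (deriv u) t₀)) t₀ :=
  (hasDerivAt_fderiv_comp_curve hS hF hu hut).clm_apply
    (ContDiffAt.hasDerivAt_deriv_deriv hu)

theorem deriv_deriv_comp_curve (hS : IsOpen S) (hF : ContDiffOn ℝ ∞ F S)
    (hu : ContDiffAt ℝ 2 u t₀) (hut : u t₀ ∈ S) :
    deriv (deriv fun t => F (u t)) t₀ =
      fderiv ℝ (fderiv ℝ F) (u t₀) (deriv u t₀) (deriv u t₀)
        + fderiv ℝ F (u t₀) (deriv (deriv u) t₀) := by
  have h1 : deriv (fun t => F (u t)) =ᶠ[𝓝 t₀] fun t => fderiv ℝ F (u t) (deriv u t) :=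
    (eventually_hasDerivAt_comp_curve hS hF hu hut).mono fun t ht => ht.deriv
  rw [h1.deriv_eq]
  exact (hasDerivAt_deriv_comp_curve hS hF hu hut).deriv

/-- For the metric induced by an immersion `F`, the Euler-Lagrange equation of `u` in the
direction `z` says that the acceleration of `F ∘ u` is orthogonal to `∂_z F`. -/
theorem eulerLagrange_iff {V : Type*} [NormedAddCommGroup V] [InnerProductSpace ℝ V] {F : X → V}
    (hS : IsOpen S) (hF : ContDiffOn ℝ ∞ F S)
    (hu : ContDiffAt ℝ 2 u t₀) (hut : u t₀ ∈ S) (z : X) :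
    HasDerivAt (fun t => inner ℝ (fderiv ℝ F (u t) (deriv u t)) (fderiv ℝ F (u t) z))
      (1 / 2 * fderiv ℝ (fun e => inner ℝ (fderiv ℝ F e (deriv u t₀)) (fderiv ℝ F e (deriv u t₀)))
        (u t₀) z) t₀ ↔
      inner ℝ (deriv (deriv fun t => F (u t)) t₀) (fderiv ℝ F (u t₀) z) = 0 := by
  have h1 : ContDiffAt ℝ 1 (fderiv ℝ F) (u t₀) :=
    (hF.contDiffAt (hS.mem_nhds hut)).fderiv_right (by norm_cast)
  have h2 := (h1.differentiableAt (by simp)).hasFDerivAt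
  set w := deriv u t₀ with hw
  have h3 : HasFDerivAt (fun e => fderiv ℝ F e w) _ (u t₀) :=
    h2.clm_apply (hasFDerivAt_const w _)
  have h4 := (h3.inner ℝ h3).fderiv
  have h5 : HasDerivAt (fun t => fderiv ℝ F (u t) z) _ t₀ :=
    (hasDerivAt_fderiv_comp_curve hS hF hu hut).clm_apply (hasDerivAt_const t₀ z)
  have h6 := (hasDerivAt_deriv_comp_curve hS hF hu hut).inner ℝ h5
  -- The product rule for the left-hand derivative leaves, besides the acceleration term, the inner
  -- product of `F' w` with `F'' w z`. Half the derivative of the metric along `z` gives the same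
  -- with `F'' z w`, so the two cancel by symmetry.
  have hsymm : fderiv ℝ (fderiv ℝ F) (u t₀) z w = fderiv ℝ (fderiv ℝ F) (u t₀) w z := by
    have h7 : ContDiffAt ℝ ∞ F (u t₀) := hF.contDiffAt (hS.mem_nhds hut)
    exact (h7.isSymmSndFDerivAt (by
      rw [minSmoothness_of_isRCLikeNormedField]
      exact WithTop.coe_le_coe.2 (le_top (a := (2 : ℕ∞))))) z w
  rw [deriv_deriv_comp_curve hS hF hu hut, h4]
  simp only [ContinuousLinearMap.comp_apply, _root_.add_apply,
    ContinuousLinearMap.flip_apply, ContinuousLinearMap.prod_apply, fderivInnerCLM_apply,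
    _root_.zero_apply, map_zero, zero_add, add_zero, ← hw, hsymm] at h6 ⊢
  rw [real_inner_comm (fderiv ℝ F (u t₀) w) (fderiv ℝ (fderiv ℝ F) (u t₀) w z)]
  constructor
  · intro h
    have := h.unique h6
    linarith
  · intro h
    rw [h, add_zero] at h6
    refine HasDerivAt.congr_deriv h6 ?_
    ring

end Curves

/-! ### The embedding read in charts -/

section Coordinates

variable {d p : ℕ} {M : Type*} [TopologicalSpace M] [ChartedSpace (EuclideanSpace ℝ (Fin d)) M]

/-- The map `ι` read in the chart at `y₀`. -/
def coordEmb (ι : M → EuclideanSpace ℝ (Fin p)) (y₀ : M) :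
    EuclideanSpace ℝ (Fin d) → EuclideanSpace ℝ (Fin p) :=
  fun e => ι ((extChartAt (𝓡 d) y₀).symm e)

variable [IsManifold (𝓡 d) ∞ M] [RiemannianBundle (fun x : M => TangentSpace (𝓡 d) x)]
  {ι : M → EuclideanSpace ℝ (Fin p)}

set_option linter.unusedSectionVars false

theorem IsIsometricEmbedding.contMDiff (hι : IsIsometricEmbedding (d := d) ι) :
    ContMDiff (𝓡 d) 𝓘(ℝ, EuclideanSpace ℝ (Fin p)) ∞ ι :=
  hι.1.contMDiff

theorem IsIsometricEmbedding.isEmbedding (hι : IsIsometricEmbedding (d := d) ι) :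
    IsEmbedding ι :=
  hι.1.isEmbedding

theorem IsIsometricEmbedding.differential_injective (hι : IsIsometricEmbedding (d := d) ι)
    (y : M) : Function.Injective (differential (d := d) ι y) := by
  rw [injective_iff_map_eq_zero]
  intro v hv
  rw [← norm_eq_zero, ← hι.2 y v, hv, norm_zero]

theorem IsIsometricEmbedding.inner_differential (hι : IsIsometricEmbedding (d := d) ι) (y : M)
    (v w : TangentSpace (𝓡 d) y) :
    inner ℝ (differential (d := d) ι y v) (differential (d := d) ι y w) = inner ℝ v w := by
  rw [real_inner_eq_norm_add_mul_self_sub_norm_mul_self_sub_norm_mul_self_div_two,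
    real_inner_eq_norm_add_mul_self_sub_norm_mul_self_sub_norm_mul_self_div_two, ← map_add,
    hι.2, hι.2, hι.2]

theorem IsIsometricEmbedding.contDiffOn_coordEmb (hι : IsIsometricEmbedding (d := d) ι) (y₀ : M) :
    ContDiffOn ℝ ∞ (coordEmb (d := d) ι y₀) (extChartAt (𝓡 d) y₀).target := by
  rw [← contMDiffOn_iff_contDiffOn]
  exact hι.contMDiff.comp_contMDiffOn (contMDiffOn_extChartAt_symm y₀)

theorem isInvertible_mfderiv_symm {y₀ : M} {e : EuclideanSpace ℝ (Fin d)}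
    (he : e ∈ (extChartAt (𝓡 d) y₀).target) :
    (mfderiv 𝓘(ℝ, EuclideanSpace ℝ (Fin d)) (𝓡 d) (extChartAt (𝓡 d) y₀).symm e).IsInvertible := by
  have h : IsManifold (𝓡 d) 1 M := IsManifold.of_le (n := ∞) (by simp)
  have := isInvertible_mfderivWithin_extChartAt_symm (I := 𝓡 d) he
  rwa [ModelWithCorners.range_eq_univ, mfderivWithin_univ] at this

theorem IsIsometricEmbedding.fderiv_coordEmb (hι : IsIsometricEmbedding (d := d) ι) {y₀ : M}
    {e : EuclideanSpace ℝ (Fin d)} (he : e ∈ (extChartAt (𝓡 d) y₀).target)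
    (v : EuclideanSpace ℝ (Fin d)) :
    fderiv ℝ (coordEmb (d := d) ι y₀) e v =
      differential (d := d) ι ((extChartAt (𝓡 d) y₀).symm e)
        (mfderiv 𝓘(ℝ, EuclideanSpace ℝ (Fin d)) (𝓡 d) (extChartAt (𝓡 d) y₀).symm e v) := by
  rw [← mfderiv_eq_fderiv]
  have h1 : MDifferentiableAt 𝓘(ℝ, EuclideanSpace ℝ (Fin d)) (𝓡 d) (extChartAt (𝓡 d) y₀).symm e :=
    ((contMDiffOn_extChartAt_symm (n := ∞) y₀).contMDiffAt
      ((isOpen_extChartAt_target y₀).mem_nhds he)).mdifferentiableAt (by simp)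
  have h2 : MDifferentiableAt (𝓡 d) 𝓘(ℝ, EuclideanSpace ℝ (Fin p)) ι
    ((extChartAt (𝓡 d) y₀).symm e) := hι.contMDiff.mdifferentiableAt (by simp)
  have := mfderiv_comp e h2 h1
  exact DFunLike.congr_fun this v

theorem IsIsometricEmbedding.fderiv_coordEmb_injective (hι : IsIsometricEmbedding (d := d) ι)
    {y₀ : M} {e : EuclideanSpace ℝ (Fin d)} (he : e ∈ (extChartAt (𝓡 d) y₀).target) :
    Function.Injective (fderiv ℝ (coordEmb (d := d) ι y₀) e) := by
  intro v w h
  rw [hι.fderiv_coordEmb he, hι.fderiv_coordEmb he] at h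
  exact (isInvertible_mfderiv_symm he).injective (hι.differential_injective _ h)

theorem IsIsometricEmbedding.exists_fderiv_coordEmb (hι : IsIsometricEmbedding (d := d) ι)
    {y₀ : M} {e : EuclideanSpace ℝ (Fin d)} (he : e ∈ (extChartAt (𝓡 d) y₀).target)
    (v : TangentSpace (𝓡 d) ((extChartAt (𝓡 d) y₀).symm e)) :
    ∃ z, fderiv ℝ (coordEmb (d := d) ι y₀) e z = differential (d := d) ι _ v := by
  obtain ⟨z, hz⟩ := (isInvertible_mfderiv_symm he).bijective.2 v
  exact ⟨z, (hι.fderiv_coordEmb he z).trans (congrArg _ hz)⟩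

/-- The intrinsic metric in coordinates is the first fundamental form of `coordEmb`, so that
`eulerLagrange_iff` applies to the geodesic equation. -/
theorem IsIsometricEmbedding.chartMetric_eq (hι : IsIsometricEmbedding (d := d) ι) {y₀ : M}
    {e : EuclideanSpace ℝ (Fin d)} (he : e ∈ (extChartAt (𝓡 d) y₀).target)
    (v w : EuclideanSpace ℝ (Fin d)) :
    chartMetric y₀ e v w = inner ℝ (fderiv ℝ (coordEmb (d := d) ι y₀) e v)
      (fderiv ℝ (coordEmb (d := d) ι y₀) e w) := by
  rw [hι.fderiv_coordEmb he, hι.fderiv_coordEmb he, hι.inner_differential]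
  rfl

/-- A `C²` curve is a geodesic if and only if the acceleration of its image in `ℝ^p` is normal to
the image of `M`. -/
theorem IsIsometricEmbedding.isGeodesic_iff (hι : IsIsometricEmbedding (d := d) ι) {γ : ℝ → M} :
    IsGeodesic (d := d) γ ↔ ContMDiff 𝓘(ℝ, ℝ) (𝓡 d) 2 γ ∧
      ∀ t, ∀ v : TangentSpace (𝓡 d) (γ t),
        inner ℝ (deriv (deriv fun t => ι (γ t)) t) (differential (d := d) ι (γ t) v) = 0 := by
  refine and_congr_right fun hγ => forall_congr' fun t₀ => ?_
  set φ := extChartAt (𝓡 d) (γ t₀) with hφ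
  let u : ℝ → EuclideanSpace ℝ (Fin d) := fun t => φ (γ t)
  have hS : IsOpen φ.target := isOpen_extChartAt_target _
  have hF := hι.contDiffOn_coordEmb (γ t₀)
  have hut : u t₀ ∈ φ.target := mem_extChartAt_target (γ t₀)
  have hu : ContDiffAt ℝ 2 u t₀ := by
    rw [← contMDiffAt_iff_contDiffAt]
    exact ((contMDiffAt_extChartAt (n := ∞)).of_le (by norm_cast)).comp t₀ hγ.contMDiffAt
  have hev : ∀ᶠ t in 𝓝 t₀, γ t ∈ φ.source :=
    hγ.continuous.continuousAt.eventually (extChartAt_source_mem_nhds (γ t₀))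
  have hc : (fun t => ι (γ t)) =ᶠ[𝓝 t₀] fun t => coordEmb (d := d) ι (γ t₀) (u t) := by
    filter_upwards [hev] with t ht
    simp only [coordEmb, u]
    rw [← hφ, φ.left_inv ht]
  rw [hc.deriv.deriv_eq]
  have hsymm : φ.symm (u t₀) = γ t₀ := φ.left_inv (mem_extChartAt_source _)
  have hev1 : ∀ z, (fun t => chartMetric (γ t₀) (u t) (deriv u t) z) =ᶠ[𝓝 t₀]
      fun t => inner ℝ (fderiv ℝ (coordEmb (d := d) ι (γ t₀)) (u t) (deriv u t))
        (fderiv ℝ (coordEmb (d := d) ι (γ t₀)) (u t) z) := fun z => by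
    filter_upwards [hu.continuousAt.eventually (hS.mem_nhds hut)] with t ht
    exact hι.chartMetric_eq ht _ _
  have hev2 : (fun e => chartMetric (γ t₀) e (deriv u t₀) (deriv u t₀)) =ᶠ[𝓝 (u t₀)]
      fun e => inner ℝ (fderiv ℝ (coordEmb (d := d) ι (γ t₀)) e (deriv u t₀))
        (fderiv ℝ (coordEmb (d := d) ι (γ t₀)) e (deriv u t₀)) := by
    filter_upwards [hS.mem_nhds hut] with e he
    exact hι.chartMetric_eq he _ _
  have key : ∀ z, HasDerivAt (fun t => chartMetric (γ t₀) (u t) (deriv u t) z)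
      (1 / 2 * fderiv ℝ (fun e => chartMetric (γ t₀) e (deriv u t₀) (deriv u t₀)) (u t₀) z) t₀ ↔
      inner ℝ (deriv (deriv fun t => coordEmb (d := d) ι (γ t₀) (u t)) t₀)
        (fderiv ℝ (coordEmb (d := d) ι (γ t₀)) (u t₀) z) = 0 := fun z => by
    rw [(hev1 z).hasDerivAt_iff, hev2.fderiv_eq]
    exact eulerLagrange_iff hS hF hu hut z
  change (∀ z, HasDerivAt (fun t => chartMetric (γ t₀) (u t) (deriv u t) z)
      (1 / 2 * fderiv ℝ (fun e => chartMetric (γ t₀) e (deriv u t₀) (deriv u t₀)) (u t₀) z) t₀) ↔ _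
  simp only [key]
  constructor
  · intro h v
    obtain ⟨z, hz⟩ : ∃ z, fderiv ℝ (coordEmb (d := d) ι (γ t₀)) (u t₀) z =
        differential (d := d) ι (γ t₀) v := by
      have := hι.exists_fderiv_coordEmb hut
      rw [← hφ, hsymm] at this
      exact this v
    rw [← hz]
    exact h z
  · intro h z
    rw [hι.fderiv_coordEmb hut]
    rw [← hφ, hsymm]
    exact h _

end Coordinates

/-! ### The second fundamental form -/

section NormalHessian

set_option synthInstance.maxHeartbeats 200000

variable {X V : Type*} [NormedAddCommGroup X] [InnerProductSpace ℝ X] [FiniteDimensional ℝ X]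
  [NormedAddCommGroup V] [InnerProductSpace ℝ V] [FiniteDimensional ℝ V]

/-- The second fundamental form of the immersion `F` at the point of coordinates `e`, as a bilinear
form on the ambient space. -/
def normalHessian (F : X → V) (e : X) : V →L[ℝ] V →L[ℝ] V :=
  ((ContinuousLinearMap.compL ℝ V X V).flip (leastSquaresInv (fderiv ℝ F e))) ∘L
    ((ContinuousLinearMap.compL ℝ X V V)
      (ContinuousLinearMap.id ℝ V - fderiv ℝ F e ∘L leastSquaresInv (fderiv ℝ F e))) ∘L
    (fderiv ℝ (fderiv ℝ F) e) ∘L leastSquaresInv (fderiv ℝ F e)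

/-- The tangential part of the second derivative of the immersion `F`: the geodesics of the
induced metric are the solutions of `u'' = - tangentialHessian F u u' u'`. -/
def tangentialHessian (F : X → V) (e : X) : X →L[ℝ] X →L[ℝ] X :=
  ((ContinuousLinearMap.compL ℝ X V X) (leastSquaresInv (fderiv ℝ F e))) ∘L
    fderiv ℝ (fderiv ℝ F) e

variable {F : X → V} {S : Set X}

/-- The least squares inverse recovers `z` from the tangent vector `F' z`. What remains is the
second derivative minus its orthogonal projection to the tangent space. -/
theorem normalHessian_apply {e : X} (he : Function.Injective (fderiv ℝ F e)) (z : X) :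
    normalHessian F e (fderiv ℝ F e z) (fderiv ℝ F e z) =
      fderiv ℝ (fderiv ℝ F) e z z - fderiv ℝ F e (tangentialHessian F e z z) := by
  simp [normalHessian, tangentialHessian, leastSquaresInv_apply_apply he]

theorem contDiffOn_leastSquaresInv_fderiv (hS : IsOpen S) (hF : ContDiffOn ℝ ∞ F S)
    (hinj : ∀ e ∈ S, Function.Injective (fderiv ℝ F e)) :
    ContDiffOn ℝ ∞ (fun e => leastSquaresInv (fderiv ℝ F e)) S := fun e he => by
  have h1 : ContDiffOn ℝ ∞ (fderiv ℝ F) S := hF.fderiv_of_isOpen hS (by simp)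
  exact ((contDiffAt_leastSquaresInv (hinj e he)).comp e
    (h1.contDiffAt (hS.mem_nhds he))).contDiffWithinAt

theorem contDiffOn_normalHessian (hS : IsOpen S) (hF : ContDiffOn ℝ ∞ F S)
    (hinj : ∀ e ∈ S, Function.Injective (fderiv ℝ F e)) :
    ContDiffOn ℝ ∞ (normalHessian F) S := by
  have h1 : ContDiffOn ℝ ∞ (fderiv ℝ F) S := hF.fderiv_of_isOpen hS (by simp)
  have h2 : ContDiffOn ℝ ∞ (fderiv ℝ (fderiv ℝ F)) S := h1.fderiv_of_isOpen hS (by simp)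
  have h3 := contDiffOn_leastSquaresInv_fderiv hS hF hinj
  exact ((ContinuousLinearMap.contDiff _).comp_contDiffOn h3).clm_comp
    (((ContinuousLinearMap.contDiff _).comp_contDiffOn
      (contDiffOn_const.sub (h1.clm_comp h3))).clm_comp (h2.clm_comp h3))

theorem contDiffOn_tangentialHessian (hS : IsOpen S) (hF : ContDiffOn ℝ ∞ F S)
    (hinj : ∀ e ∈ S, Function.Injective (fderiv ℝ F e)) :
    ContDiffOn ℝ ∞ (tangentialHessian F) S := by
  have h1 : ContDiffOn ℝ ∞ (fderiv ℝ F) S := hF.fderiv_of_isOpen hS (by simp)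
  have h2 : ContDiffOn ℝ ∞ (fderiv ℝ (fderiv ℝ F)) S := h1.fderiv_of_isOpen hS (by simp)
  have h3 := contDiffOn_leastSquaresInv_fderiv hS hF hinj
  exact ((ContinuousLinearMap.contDiff _).comp_contDiffOn h3).clm_comp h2

theorem inner_apply_hessian_sub {e : X} (he : Function.Injective (fderiv ℝ F e)) (z y : X) :
    inner ℝ (fderiv ℝ (fderiv ℝ F) e z z - fderiv ℝ F e (tangentialHessian F e z z))
      (fderiv ℝ F e y) = 0 := by
  rw [real_inner_comm]
  exact inner_apply_sub_leastSquaresInv he y _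

end NormalHessian

/-- Smooth functions satisfying local convex constraints exist globally. -/
theorem exists_contDiff_forall_mem_convex_of_local {X W : Type*} [NormedAddCommGroup X]
    [NormedSpace ℝ X] [FiniteDimensional ℝ X] [NormedAddCommGroup W] [NormedSpace ℝ W]
    {t : X → Set W} (ht : ∀ x, Convex ℝ (t x))
    (hloc : ∀ x, ∃ U ∈ 𝓝 x, ∃ g : X → W, ContDiffOn ℝ ∞ g U ∧ ∀ y ∈ U, g y ∈ t y) :
    ∃ g : X → W, ContDiff ℝ ∞ g ∧ ∀ x, g x ∈ t x := by
  obtain ⟨g, hg⟩ := exists_contMDiffMap_forall_mem_convex_of_local (n := ⊤) 𝓘(ℝ, X) ht fun x => by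
    obtain ⟨U, hU, g, hg, h⟩ := hloc x
    exact ⟨U, hU, g, hg.contMDiffOn, h⟩
  exact ⟨g, g.contMDiff.contDiff, hg⟩

/-! ### Smooth extension of the second fundamental form to the ambient space. -/

section Extension

set_option synthInstance.maxHeartbeats 200000

set_option linter.unusedSectionVars false

variable {d p : ℕ} {M : Type*} [TopologicalSpace M] [ChartedSpace (EuclideanSpace ℝ (Fin d)) M]
  [IsManifold (𝓡 d) ∞ M] [RiemannianBundle (fun x : M => TangentSpace (𝓡 d) x)]
  {ι : M → EuclideanSpace ℝ (Fin p)}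

/-- Smooth functions on the ambient space which extend the coordinates of `M`. -/
theorem IsIsometricEmbedding.exists_smooth_coordinates (hι : IsIsometricEmbedding (d := d) ι)
    (y₀ : M) : ∃ (L : EuclideanSpace ℝ (Fin p) → EuclideanSpace ℝ (Fin d))
      (U : Set (EuclideanSpace ℝ (Fin p))), IsOpen U ∧ ι y₀ ∈ U ∧ ContDiffOn ℝ ∞ L U ∧
      MapsTo L U (extChartAt (𝓡 d) y₀).target ∧
      ∀ y, ι y ∈ U → y ∈ (extChartAt (𝓡 d) y₀).source ∧ L (ι y) = extChartAt (𝓡 d) y₀ y := by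
  set φ := extChartAt (𝓡 d) y₀ with hφ
  obtain ⟨L, U, S, hU, hyU, hL, hS, hyS, hSφ, hLS, hLF⟩ := exists_smooth_leftInverse
    (isOpen_extChartAt_target y₀) (hι.contDiffOn_coordEmb y₀) (mem_extChartAt_target (I := 𝓡 d) y₀)
    (hι.fderiv_coordEmb_injective (mem_extChartAt_target (I := 𝓡 d) y₀))
  have hFy : ∀ y ∈ φ.source, coordEmb (d := d) ι y₀ (φ y) = ι y := fun y hy => by
    simp only [coordEmb]
    rw [← hφ, φ.left_inv hy]
  -- As `ι` is a topological embedding, some ambient open `W` cuts out exactly this piece of the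
  -- chart domain. This excludes distant parts of `M` whose images pass near `ι y₀`.
  obtain ⟨W, hW, hWO⟩ := hι.isEmbedding.isOpen_iff.1
    ((continuousOn_extChartAt (I := 𝓡 d) y₀).isOpen_inter_preimage
      (isOpen_extChartAt_source y₀) hS)
  have hy₀ : y₀ ∈ φ.source := mem_extChartAt_source y₀
  refine ⟨L, U ∩ W, hU.inter hW, ⟨hFy y₀ hy₀ ▸ hyU, ?_⟩, hL.mono inter_subset_left,
    fun x hx => hSφ (hLS hx.1), fun y hy => ?_⟩
  · change y₀ ∈ ι ⁻¹' W
    rw [hWO]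
    exact ⟨hy₀, hyS⟩
  · have : y ∈ ι ⁻¹' W := hy.2
    rw [hWO] at this
    refine ⟨this.1, ?_⟩
    rw [← hFy y this.1]
    exact hLF _ this.2

/-- The curve `u` of coordinates in the chart at `y₀` of a `C²` curve in `M`. -/
theorem contDiffAt_coord_curve {γ : ℝ → M} {t₀ : ℝ}
    (hγ : ContMDiffAt 𝓘(ℝ, ℝ) (𝓡 d) 2 γ t₀) {y₀ : M} (hy : γ t₀ ∈ (extChartAt (𝓡 d) y₀).source) :
    ContDiffAt ℝ 2 (fun t => extChartAt (𝓡 d) y₀ (γ t)) t₀ := by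
  rw [← contMDiffAt_iff_contDiffAt]
  rw [extChartAt_source] at hy
  exact ((contMDiffAt_extChartAt' (n := ∞) hy).of_le (by norm_cast)).comp t₀ hγ

theorem eventuallyEq_coordEmb_curve {γ : ℝ → M} {t₀ : ℝ} (hγ : ContinuousAt γ t₀)
    {y₀ : M} (hy : γ t₀ ∈ (extChartAt (𝓡 d) y₀).source) :
    (fun t => ι (γ t)) =ᶠ[𝓝 t₀] fun t => coordEmb (d := d) ι y₀ (extChartAt (𝓡 d) y₀ (γ t)) := by
  filter_upwards [hγ.eventually ((isOpen_extChartAt_source y₀).mem_nhds hy)] with t ht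
  simp only [coordEmb]
  rw [(extChartAt (𝓡 d) y₀).left_inv ht]

/-- `B` is a smooth extension to the ambient space of the second fundamental form of `ι(M)`,
which is characterised by its values on the velocities of curves. -/
def IsSecondFundamentalForm (d : ℕ) {p : ℕ} {M : Type*} [TopologicalSpace M]
    [ChartedSpace (EuclideanSpace ℝ (Fin d)) M] (ι : M → EuclideanSpace ℝ (Fin p))
    (x : EuclideanSpace ℝ (Fin p)) (B : EuclideanSpace ℝ (Fin p) →L[ℝ]
      EuclideanSpace ℝ (Fin p) →L[ℝ] EuclideanSpace ℝ (Fin p)) : Prop :=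
  ∀ (γ : ℝ → M) (t₀ : ℝ), ContMDiffAt 𝓘(ℝ, ℝ) (𝓡 d) 2 γ t₀ → ι (γ t₀) = x →
    (∃ v, deriv (deriv fun t => ι (γ t)) t₀ -
      B (deriv (fun t => ι (γ t)) t₀) (deriv (fun t => ι (γ t)) t₀) =
        differential (d := d) ι (γ t₀) v) ∧
    ∀ v, inner ℝ (B (deriv (fun t => ι (γ t)) t₀) (deriv (fun t => ι (γ t)) t₀))
      (differential (d := d) ι (γ t₀) v) = 0

/-- Both requirements, a tangential difference and a normal value, are affine in `B`. Convexity
allows gluing by a partition of unity. -/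
theorem convex_isSecondFundamentalForm (x : EuclideanSpace ℝ (Fin p)) :
    Convex ℝ {B | IsSecondFundamentalForm d ι x B} := by
  intro B₁ h₁ B₂ h₂ a b ha hb hab γ t₀ hγ hx
  obtain ⟨⟨v₁, hv₁⟩, h₁⟩ := h₁ γ t₀ hγ hx
  obtain ⟨⟨v₂, hv₂⟩, h₂⟩ := h₂ γ t₀ hγ hx
  set w := deriv (fun t => ι (γ t)) t₀
  refine ⟨⟨a • v₁ + b • v₂, ?_⟩, fun v => ?_⟩
  · rw [map_add, map_smul, map_smul, ← hv₁, ← hv₂]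
    have : deriv (deriv fun t => ι (γ t)) t₀ = (a + b) • deriv (deriv fun t => ι (γ t)) t₀ := by
      rw [hab, one_smul]
    nth_rewrite 1 [this]
    simp only [_root_.add_apply, _root_.smul_apply, add_smul, smul_sub]
    abel
  · simp only [_root_.add_apply, _root_.smul_apply, inner_add_left, real_inner_smul_left,
      h₁ v, h₂ v, mul_zero, add_zero]

/-- With `u` the coordinates of the curve, the acceleration is `F'' u' u' + F' u''`. It differs from
the normal part of `F'' u' u'` by a vector in the range of `F'`, which is the tangent space. -/
theorem IsIsometricEmbedding.isSecondFundamentalForm_normalHessian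
    (hι : IsIsometricEmbedding (d := d) ι) {y₀ y : M} (hy : y ∈ (extChartAt (𝓡 d) y₀).source) :
    IsSecondFundamentalForm d ι (ι y)
      (normalHessian (coordEmb (d := d) ι y₀) (extChartAt (𝓡 d) y₀ y)) := by
  intro γ t₀ hγ hx
  obtain rfl : γ t₀ = y := hι.isEmbedding.injective hx
  set φ := extChartAt (𝓡 d) y₀ with hφ
  set F := coordEmb (d := d) ι y₀ with hF
  have hS : IsOpen φ.target := isOpen_extChartAt_target y₀
  have hFS : ContDiffOn ℝ ∞ F φ.target := hι.contDiffOn_coordEmb y₀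
  have hu : ContDiffAt ℝ 2 (fun t => φ (γ t)) t₀ := contDiffAt_coord_curve hγ hy
  have hut : φ (γ t₀) ∈ φ.target := φ.map_source hy
  have hc := eventuallyEq_coordEmb_curve (ι := ι) hγ.continuousAt hy
  have hinj : Function.Injective (fderiv ℝ F (φ (γ t₀))) := hι.fderiv_coordEmb_injective hut
  have hd : deriv (fun t => ι (γ t)) t₀ =
      fderiv ℝ F (φ (γ t₀)) (deriv (fun t => φ (γ t)) t₀) := by
    rw [hc.deriv_eq]
    exact (eventually_hasDerivAt_comp_curve hS hFS hu hut).self_of_nhds.deriv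
  have hdd : deriv (deriv fun t => ι (γ t)) t₀ =
      fderiv ℝ (fderiv ℝ F) (φ (γ t₀)) (deriv (fun t => φ (γ t)) t₀) (deriv (fun t => φ (γ t)) t₀)
        + fderiv ℝ F (φ (γ t₀)) (deriv (deriv fun t => φ (γ t)) t₀) := by
    rw [hc.deriv.deriv_eq]
    exact deriv_deriv_comp_curve hS hFS hu hut
  have hsymm : φ.symm (φ (γ t₀)) = γ t₀ := φ.left_inv hy
  rw [hdd, hd, normalHessian_apply hinj]
  have hrange : ∀ z, ∃ v, fderiv ℝ F (φ (γ t₀)) z = differential (d := d) ι (γ t₀) v := fun z => by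
    rw [hF, hι.fderiv_coordEmb hut, ← hφ, hsymm]
    exact ⟨_, rfl⟩
  constructor
  · obtain ⟨v, hv⟩ := hrange (deriv (deriv fun t => φ (γ t)) t₀ + tangentialHessian F (φ (γ t₀))
      (deriv (fun t => φ (γ t)) t₀) (deriv (fun t => φ (γ t)) t₀))
    refine ⟨v, ?_⟩
    rw [← hv, map_add]
    abel
  · intro v
    obtain ⟨z, hz⟩ : ∃ z, fderiv ℝ F (φ (γ t₀)) z = differential (d := d) ι (γ t₀) v := by
      have := hι.exists_fderiv_coordEmb hut
      rw [← hφ, hsymm] at this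
      exact this v
    rw [← hz]
    exact inner_apply_hessian_sub hinj _ _

/-- Near a point of the image, `normalHessian` is extended by composing it with smooth ambient
coordinates `L`. Off the image, which is closed by compactness, the condition is void and zero will
do. -/
theorem IsIsometricEmbedding.exists_secondFundamentalForm [CompactSpace M]
    (hι : IsIsometricEmbedding (d := d) ι) :
    ∃ B : EuclideanSpace ℝ (Fin p) → EuclideanSpace ℝ (Fin p) →L[ℝ]
      EuclideanSpace ℝ (Fin p) →L[ℝ] EuclideanSpace ℝ (Fin p),
      ContDiff ℝ ∞ B ∧ ∀ x, IsSecondFundamentalForm d ι x (B x) := by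
  refine exists_contDiff_forall_mem_convex_of_local
    (t := fun x => {B | IsSecondFundamentalForm d ι x B})
    (fun x => convex_isSecondFundamentalForm x) (fun x => ?_)
  · by_cases hx : x ∈ range ι
    · obtain ⟨y₀, rfl⟩ := hx
      obtain ⟨L, U, hU, hyU, hL, hLU, hy⟩ := hι.exists_smooth_coordinates y₀
      have hsmooth : ContDiffOn ℝ ∞ (fun x => normalHessian (coordEmb (d := d) ι y₀) (L x)) U :=
        ContDiffOn.comp (contDiffOn_normalHessian (isOpen_extChartAt_target y₀)
          (hι.contDiffOn_coordEmb y₀) fun e he => hι.fderiv_coordEmb_injective he) hL hLU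
      refine ⟨U, hU.mem_nhds hyU, fun x => normalHessian (coordEmb (d := d) ι y₀) (L x),
        hsmooth, ?_⟩
      · intro x hx γ t₀ hγ hx'
        subst hx'
        obtain ⟨h1, h2⟩ := hy _ hx
        have := hι.isSecondFundamentalForm_normalHessian h1 γ t₀ hγ rfl
        rwa [← h2] at this
    · refine ⟨(range ι)ᶜ, (isCompact_range hι.isEmbedding.continuous).isClosed.isOpen_compl.mem_nhds
        hx, fun _ => 0, contDiffOn_const, ?_⟩
      rintro x hx γ t₀ - rfl
      exact absurd (mem_range_self _) hx

/-- Curves whose acceleration is normal satisfy the geodesic equation in the ambient space. -/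
theorem IsSecondFundamentalForm.deriv_deriv_eq {γ : ℝ → M} {t₀ : ℝ}
    {B : EuclideanSpace ℝ (Fin p) →L[ℝ] EuclideanSpace ℝ (Fin p) →L[ℝ] EuclideanSpace ℝ (Fin p)}
    (hB : IsSecondFundamentalForm d ι (ι (γ t₀)) B) (hγ : ContMDiffAt 𝓘(ℝ, ℝ) (𝓡 d) 2 γ t₀)
    (h : ∀ v, inner ℝ (deriv (deriv fun t => ι (γ t)) t₀)
      (differential (d := d) ι (γ t₀) v) = 0) :
    deriv (deriv fun t => ι (γ t)) t₀ =
      B (deriv (fun t => ι (γ t)) t₀) (deriv (fun t => ι (γ t)) t₀) := by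
  obtain ⟨⟨v, hv⟩, h'⟩ := hB γ t₀ hγ rfl
  -- The difference of the two sides is tangential by `hv` and orthogonal to all tangent vectors by
  -- `h` and `h'`, hence zero.
  rw [← sub_eq_zero, ← inner_self_eq_zero (𝕜 := ℝ)]
  nth_rewrite 2 [hv]
  rw [inner_sub_left, h, h', sub_zero]

end Extension

/-! ### Flows of bounded Lipschitz vector fields -/

section Flow

variable {X : Type*} [NormedAddCommGroup X] [NormedSpace ℝ X]

theorem exists_hasDerivAt_Ioo_of_bounded_lipschitz [CompleteSpace X] {Y : X → X} {K : NNReal}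
    (hK : LipschitzWith K Y) {C : NNReal} (hC : ∀ x, ‖Y x‖ ≤ C) (x : X) {T : NNReal} (hT : 0 < T) :
    ∃ α : ℝ → X, α 0 = x ∧ ∀ t ∈ Ioo (-(T : ℝ)) T, HasDerivAt α (Y (α t)) t := by
  have hT' : (0 : ℝ) < T := hT
  have h0 : (0 : ℝ) ∈ Icc (-(T : ℝ)) T := ⟨by linarith, hT'.le⟩
  -- At speed at most `C` a solution cannot leave the ball of radius `C * T` within time `T`, so
  -- Picard-Lindelöf needs no smallness of `T`.
  have hpl : IsPicardLindelof (fun _ => Y) (⟨0, h0⟩ : Icc (-(T : ℝ)) T) x (C * T) 0 C K := by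
    refine IsPicardLindelof.of_time_independent (fun y _ => hC y) hK.lipschitzOnWith ?_
    simp
  obtain ⟨α, h1, h2⟩ := hpl.exists_eq_forall_mem_Icc_hasDerivWithinAt (x := x) (by simp)
  exact ⟨α, h1, fun t ht => (h2 t (Ioo_subset_Icc_self ht)).hasDerivAt (Icc_mem_nhds ht.1 ht.2)⟩

/-- A bounded Lipschitz vector field is complete. -/
theorem exists_global_integralCurve [CompleteSpace X] {Y : X → X} {K : NNReal}
    (hK : LipschitzWith K Y) {C : NNReal} (hC : ∀ x, ‖Y x‖ ≤ C) (x : X) :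
    ∃ α : ℝ → X, α 0 = x ∧ ∀ t, HasDerivAt α (Y (α t)) t := by
  have h := fun n : ℕ => exists_hasDerivAt_Ioo_of_bounded_lipschitz hK hC x
    (T := (n : NNReal) + 1) (by positivity)
  choose α h0 hα using h
  have hagree : ∀ m n : ℕ, m ≤ n → ∀ t ∈ Ioo (-((m : ℝ) + 1)) (m + 1), α m t = α n t := by
    intro m n hmn t ht
    have hmn' : (m : ℝ) ≤ n := by exact_mod_cast hmn
    refine ODE_solution_unique_of_mem_Ioo (v := fun _ => Y) (s := fun _ => univ) (K := K)
      (a := -((m : ℝ) + 1)) (b := m + 1) (t₀ := 0)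
      (fun t _ => hK.lipschitzOnWith) ⟨by linarith [ht.1, ht.2], by positivity⟩
      (fun t ht => ⟨hα m t (by simpa using ht), mem_univ _⟩)
      (fun t ht => ⟨hα n t ?_, mem_univ _⟩) ((h0 m).trans (h0 n).symm) ht
    simp only [NNReal.coe_add, NNReal.coe_natCast, NNReal.coe_one]
    exact ⟨by linarith [ht.1], by linarith [ht.2]⟩
  have hagree' : ∀ m n : ℕ, ∀ t ∈ Ioo (-((m : ℝ) + 1)) (m + 1), t ∈ Ioo (-((n : ℝ) + 1)) (n + 1) →
      α m t = α n t := by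
    intro m n t hm hn
    rcases le_total m n with h | h
    · exact hagree m n h t hm
    · exact (hagree n m h t hn).symm
  -- The solution of index `n` lives on `(-(n + 1), n + 1)`; the extra one keeps `t` in the open
  -- interval of index `⌈|t|⌉₊`.
  have hmem : ∀ t : ℝ, t ∈ Ioo (-((⌈|t|⌉₊ : ℝ) + 1)) (⌈|t|⌉₊ + 1) := fun t => by
    have := Nat.le_ceil |t|
    constructor <;> linarith [abs_le.1 (le_refl |t|)]
  refine ⟨fun t => α ⌈|t|⌉₊ t, by simp [h0], fun t => ?_⟩
  have h1 := hα ⌈|t|⌉₊ t (by simpa using hmem t)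
  refine h1.congr_of_eventuallyEq ?_
  filter_upwards [isOpen_Ioo.mem_nhds (hmem t)] with s hs
  exact hagree' _ _ s (hmem s) hs

theorem integralCurve_unique {Y : X → X} {K : NNReal} (hK : LipschitzWith K Y) {α β : ℝ → X}
    (hα : ∀ t, HasDerivAt α (Y (α t)) t) (hβ : ∀ t, HasDerivAt β (Y (β t)) t) {t₀ : ℝ}
    (h : α t₀ = β t₀) : α = β :=
  ODE_solution_unique_univ (v := fun _ => Y) (s := fun _ => univ) (K := K)
    (fun _ => hK.lipschitzOnWith) (fun t => ⟨hα t, mem_univ _⟩) (fun t => ⟨hβ t, mem_univ _⟩) h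

/-- The time-one map of a Lipschitz vector field is Lipschitz. -/
theorem lipschitzWith_timeOne {Y : X → X} {K : NNReal} (hK : LipschitzWith K Y) {Φ : X → ℝ → X}
    (h0 : ∀ x, Φ x 0 = x) (hΦ : ∀ x t, HasDerivAt (Φ x) (Y (Φ x t)) t) :
    LipschitzWith (Real.exp K).toNNReal fun x => Φ x 1 := by
  refine LipschitzWith.of_dist_le_mul fun x y => ?_
  have hc : ∀ x, Continuous (Φ x) := fun x =>
    continuous_iff_continuousAt.2 fun t => (hΦ x t).continuousAt
  have := dist_le_of_trajectories_ODE (v := fun _ => Y) (f := Φ x) (g := Φ y) (a := 0) (b := 1)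
    (fun _ => hK) (hc x).continuousOn (fun t _ => (hΦ x t).hasDerivWithinAt) (hc y).continuousOn
    (fun t _ => (hΦ y t).hasDerivWithinAt) le_rfl 1 (by simp)
  rw [h0, h0, sub_zero, mul_one, mul_comm] at this
  rwa [Real.coe_toNNReal _ (Real.exp_pos _).le]

/-- Integral curves of `C¹` vector fields are `C²`. -/
theorem contDiffOn_two_of_hasDerivAt {Y : X → X} {O : Set X} (hY : ContDiffOn ℝ 1 Y O)
    {α : ℝ → X} {I : Set ℝ} (hI : IsOpen I) (hαO : MapsTo α I O)
    (hα : ∀ t ∈ I, HasDerivAt α (Y (α t)) t) : ContDiffOn ℝ 2 α I := by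
  have hd : ∀ t ∈ I, deriv α t = Y (α t) := fun t ht => (hα t ht).deriv
  have hdiff : DifferentiableOn ℝ α I := fun t ht =>
    (hα t ht).differentiableAt.differentiableWithinAt
  have h1 : ContDiffOn ℝ 1 α I := by
    have : ContDiffOn ℝ (0 + 1) α I := by
      rw [contDiffOn_succ_iff_deriv_of_isOpen hI]
      refine ⟨hdiff, by simp, contDiffOn_zero.2 ?_⟩
      exact (hY.continuousOn.comp hdiff.continuousOn hαO).congr hd
    simpa using this
  have : ContDiffOn ℝ (1 + 1) α I := by
    rw [contDiffOn_succ_iff_deriv_of_isOpen hI]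
    exact ⟨hdiff, by simp, (hY.comp h1 hαO).congr hd⟩
  simpa [one_add_one_eq_two] using this

end Flow

/-! ### The geodesic flow in the ambient space -/

section GeodesicField

variable {V : Type*} [NormedAddCommGroup V] [NormedSpace ℝ V]

/-- The second order vector field `x'' = B x x' x'`. -/
def geodesicField (B : V → V →L[ℝ] V →L[ℝ] V) (q : V × V) : V × V :=
  (q.2, B q.1 q.2 q.2)

set_option synthInstance.maxHeartbeats 200000 in
theorem contDiff_geodesicField {B : V → V →L[ℝ] V →L[ℝ] V} (hB : ContDiff ℝ ∞ B) :
    ContDiff ℝ ∞ (geodesicField B) :=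
  contDiff_snd.prodMk (((hB.comp contDiff_fst).clm_apply contDiff_snd).clm_apply contDiff_snd)

/-- A smooth vector field agrees on any ball with one which is bounded and Lipschitz. -/
theorem exists_bounded_lipschitz_eqOn_ball {X : Type*} [NormedAddCommGroup X] [NormedSpace ℝ X]
    [FiniteDimensional ℝ X] {Y : X → X} (hY : ContDiff ℝ ∞ Y) (R : ℝ) :
    ∃ (Y' : X → X) (K C : NNReal), ContDiff ℝ ∞ Y' ∧ LipschitzWith K Y' ∧ (∀ x, ‖Y' x‖ ≤ C) ∧
      ∀ x, ‖x‖ ≤ R → Y' x = Y x := by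
  have hR : 0 < |R| + 1 := by positivity
  let χ : ContDiffBump (0 : X) := ⟨|R| + 1, |R| + 2, hR, by linarith⟩
  have hs : ContDiff ℝ ∞ fun x => χ x • Y x := χ.contDiff.smul hY
  have hc : HasCompactSupport fun x => χ x • Y x := χ.hasCompactSupport.smul_right
  obtain ⟨K, hK⟩ := hs.lipschitzWith_of_hasCompactSupport hc (by simp)
  obtain ⟨C, hC⟩ := hc.exists_bound_of_continuous hs.continuous
  refine ⟨_, K, C.toNNReal, hs, hK, fun x => (hC x).trans (Real.le_coe_toNNReal C), fun x hx => ?_⟩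
  have : χ x = 1 := χ.one_of_mem_closedBall (by
    rw [mem_closedBall_zero_iff]
    exact hx.trans ((le_abs_self R).trans (by simp [χ])))
  simp [this]

end GeodesicField

/-! ### Tangent spheres and local geodesics. -/

section Flow

variable {d p : ℕ} {M : Type*} [TopologicalSpace M] [ChartedSpace (EuclideanSpace ℝ (Fin d)) M]
  {ι : M → EuclideanSpace ℝ (Fin p)}

/-- The vectors of length `r` tangent to the image of `M`, together with their base points. -/
def tangentSphere (d : ℕ) {p : ℕ} {M : Type*} [TopologicalSpace M]
    [ChartedSpace (EuclideanSpace ℝ (Fin d)) M] (ι : M → EuclideanSpace ℝ (Fin p)) (r : ℝ) :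
    Set (EuclideanSpace ℝ (Fin p) × EuclideanSpace ℝ (Fin p)) :=
  {q | (∃ (y : M) (v : TangentSpace (𝓡 d) y), ι y = q.1 ∧ differential (d := d) ι y v = q.2) ∧
    ‖q.2‖ = r}

set_option linter.unusedSectionVars false

variable [IsManifold (𝓡 d) ∞ M] [RiemannianBundle (fun x : M => TangentSpace (𝓡 d) x)]

/-- Near `ι y₀` the map `F ∘ L` is a smooth retraction onto the image of `M`, and its differential
fixes tangent vectors. This equation survives limits and puts the limit vector in the range of `F'`,
so it is tangent. -/
theorem IsIsometricEmbedding.isClosed_tangentSphere [CompactSpace M]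
    (hι : IsIsometricEmbedding (d := d) ι) (r : ℝ) : IsClosed (tangentSphere d ι r) := by
  refine isClosed_of_closure_subset fun q hq => ?_
  obtain ⟨s, hs, hsq⟩ := mem_closure_iff_seq_limit.1 hq
  have hs1 : Tendsto (fun n => (s n).1) atTop (𝓝 q.1) := (continuous_fst.tendsto q).comp hsq
  have hs2 : Tendsto (fun n => (s n).2) atTop (𝓝 q.2) := (continuous_snd.tendsto q).comp hsq
  have hrange : q.1 ∈ range ι :=
    (isCompact_range hι.isEmbedding.continuous).isClosed.mem_of_tendsto hs1
      (Eventually.of_forall fun n => by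
        obtain ⟨⟨y, v, h, -⟩, -⟩ := hs n
        exact ⟨y, h⟩)
  obtain ⟨y₀, hy₀⟩ := hrange
  obtain ⟨L, U, hU, hyU, hL, hLU, hy⟩ := hι.exists_smooth_coordinates y₀
  set φ := extChartAt (𝓡 d) y₀ with hφ
  set F := coordEmb (d := d) ι y₀ with hF
  have hFS : ContDiffOn ℝ ∞ F φ.target := hι.contDiffOn_coordEmb y₀
  have hG : ContDiffOn ℝ ∞ (fun x => F (L x)) U := hFS.comp hL hLU
  have hfix : ∀ q' ∈ tangentSphere d ι r, q'.1 ∈ U →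
      fderiv ℝ (fun x => F (L x)) q'.1 q'.2 = q'.2 := by
    rintro ⟨x, w⟩ ⟨⟨y, v, rfl, rfl⟩, -⟩ hyU'
    obtain ⟨h1, h2⟩ := hy y hyU'
    have ht : φ y ∈ φ.target := φ.map_source h1
    have hsymm : φ.symm (φ y) = y := φ.left_inv h1
    obtain ⟨z, hz⟩ : ∃ z, fderiv ℝ F (φ y) z = differential (d := d) ι y v := by
      have := hι.exists_fderiv_coordEmb ht
      rw [← hφ, hsymm] at this
      exact this v
    have hFy : F (φ y) = ι y := by simp only [hF, coordEmb, ← hφ, hsymm]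
    have hFd : HasFDerivAt F (fderiv ℝ F (φ y)) (φ y) :=
      ((hFS.contDiffAt ((isOpen_extChartAt_target y₀).mem_nhds ht)).differentiableAt
        (by simp)).hasFDerivAt
    have hGd : HasFDerivAt (fun x => F (L x)) (fderiv ℝ (fun x => F (L x)) (ι y)) (F (φ y)) := by
      rw [hFy]
      exact ((hG.contDiffAt (hU.mem_nhds hyU')).differentiableAt (by simp)).hasFDerivAt
    have hcomp := hGd.comp (φ y) hFd
    have hev : ((fun x => F (L x)) ∘ F) =ᶠ[𝓝 (φ y)] F := by
      have h3 : ∀ᶠ e in 𝓝 (φ y), F e ∈ U := by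
        refine hFd.continuousAt.eventually (hU.mem_nhds ?_)
        rw [hFy]
        exact hyU'
      filter_upwards [h3, (isOpen_extChartAt_target y₀).mem_nhds ht] with e he het
      have h4 := (hy (φ.symm e) he).2
      rw [φ.right_inv het] at h4
      change F (L (ι (φ.symm e))) = F e
      rw [h4]
    have := (hcomp.congr_of_eventuallyEq hev.symm).unique hFd
    have h5 := DFunLike.congr_fun this z
    change fderiv ℝ (fun x => F (L x)) (ι y) (fderiv ℝ F (φ y) z) = fderiv ℝ F (φ y) z at h5
    rwa [hz] at h5
  have hq1 : q.1 ∈ U := hy₀ ▸ hyU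
  have hcont : ContinuousAt (fderiv ℝ (fun x => F (L x))) q.1 :=
    (hG.continuousOn_fderiv_of_isOpen hU (by simp)).continuousAt (hU.mem_nhds hq1)
  have hlim : Tendsto (fun n => fderiv ℝ (fun x => F (L x)) (s n).1 (s n).2) atTop
      (𝓝 (fderiv ℝ (fun x => F (L x)) q.1 q.2)) := by
    have h : Tendsto (fun n => fderiv ℝ (fun x => F (L x)) (s n).1) atTop
      (𝓝 (fderiv ℝ (fun x => F (L x)) q.1)) := hcont.tendsto.comp hs1
    exact (isBoundedBilinearMap_apply.continuous.tendsto (fderiv ℝ (fun x => F (L x)) q.1,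
      q.2)).comp (h.prodMk_nhds hs2)
  have hlim' : Tendsto (fun n => fderiv ℝ (fun x => F (L x)) (s n).1 (s n).2) atTop (𝓝 q.2) := by
    refine hs2.congr' ?_
    filter_upwards [hs1.eventually (hU.mem_nhds hq1)] with n hn
    exact (hfix _ (hs n) hn).symm
  have hq2 := tendsto_nhds_unique hlim hlim'
  have hy₀s : y₀ ∈ φ.source := mem_extChartAt_source y₀
  have hq3 : fderiv ℝ (fun x => F (L x)) q.1 q.2 =
      fderiv ℝ F (φ y₀) (fderiv ℝ L q.1 q.2) := by
    have h6 : L q.1 = φ y₀ := by rw [← hy₀]; exact (hy y₀ hyU).2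
    have h7 : DifferentiableAt ℝ F (L q.1) := by
      rw [h6]
      exact (hFS.contDiffAt ((isOpen_extChartAt_target y₀).mem_nhds
        (φ.map_source hy₀s))).differentiableAt (by simp)
    have h8 : DifferentiableAt ℝ L q.1 :=
      (hL.contDiffAt (hU.mem_nhds hq1)).differentiableAt (by simp)
    have h9 := fderiv_comp q.1 h7 h8
    rw [h6] at h9
    exact DFunLike.congr_fun h9 q.2
  refine ⟨⟨y₀, ?_⟩, ?_⟩
  · have h10 := hι.fderiv_coordEmb (φ.map_source hy₀s) (fderiv ℝ L q.1 q.2)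
    rw [← hF, ← hq3, hq2, ← hφ, φ.left_inv hy₀s] at h10
    exact ⟨_, hy₀, h10.symm⟩
  · refine tendsto_nhds_unique hs2.norm ?_
    refine tendsto_const_nhds.congr fun n => ?_
    exact (hs n).2.symm

/-- Supplies the ball outside which the geodesic field may be cut off without affecting geodesics of
speed at most `R`. -/
theorem IsIsometricEmbedding.exists_tangentSphere_subset [CompactSpace M]
    (hι : IsIsometricEmbedding (d := d) ι) (R : ℝ) :
    ∃ R', ∀ r ≤ R, ∀ q ∈ tangentSphere d ι r, ‖q‖ ≤ R' := by
  obtain ⟨C, hC⟩ := (isCompact_range hι.isEmbedding.continuous).isBounded.exists_norm_le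
  refine ⟨max C R, ?_⟩
  rintro r hr q ⟨⟨y, v, h1, -⟩, h2⟩
  rw [Prod.norm_def]
  refine max_le_max ?_ (h2.trans_le hr)
  rw [← h1]
  exact hC _ (mem_range_self y)

/-- Solutions of the geodesic equation in coordinates give integral curves of the geodesic field
in the ambient space. -/
theorem IsIsometricEmbedding.hasDerivAt_of_coord_geodesic (hι : IsIsometricEmbedding (d := d) ι)
    {B : EuclideanSpace ℝ (Fin p) → EuclideanSpace ℝ (Fin p) →L[ℝ]
      EuclideanSpace ℝ (Fin p) →L[ℝ] EuclideanSpace ℝ (Fin p)}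
    (hB : ∀ x, IsSecondFundamentalForm d ι x (B x)) {y₀ : M} {u : ℝ → EuclideanSpace ℝ (Fin d)}
    {t : ℝ} (hu : ContDiffAt ℝ 2 u t) (hut : u t ∈ (extChartAt (𝓡 d) y₀).target)
    (heq : deriv (deriv u) t =
      -tangentialHessian (coordEmb (d := d) ι y₀) (u t) (deriv u t) (deriv u t)) :
    HasDerivAt (fun t => (coordEmb (d := d) ι y₀ (u t),
      fderiv ℝ (coordEmb (d := d) ι y₀) (u t) (deriv u t)))
      (geodesicField B (coordEmb (d := d) ι y₀ (u t),
        fderiv ℝ (coordEmb (d := d) ι y₀) (u t) (deriv u t))) t ∧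
    inner ℝ (geodesicField B (coordEmb (d := d) ι y₀ (u t),
        fderiv ℝ (coordEmb (d := d) ι y₀) (u t) (deriv u t))).2
        (fderiv ℝ (coordEmb (d := d) ι y₀) (u t) (deriv u t)) = 0 := by
  set φ := extChartAt (𝓡 d) y₀ with hφ
  set F := coordEmb (d := d) ι y₀ with hF
  have hS : IsOpen φ.target := isOpen_extChartAt_target y₀
  have hFS : ContDiffOn ℝ ∞ F φ.target := hι.contDiffOn_coordEmb y₀
  have h1 := (eventually_hasDerivAt_comp_curve hS hFS hu hut).self_of_nhds
  have h2 := hasDerivAt_deriv_comp_curve hS hFS hu hut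
  have hinj : Function.Injective (fderiv ℝ F (u t)) := hι.fderiv_coordEmb_injective hut
  rw [heq, map_neg, ← sub_eq_add_neg] at h2
  have h3 := deriv_deriv_comp_curve hS hFS hu hut
  rw [heq, map_neg, ← sub_eq_add_neg] at h3
  have hγ : ContMDiffAt 𝓘(ℝ, ℝ) (𝓡 d) 2 (fun t => φ.symm (u t)) t :=
    (((contMDiffOn_extChartAt_symm (n := ∞) y₀).contMDiffAt (hS.mem_nhds hut)).of_le
      (by norm_cast)).comp t hu.contMDiffAt
  have h4 := (hB (ι (φ.symm (u t)))).deriv_deriv_eq hγ (fun v => by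
    obtain ⟨z, hz⟩ := hι.exists_fderiv_coordEmb hut v
    rw [← hz]
    change inner ℝ (deriv (deriv fun t => F (u t)) t) _ = 0
    rw [h3]
    exact inner_apply_hessian_sub hinj _ _)
  change deriv (deriv fun t => F (u t)) t = B (F (u t)) (deriv (fun t => F (u t)) t)
    (deriv (fun t => F (u t)) t) at h4
  rw [h3, h1.deriv] at h4
  have h5 := inner_apply_hessian_sub hinj (deriv u t) (deriv u t)
  rw [h4] at h2 h5
  exact ⟨h1.prodMk h2, h5⟩

theorem norm_eq_of_inner_deriv_eq_zero {V : Type*} [NormedAddCommGroup V] [InnerProductSpace ℝ V]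
    {w w' : ℝ → V} {a b : ℝ} (hw : ∀ t ∈ Ioo a b, HasDerivAt w (w' t) t)
    (h : ∀ t ∈ Ioo a b, inner ℝ (w' t) (w t) = 0) {s t : ℝ} (hs : s ∈ Ioo a b)
    (ht : t ∈ Ioo a b) : ‖w s‖ = ‖w t‖ := by
  have hd : ∀ t ∈ Ioo a b, HasDerivAt (fun t => ‖w t‖ ^ 2) 0 t := fun t ht => by
    have := (hw t ht).norm_sq
    rwa [real_inner_comm, h t ht, mul_zero] at this
  have := isOpen_Ioo.is_const_of_deriv_eq_zero isPreconnected_Ioo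
    (fun t ht => (hd t ht).differentiableAt.differentiableWithinAt)
    (fun t ht => (hd t ht).deriv) hs ht
  exact (pow_left_inj₀ (norm_nonneg _) (norm_nonneg _) two_ne_zero).1 this

/-- A coordinate geodesic stays in a tangent sphere. -/
theorem IsIsometricEmbedding.mem_tangentSphere_of_coord_geodesic
    (hι : IsIsometricEmbedding (d := d) ι)
    {B : EuclideanSpace ℝ (Fin p) → EuclideanSpace ℝ (Fin p) →L[ℝ]
      EuclideanSpace ℝ (Fin p) →L[ℝ] EuclideanSpace ℝ (Fin p)}
    (hB : ∀ x, IsSecondFundamentalForm d ι x (B x)) {y₀ : M} {u : ℝ → EuclideanSpace ℝ (Fin d)}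
    {a b : ℝ} (hu : ∀ t ∈ Ioo a b, ContDiffAt ℝ 2 u t)
    (hut : ∀ t ∈ Ioo a b, u t ∈ (extChartAt (𝓡 d) y₀).target)
    (heq : ∀ t ∈ Ioo a b, deriv (deriv u) t =
      -tangentialHessian (coordEmb (d := d) ι y₀) (u t) (deriv u t) (deriv u t))
    {s t : ℝ} (hs : s ∈ Ioo a b) (ht : t ∈ Ioo a b) :
    (coordEmb (d := d) ι y₀ (u t), fderiv ℝ (coordEmb (d := d) ι y₀) (u t) (deriv u t)) ∈
      tangentSphere d ι ‖fderiv ℝ (coordEmb (d := d) ι y₀) (u s) (deriv u s)‖ := by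
  have h := fun t ht => hι.hasDerivAt_of_coord_geodesic hB (hu t ht) (hut t ht) (heq t ht)
  refine ⟨⟨(extChartAt (𝓡 d) y₀).symm (u t), _, rfl, (hι.fderiv_coordEmb (hut t ht) _).symm⟩, ?_⟩
  exact norm_eq_of_inner_deriv_eq_zero
    (fun t ht => (hasFDerivAt_snd (𝕜 := ℝ)).comp_hasDerivAt t (h t ht).1)
    (fun t ht => (h t ht).2) ht hs

/-- Local existence of geodesics, in the ambient space. -/
theorem IsIsometricEmbedding.exists_local_geodesic (hι : IsIsometricEmbedding (d := d) ι)
    {B : EuclideanSpace ℝ (Fin p) → EuclideanSpace ℝ (Fin p) →L[ℝ]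
      EuclideanSpace ℝ (Fin p) →L[ℝ] EuclideanSpace ℝ (Fin p)}
    (hB : ∀ x, IsSecondFundamentalForm d ι x (B x)) {r : ℝ}
    {q : EuclideanSpace ℝ (Fin p) × EuclideanSpace ℝ (Fin p)} (hq : q ∈ tangentSphere d ι r)
    (t₀ : ℝ) : ∃ α : ℝ → EuclideanSpace ℝ (Fin p) × EuclideanSpace ℝ (Fin p), α t₀ = q ∧
      ∀ᶠ t in 𝓝 t₀, HasDerivAt α (geodesicField B (α t)) t ∧ α t ∈ tangentSphere d ι r := by
  obtain ⟨x, w⟩ := q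
  obtain ⟨⟨y₀, v, rfl, rfl⟩, hr⟩ := hq
  set φ := extChartAt (𝓡 d) y₀ with hφ
  set F := coordEmb (d := d) ι y₀ with hF
  have hS : IsOpen φ.target := isOpen_extChartAt_target y₀
  have hFS : ContDiffOn ℝ ∞ F φ.target := hι.contDiffOn_coordEmb y₀
  have hy₀ : y₀ ∈ φ.source := mem_extChartAt_source y₀
  have ht : φ y₀ ∈ φ.target := φ.map_source hy₀
  have hsymm : φ.symm (φ y₀) = y₀ := φ.left_inv hy₀
  obtain ⟨z, hz⟩ : ∃ z, fderiv ℝ F (φ y₀) z = differential (d := d) ι y₀ v := by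
    have := hι.exists_fderiv_coordEmb ht
    rw [← hφ, hsymm] at this
    exact this v
  -- The geodesic equation in coordinates, as a first order field on the phase space of the chart.
  let Y := geodesicField fun e => -tangentialHessian F e
  have hY : ContDiffOn ℝ 1 Y (φ.target ×ˢ univ) := by
    have hT : ContDiffOn ℝ ∞ (fun e => -tangentialHessian F e) φ.target :=
      (contDiffOn_tangentialHessian hS hFS fun e he => hι.fderiv_coordEmb_injective he).neg
    have hT' : ContDiffOn ℝ ∞ (fun q : EuclideanSpace ℝ (Fin d) × EuclideanSpace ℝ (Fin d) =>
        -tangentialHessian F q.1) (φ.target ×ˢ univ) :=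
      hT.comp contDiffOn_fst fun q hq => hq.1
    exact (contDiffOn_snd.prodMk ((hT'.clm_apply contDiffOn_snd).clm_apply contDiffOn_snd)).of_le
      (by norm_cast)
  have hO : IsOpen (φ.target ×ˢ (univ : Set (EuclideanSpace ℝ (Fin d)))) := hS.prod isOpen_univ
  have hz0 : (φ y₀, z) ∈ φ.target ×ˢ (univ : Set (EuclideanSpace ℝ (Fin d))) := ⟨ht, mem_univ _⟩
  obtain ⟨α, hα0, ε, hε, hα⟩ :=
    (hY.contDiffAt (hO.mem_nhds hz0)).exists_forall_mem_closedBall_exists_eq_forall_mem_Ioo_hasDerivAt₀ t₀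
  have hcont : ContinuousAt α t₀ := (hα t₀ ⟨by linarith, by linarith⟩).continuousAt
  have hev : ∀ᶠ t in 𝓝 t₀, α t ∈ φ.target ×ˢ (univ : Set (EuclideanSpace ℝ (Fin d))) :=
    hcont.eventually (hα0 ▸ hO.mem_nhds hz0)
  obtain ⟨ε', hε', hball⟩ := Metric.eventually_nhds_iff_ball.1
    (hev.and (isOpen_Ioo.mem_nhds (⟨by linarith, by linarith⟩ : t₀ ∈ Ioo (t₀ - ε) (t₀ + ε))))
  rw [Real.ball_eq_Ioo] at hball
  have hα' : ∀ t ∈ Ioo (t₀ - ε') (t₀ + ε'), HasDerivAt α (Y (α t)) t := fun t ht =>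
    hα t (hball t ht).2
  have hα2 : ContDiffOn ℝ 2 α (Ioo (t₀ - ε') (t₀ + ε')) :=
    contDiffOn_two_of_hasDerivAt hY isOpen_Ioo (fun t ht => (hball t ht).1) hα'
  let u : ℝ → EuclideanSpace ℝ (Fin d) := fun t => (α t).1
  have hu : ∀ t ∈ Ioo (t₀ - ε') (t₀ + ε'), ContDiffAt ℝ 2 u t := fun t ht =>
    contDiffAt_fst.comp t (hα2.contDiffAt (isOpen_Ioo.mem_nhds ht))
  have hu1 : ∀ t ∈ Ioo (t₀ - ε') (t₀ + ε'), deriv u t = (α t).2 := fun t ht => by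
    have h : HasDerivAt u (Y (α t)).1 t :=
      (hasFDerivAt_fst (𝕜 := ℝ) (p := α t)).comp_hasDerivAt t (hα' t ht)
    exact h.deriv
  have hu2 : ∀ t ∈ Ioo (t₀ - ε') (t₀ + ε'), deriv (deriv u) t =
      -tangentialHessian F (u t) (deriv u t) (deriv u t) := fun t ht => by
    have h1 : deriv u =ᶠ[𝓝 t] fun t => (α t).2 := by
      filter_upwards [isOpen_Ioo.mem_nhds ht] with s hs
      exact hu1 s hs
    rw [h1.deriv_eq, hu1 t ht]
    exact ((hasFDerivAt_snd (𝕜 := ℝ)).comp_hasDerivAt t (hα' t ht)).deriv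
  have hut : ∀ t ∈ Ioo (t₀ - ε') (t₀ + ε'), u t ∈ φ.target := fun t ht => (hball t ht).1.1
  have ht₀ : t₀ ∈ Ioo (t₀ - ε') (t₀ + ε') := ⟨by linarith, by linarith⟩
  have hu0 : u t₀ = φ y₀ := by simp only [u, hα0]
  have hu0' : deriv u t₀ = z := by rw [hu1 t₀ ht₀, hα0]
  refine ⟨fun t => (F (u t), fderiv ℝ F (u t) (deriv u t)), ?_, ?_⟩
  · simp only [hu0, hu0', hz]
    simp only [hF, coordEmb, ← hφ, hsymm]
  · filter_upwards [isOpen_Ioo.mem_nhds ht₀] with t ht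
    refine ⟨(hι.hasDerivAt_of_coord_geodesic hB (hu t ht) (hut t ht) (hu2 t ht)).1, ?_⟩
    have := hι.mem_tangentSphere_of_coord_geodesic hB hu hut hu2 ht₀ ht
    rwa [hu0, hu0', ← hF, hz, hr] at this

end Flow

/-! ### Existence and uniqueness of geodesics, continuity of the exponential map -/

section Geodesics

variable {d p : ℕ} {M : Type*} [TopologicalSpace M] [ChartedSpace (EuclideanSpace ℝ (Fin d)) M]
  {ι : M → EuclideanSpace ℝ (Fin p)}
  [IsManifold (𝓡 d) ∞ M] [RiemannianBundle (fun x : M => TangentSpace (𝓡 d) x)]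

set_option linter.unusedSectionVars false

theorem IsIsometricEmbedding.contDiff_comp_curve (hι : IsIsometricEmbedding (d := d) ι)
    {γ : ℝ → M} (hγ : ContMDiff 𝓘(ℝ, ℝ) (𝓡 d) 2 γ) : ContDiff ℝ 2 fun t => ι (γ t) :=
  ((hι.contMDiff.of_le (by norm_cast)).comp hγ).contDiff

theorem IsIsometricEmbedding.deriv_comp_curve (hι : IsIsometricEmbedding (d := d) ι) {γ : ℝ → M}
    {t : ℝ} (hγ : MDifferentiableAt 𝓘(ℝ, ℝ) (𝓡 d) γ t) :
    deriv (fun t => ι (γ t)) t =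
      differential (d := d) ι (γ t) (mfderiv 𝓘(ℝ, ℝ) (𝓡 d) γ t (1 : ℝ)) := by
  have h2 : MDifferentiableAt (𝓡 d) 𝓘(ℝ, EuclideanSpace ℝ (Fin p)) ι (γ t) :=
    hι.contMDiff.mdifferentiableAt (by simp)
  have h := mfderiv_comp t h2 hγ
  rw [← fderiv_apply_one_eq_deriv]
  have h3 := mfderiv_eq_fderiv (f := fun t => ι (γ t)) (x := t) (𝕜 := ℝ)
  rw [← h3]
  exact DFunLike.congr_fun h (1 : ℝ)

/-- Since `ι` and its differentials are injective, initial data may be compared in the ambient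
space. -/
theorem IsIsometricEmbedding.isGeodesicFrom_iff (hι : IsIsometricEmbedding (d := d) ι) {y : M}
    {v : TangentSpace (𝓡 d) y} {γ : ℝ → M} :
    IsGeodesicFrom y v γ ↔ IsGeodesic (d := d) γ ∧ ι (γ 0) = ι y ∧
      deriv (fun t => ι (γ t)) 0 = differential (d := d) ι y v := by
  refine and_congr_right fun hγ => ?_
  have hd := hι.deriv_comp_curve (hγ.1.mdifferentiableAt (by simp) : MDifferentiableAt 𝓘(ℝ, ℝ) (𝓡 d) γ 0)
  constructor
  · intro h
    refine ⟨congrArg (fun q : TangentBundle (𝓡 d) M => ι q.1) h, hd.trans ?_⟩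
    exact congrArg (fun q : TangentBundle (𝓡 d) M => differential (d := d) ι q.1 q.2) h
  · rintro ⟨h1, h2⟩
    have h1' := hι.isEmbedding.injective h1
    subst h1'
    rw [hd] at h2
    rw [hι.differential_injective _ h2]

variable {B : EuclideanSpace ℝ (Fin p) → EuclideanSpace ℝ (Fin p) →L[ℝ]
      EuclideanSpace ℝ (Fin p) →L[ℝ] EuclideanSpace ℝ (Fin p)}

/-- The lift of a geodesic is an integral curve of the geodesic field, in a tangent sphere. -/
theorem IsIsometricEmbedding.hasDerivAt_lift_geodesic (hι : IsIsometricEmbedding (d := d) ι)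
    (hB : ∀ x, IsSecondFundamentalForm d ι x (B x)) {γ : ℝ → M} (hγ : IsGeodesic (d := d) γ)
    (t : ℝ) :
    HasDerivAt (fun t => (ι (γ t), deriv (fun t => ι (γ t)) t))
      (geodesicField B (ι (γ t), deriv (fun t => ι (γ t)) t)) t ∧
    (ι (γ t), deriv (fun t => ι (γ t)) t) ∈ tangentSphere d ι ‖deriv (fun t => ι (γ t)) 0‖ := by
  obtain ⟨hγ1, hγ2⟩ := hι.isGeodesic_iff.1 hγ
  have hc := hι.contDiff_comp_curve hγ1
  have h1 : ∀ t, HasDerivAt (fun t => ι (γ t)) (deriv (fun t => ι (γ t)) t) t := fun t =>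
    (ContDiffAt.eventually_hasDerivAt_deriv hc.contDiffAt).self_of_nhds
  have h2 : ∀ t, HasDerivAt (deriv fun t => ι (γ t)) (deriv (deriv fun t => ι (γ t)) t) t :=
    fun t => ContDiffAt.hasDerivAt_deriv_deriv hc.contDiffAt
  have h3 : ∀ t, deriv (fun t => ι (γ t)) t =
      differential (d := d) ι (γ t) (mfderiv 𝓘(ℝ, ℝ) (𝓡 d) γ t (1 : ℝ)) := fun t =>
    hι.deriv_comp_curve (hγ1.mdifferentiableAt (by simp))
  refine ⟨(h1 t).prodMk ?_, ⟨⟨γ t, _, rfl, (h3 t).symm⟩, ?_⟩⟩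
  · have := (hB (ι (γ t))).deriv_deriv_eq hγ1.contMDiffAt (hγ2 t)
    have h4 := h2 t
    rwa [this] at h4
  · refine norm_eq_of_inner_deriv_eq_zero (a := -|t| - 1) (b := |t| + 1) (fun t _ => h2 t)
      (fun t _ => ?_) ⟨by linarith [neg_abs_le t], by linarith [le_abs_self t]⟩
      ⟨by linarith [abs_nonneg t], by linarith [abs_nonneg t]⟩
    rw [h3 t]
    exact hγ2 t _

/-- Integral curves of the geodesic field which stay tangent to `M` come from geodesics. -/
theorem IsIsometricEmbedding.exists_geodesic_of_integralCurve
    (hι : IsIsometricEmbedding (d := d) ι) (hBs : ContDiff ℝ ∞ B)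
    (hB : ∀ x, IsSecondFundamentalForm d ι x (B x)) {r : ℝ}
    {α : ℝ → EuclideanSpace ℝ (Fin p) × EuclideanSpace ℝ (Fin p)}
    (hα : ∀ t, HasDerivAt α (geodesicField B (α t)) t) (hαr : ∀ t, α t ∈ tangentSphere d ι r) :
    ∃ γ : ℝ → M, IsGeodesic (d := d) γ ∧
      ∀ t, ι (γ t) = (α t).1 ∧ deriv (fun t => ι (γ t)) t = (α t).2 := by
  choose γ v hγ hv using fun t => (hαr t).1
  have hγ' : (fun t => ι (γ t)) = fun t => (α t).1 := funext hγ
  have hα2 : ContDiff ℝ 2 α := by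
    rw [← contDiffOn_univ]
    exact contDiffOn_two_of_hasDerivAt (O := univ)
      ((contDiff_geodesicField hBs).of_le (by norm_cast)).contDiffOn isOpen_univ
      (mapsTo_univ _ _) fun t _ => hα t
  have hc2 : ContDiff ℝ 2 fun t => ι (γ t) := by
    rw [hγ']
    exact contDiff_fst.comp hα2
  have hd : deriv (fun t => ι (γ t)) = fun t => (α t).2 := by
    rw [hγ']
    ext1 t
    exact ((hasFDerivAt_fst (𝕜 := ℝ) (p := α t)).comp_hasDerivAt t (hα t)).deriv
  have hdd : ∀ t, deriv (deriv fun t => ι (γ t)) t = B (α t).1 (α t).2 (α t).2 := fun t => by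
    rw [hd]
    exact ((hasFDerivAt_snd (𝕜 := ℝ) (p := α t)).comp_hasDerivAt t (hα t)).deriv
  -- The curve `γ` was chosen pointwise. Its regularity comes from writing it locally as the inverse
  -- chart applied to `L (ι (γ s))`, where `ι ∘ γ` is already known to be `C²`.
  have hγC : ContMDiff 𝓘(ℝ, ℝ) (𝓡 d) 2 γ := by
    intro t
    obtain ⟨L, U, hU, hyU, hL, hLU, hy⟩ := hι.exists_smooth_coordinates (γ t)
    have h1 : γ =ᶠ[𝓝 t] fun s => (extChartAt (𝓡 d) (γ t)).symm (L (ι (γ s))) := by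
      filter_upwards [hc2.continuous.continuousAt.eventually (hU.mem_nhds hyU)] with s hs
      obtain ⟨h2, h3⟩ := hy _ hs
      rw [h3, (extChartAt (𝓡 d) (γ t)).left_inv h2]
    refine ContMDiffAt.congr_of_eventuallyEq ?_ h1
    have h2 : ContMDiffAt 𝓘(ℝ, ℝ) 𝓘(ℝ, EuclideanSpace ℝ (Fin d)) 2 (fun s => L (ι (γ s))) t :=
      (((hL.contDiffAt (hU.mem_nhds hyU)).of_le (by norm_cast)).comp t
        hc2.contDiffAt).contMDiffAt
    exact (((contMDiffOn_extChartAt_symm (n := ∞) (γ t)).contMDiffAt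
      ((isOpen_extChartAt_target (γ t)).mem_nhds (hLU hyU))).of_le (by norm_cast)).comp t h2
  refine ⟨γ, hι.isGeodesic_iff.2 ⟨hγC, fun t w => ?_⟩, fun t => ⟨hγ t, congrFun hd t⟩⟩
  have h := (hB (ι (γ t)) γ t hγC.contMDiffAt rfl).2 w
  rw [hd] at h
  rw [hdd, ← hγ t]
  exact h

/-- For each speed bound `R`, a complete Lipschitz vector field on the ambient space whose
integral curves include the lifts of all geodesics of speed at most `R`. -/
theorem IsIsometricEmbedding.exists_geodesic_flow [CompactSpace M]
    (hι : IsIsometricEmbedding (d := d) ι) (R : ℝ) :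
    ∃ (B : EuclideanSpace ℝ (Fin p) → EuclideanSpace ℝ (Fin p) →L[ℝ]
        EuclideanSpace ℝ (Fin p) →L[ℝ] EuclideanSpace ℝ (Fin p))
      (Y : EuclideanSpace ℝ (Fin p) × EuclideanSpace ℝ (Fin p) →
        EuclideanSpace ℝ (Fin p) × EuclideanSpace ℝ (Fin p))
      (K : NNReal) (Φ : EuclideanSpace ℝ (Fin p) × EuclideanSpace ℝ (Fin p) → ℝ →
        EuclideanSpace ℝ (Fin p) × EuclideanSpace ℝ (Fin p)),
      (∀ x, IsSecondFundamentalForm d ι x (B x)) ∧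
      LipschitzWith K Y ∧
      (∀ r ≤ R, ∀ q ∈ tangentSphere d ι r, Y q = geodesicField B q) ∧
      (∀ q, Φ q 0 = q) ∧ (∀ q t, HasDerivAt (Φ q) (Y (Φ q t)) t) ∧
      (∀ r ≤ R, ∀ q ∈ tangentSphere d ι r, ∀ t, Φ q t ∈ tangentSphere d ι r) ∧
      ∀ (y : M) (v : TangentSpace (𝓡 d) y), ‖v‖ ≤ R → ∃ γ, IsGeodesicFrom y v γ := by
  obtain ⟨B, hBs, hB⟩ := hι.exists_secondFundamentalForm
  obtain ⟨R', hR'⟩ := hι.exists_tangentSphere_subset R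
  obtain ⟨Y, K, C, hYs, hK, hC, hY⟩ :=
    exists_bounded_lipschitz_eqOn_ball (contDiff_geodesicField hBs) R'
  have hYr : ∀ r ≤ R, ∀ q ∈ tangentSphere d ι r, Y q = geodesicField B q :=
    fun r hr q hq => hY q (hR' r hr q hq)
  choose Φ hΦ0 hΦ using exists_global_integralCurve hK hC
  -- The times spent in the tangent sphere form a clopen set: closed because the sphere is closed,
  -- open because a local geodesic through the current point must coincide with the flow line.
  have hstay : ∀ r ≤ R, ∀ q ∈ tangentSphere d ι r, ∀ t, Φ q t ∈ tangentSphere d ι r := by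
    intro r hr q hq
    have hcont : Continuous (Φ q) :=
      continuous_iff_continuousAt.2 fun t => (hΦ q t).continuousAt
    have hclopen : IsClopen {t | Φ q t ∈ tangentSphere d ι r} := by
      refine ⟨(hι.isClosed_tangentSphere r).preimage hcont, isOpen_iff_mem_nhds.2 fun t ht => ?_⟩
      obtain ⟨α, hα0, hα⟩ := hι.exists_local_geodesic hB ht t
      have h1 : Φ q =ᶠ[𝓝 t] α := by
        refine ODE_solution_unique_of_eventually (v := fun _ => Y) (s := fun _ => univ) (K := K)
          (Eventually.of_forall fun _ => hK.lipschitzOnWith)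
          (Eventually.of_forall fun s => ⟨hΦ q s, mem_univ _⟩) ?_ hα0.symm
        filter_upwards [hα] with s hs
        rw [hYr r hr _ hs.2]
        exact ⟨hs.1, mem_univ _⟩
      filter_upwards [h1, hα] with s hs hs'
      rw [hs]
      exact hs'.2
    have huniv := hclopen.eq_univ ⟨0, by
      change Φ q 0 ∈ tangentSphere d ι r
      rwa [hΦ0]⟩
    intro t
    have : t ∈ {t | Φ q t ∈ tangentSphere d ι r} := huniv ▸ mem_univ t
    exact this
  refine ⟨B, Y, K, Φ, hB, hK, hYr, hΦ0, hΦ, hstay, fun y v hv => ?_⟩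
  have hq : (ι y, differential (d := d) ι y v) ∈ tangentSphere d ι ‖v‖ :=
    ⟨⟨y, v, rfl, rfl⟩, hι.2 y v⟩
  have hst := hstay ‖v‖ hv _ hq
  obtain ⟨γ, hγ, h⟩ := hι.exists_geodesic_of_integralCurve hBs hB
    (fun t => (hYr _ hv _ (hst t)) ▸ hΦ _ t) hst
  refine ⟨γ, hι.isGeodesicFrom_iff.2 ⟨hγ, ?_, ?_⟩⟩
  · rw [(h 0).1, hΦ0]
  · rw [(h 0).2, hΦ0]

/-- Geodesics with the same initial data, one of them given in coordinates on an interval, agree;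
this computes the exponential map. -/
theorem IsIsometricEmbedding.riemExp_eq_of_coord_geodesic [CompactSpace M]
    (hι : IsIsometricEmbedding (d := d) ι) {y₀ : M} {u : ℝ → EuclideanSpace ℝ (Fin d)}
    {a b : ℝ} (h0 : (0 : ℝ) ∈ Ioo a b) (h1 : (1 : ℝ) ∈ Ioo a b)
    (hu : ∀ t ∈ Ioo a b, ContDiffAt ℝ 2 u t)
    (hut : ∀ t ∈ Ioo a b, u t ∈ (extChartAt (𝓡 d) y₀).target)
    (heq : ∀ t ∈ Ioo a b, deriv (deriv u) t =
      -tangentialHessian (coordEmb (d := d) ι y₀) (u t) (deriv u t) (deriv u t))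
    (hu0 : u 0 = extChartAt (𝓡 d) y₀ y₀) {v : TangentSpace (𝓡 d) y₀}
    (hv : fderiv ℝ (coordEmb (d := d) ι y₀) (u 0) (deriv u 0) = differential (d := d) ι y₀ v) :
    riemExp (d := d) y₀ v = (extChartAt (𝓡 d) y₀).symm (u 1) := by
  obtain ⟨B, Y, K, Φ, hB, hK, hY, hΦ0, hΦ, hst, hex⟩ := hι.exists_geodesic_flow ‖v‖
  have hγe := hex y₀ v le_rfl
  rw [riemExp, dif_pos hγe]
  set γ := hγe.choose
  obtain ⟨hγ, hγ0, hγ1⟩ := hι.isGeodesicFrom_iff.1 hγe.choose_spec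
  have hlift := hι.hasDerivAt_lift_geodesic hB hγ
  change ∀ t, _ ∧ _ ∈ tangentSphere d ι ‖deriv (fun t => ι (γ t)) 0‖ at hlift
  rw [hγ1, hι.2] at hlift
  have hc := fun t ht => (hι.hasDerivAt_of_coord_geodesic hB (hu t ht) (hut t ht) (heq t ht)).1
  have hcs := fun t ht => hι.mem_tangentSphere_of_coord_geodesic hB hu hut heq h0 (t := t) ht
  rw [hv, hι.2] at hcs
  -- Both curves lift to solutions of the same Lipschitz equation in the ambient phase space, where
  -- uniqueness holds on the whole interval.
  have := ODE_solution_unique_of_mem_Ioo (v := fun _ => Y) (s := fun _ => univ) (K := K)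
    (f := fun t => (ι (γ t), deriv (fun t => ι (γ t)) t))
    (g := fun t => (coordEmb (d := d) ι y₀ (u t),
      fderiv ℝ (coordEmb (d := d) ι y₀) (u t) (deriv u t)))
    (fun _ _ => hK.lipschitzOnWith) h0
    (fun t ht => ⟨(hY _ le_rfl _ (hlift t).2) ▸ (hlift t).1, mem_univ _⟩)
    (fun t ht => ⟨(hY _ le_rfl _ (hcs t ht)) ▸ hc t ht, mem_univ _⟩) (by
      refine Prod.ext ?_ (hγ1.trans hv.symm)
      refine hγ0.trans ?_
      simp only [hu0, coordEmb]
      rw [(extChartAt (𝓡 d) y₀).left_inv (mem_extChartAt_source y₀)]) h1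
  exact hι.isEmbedding.injective (congrArg Prod.fst this)

/-- Near `v₀` all speeds are at most `‖v₀‖ + 1`. There `ι ∘ Exp` is the position component of the
time-one map of a single Lipschitz field, and that map is Lipschitz. -/
theorem IsIsometricEmbedding.continuous_riemExp [CompactSpace M]
    (hι : IsIsometricEmbedding (d := d) ι) (y : M) :
    Continuous fun v : TangentSpace (𝓡 d) y => riemExp (d := d) y v := by
  rw [hι.isEmbedding.continuous_iff, continuous_iff_continuousAt]
  intro v₀
  obtain ⟨B, Y, K, Φ, hB, hK, hY, hΦ0, hΦ, hst, hex⟩ := hι.exists_geodesic_flow (‖v₀‖ + 1)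
  have heq : ∀ v : TangentSpace (𝓡 d) y, ‖v‖ ≤ ‖v₀‖ + 1 →
      ι (riemExp (d := d) y v) = (Φ (ι y, differential (d := d) ι y v) 1).1 := by
    intro v hv
    have hγe := hex y v hv
    rw [riemExp, dif_pos hγe]
    set γ := hγe.choose
    obtain ⟨hγ, hγ0, hγ1⟩ := hι.isGeodesicFrom_iff.1 hγe.choose_spec
    have hlift := hι.hasDerivAt_lift_geodesic hB hγ
    change ∀ t, _ ∧ _ ∈ tangentSphere d ι ‖deriv (fun t => ι (γ t)) 0‖ at hlift
    rw [hγ1, hι.2] at hlift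
    have := integralCurve_unique hK (α := fun t => (ι (γ t), deriv (fun t => ι (γ t)) t))
      (β := Φ (ι y, differential (d := d) ι y v)) (t₀ := 0)
      (fun t => (hY _ hv _ (hlift t).2) ▸ (hlift t).1) (hΦ _) (by
        rw [hΦ0]
        exact Prod.ext hγ0 hγ1)
    exact congrArg Prod.fst (congrFun this 1)
  have hcont : Continuous fun v : TangentSpace (𝓡 d) y =>
      (Φ (ι y, differential (d := d) ι y v) 1).1 :=
    continuous_fst.comp ((lipschitzWith_timeOne hK hΦ0 hΦ).continuous.comp
      (continuous_const.prodMk (differential (d := d) ι y).continuous))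
  refine hcont.continuousAt.congr ?_
  have hn : ∀ᶠ v in 𝓝 v₀, ‖v‖ < ‖v₀‖ + 1 :=
    continuous_norm.continuousAt.eventually (gt_mem_nhds (by linarith))
  filter_upwards [hn] with v hv
  exact (heq v hv.le).symm

end Geodesics

/-! ### Smooth dependence of solutions of second order equations near an equilibrium -/

section Superposition

set_option synthInstance.maxHeartbeats 200000

variable {K : Type*} [TopologicalSpace K] [CompactSpace K]

section Apply

variable {V A G : Type*} [NormedAddCommGroup V] [NormedSpace ℝ V] [NormedAddCommGroup A]
  [NormedSpace ℝ A] [NormedAddCommGroup G] [NormedSpace ℝ G]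

/-- A bounded bilinear map, applied pointwise to continuous functions. -/
def pointwiseBilin (b : V →L[ℝ] A →L[ℝ] G) (T : C(K, V)) (h : C(K, A)) : C(K, G) :=
  ⟨fun t => b (T t) (h t), (b.continuous.comp T.continuous).clm_apply h.continuous⟩

theorem norm_pointwiseBilin_le (b : V →L[ℝ] A →L[ℝ] G) (T : C(K, V)) (h : C(K, A)) :
    ‖pointwiseBilin b T h‖ ≤ ‖b‖ * ‖T‖ * ‖h‖ := by
  have hb : 0 ≤ ‖b‖ * ‖T‖ := mul_nonneg (norm_nonneg b) (norm_nonneg T)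
  rw [ContinuousMap.norm_le _ (mul_nonneg hb (norm_nonneg h))]
  intro t
  exact (b.le_opNorm₂ _ _).trans (mul_le_mul (mul_le_mul_of_nonneg_left (T.norm_coe_le_norm t)
    (norm_nonneg b)) (h.norm_coe_le_norm t) (norm_nonneg _) hb)

variable (K) in
/-- A bounded bilinear map, applied pointwise to continuous functions, as a bounded bilinear
map. -/
def pointwiseBilinCLM (b : V →L[ℝ] A →L[ℝ] G) : C(K, V) →L[ℝ] C(K, A) →L[ℝ] C(K, G) :=
  LinearMap.mkContinuous₂
    (LinearMap.mk₂ ℝ (pointwiseBilin b)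
      (fun T T' h => ContinuousMap.ext fun t => by simp [pointwiseBilin])
      (fun c T h => ContinuousMap.ext fun t => by simp [pointwiseBilin])
      (fun T h h' => ContinuousMap.ext fun t => by simp [pointwiseBilin])
      (fun c T h => ContinuousMap.ext fun t => by simp [pointwiseBilin]))
    ‖b‖ (norm_pointwiseBilin_le b)

@[simp]
theorem pointwiseBilinCLM_apply (b : V →L[ℝ] A →L[ℝ] G) (T : C(K, V)) (h : C(K, A)) (t : K) :
    pointwiseBilinCLM K b T h t = b (T t) (h t) := rfl

end Apply

/-- Superposition with `f`, on continuous functions on a compact space. -/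
def postcomp {A G : Type*} [TopologicalSpace A] [TopologicalSpace G] (f : C(A, G)) (w : C(K, A)) :
    C(K, G) := f.comp w

/-- The range of `w` is compact, so `f'` is uniformly continuous along it, and the mean value
estimate holds uniformly in `t`. -/
theorem hasFDerivAt_postcomp {A G : Type*} [NormedAddCommGroup A] [NormedSpace ℝ A]
    [NormedAddCommGroup G] [NormedSpace ℝ G] {f : C(A, G)} {f' : C(A, A →L[ℝ] G)}
    (hf : ∀ x, HasFDerivAt f (f' x) x) (w : C(K, A)) :
    HasFDerivAt (postcomp (K := K) f) (pointwiseBilinCLM K (ContinuousLinearMap.id ℝ (A →L[ℝ] G)) (postcomp f' w)) w := by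
  rw [hasFDerivAt_iff_isLittleO_nhds_zero, Asymptotics.isLittleO_iff]
  intro ε hε
  have hcomp : IsCompact (range w) := isCompact_range w.continuous
  have hunif := hcomp.uniformContinuousAt_of_continuousAt f'
    (fun a _ => f'.continuous.continuousAt) (Metric.dist_mem_uniformity hε)
  obtain ⟨δ, hδ, hδ'⟩ := Metric.mem_uniformity_dist.1 hunif
  filter_upwards [Metric.ball_mem_nhds (0 : C(K, A)) hδ] with h hh
  rw [mem_ball_zero_iff] at hh
  rw [ContinuousMap.norm_le _ (by positivity)]
  intro t
  have h1 : ∀ x ∈ Metric.ball (w t) δ, ‖f' x - f' (w t)‖ ≤ ε := fun x hx => by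
    have : dist (w t) x < δ := by rwa [dist_comm]
    have h2 := hδ' this (mem_range_self t)
    simp only [mem_ofPred_eq] at h2
    rw [dist_comm, dist_eq_norm] at h2
    exact h2.le
  have h3 : w t + h t ∈ Metric.ball (w t) δ := by
    rw [mem_ball_iff_norm, add_sub_cancel_left]
    exact (h.norm_coe_le_norm t).trans_lt hh
  have h4 := (convex_ball (w t) δ).norm_image_sub_le_of_norm_hasFDerivWithin_le' (f := f)
    (fun x _ => (hf x).hasFDerivWithinAt) h1 (Metric.mem_ball_self hδ) h3
  rw [add_sub_cancel_left] at h4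
  exact h4.trans (mul_le_mul_of_nonneg_left (h.norm_coe_le_norm t) hε.le)

/-- The derivative of superposition with `f` is a bounded bilinear operation applied to
superposition with `f'`. The induction therefore has to range over all target spaces `G`. -/
theorem contDiff_postcomp_nat {A : Type} [NormedAddCommGroup A] [NormedSpace ℝ A] (n : ℕ) :
    ∀ {G : Type} [NormedAddCommGroup G] [NormedSpace ℝ G] {f : C(A, G)}, ContDiff ℝ ∞ f →
      ContDiff ℝ n (postcomp (K := K) f) := by
  induction n with
  | zero =>
    intro G _ _ f _
    exact contDiff_zero.2 (ContinuousMap.continuous_postcomp f)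
  | succ n ih =>
    intro G _ _ f hf
    have hf' : ContDiff ℝ ∞ (fderiv ℝ f) := hf.fderiv_right (by simp)
    let f' : C(A, A →L[ℝ] G) := ⟨fderiv ℝ f, hf'.continuous⟩
    push_cast
    rw [contDiff_succ_iff_hasFDerivAt]
    refine ⟨fun w => pointwiseBilinCLM K (ContinuousLinearMap.id ℝ (A →L[ℝ] G)) (postcomp f' w), (pointwiseBilinCLM K (ContinuousLinearMap.id ℝ (A →L[ℝ] G))).contDiff.comp (ih hf'),
      fun w => hasFDerivAt_postcomp (fun x => ?_) w⟩
    exact (hf.differentiable (by simp) x).hasFDerivAt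

theorem contDiff_postcomp {A G : Type} [NormedAddCommGroup A] [NormedSpace ℝ A]
    [NormedAddCommGroup G] [NormedSpace ℝ G] {f : C(A, G)} (hf : ContDiff ℝ ∞ f) :
    ContDiff ℝ ∞ (postcomp (K := K) f) :=
  contDiff_infty.2 fun n => contDiff_postcomp_nat n hf

end Superposition

/-! ### Integration as a bounded operator on continuous paths. -/

section Primitive

set_option linter.unusedSectionVars false

variable {E : Type*} [NormedAddCommGroup E] [NormedSpace ℝ E]

/-- The interval on which differential equations are solved. -/
abbrev TimeInterval : Type := Icc (-2 : ℝ) 2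

/-- The extension of a function on `[-2, 2]` by its values at the end points. -/
def extendTime (w : C(TimeInterval, E)) (t : ℝ) : E :=
  w (projIcc (-2) 2 (by norm_num) t)

theorem continuous_extendTime (w : C(TimeInterval, E)) : Continuous (extendTime w) :=
  w.continuous.comp continuous_projIcc

theorem extendTime_of_mem (w : C(TimeInterval, E)) {t : ℝ} (ht : t ∈ Icc (-2 : ℝ) 2) :
    extendTime w t = w ⟨t, ht⟩ := by
  rw [extendTime, projIcc_of_mem _ ht]

/-- The primitive which vanishes at `0`, on `[-2, 2]`. -/
def primitiveCLM (E : Type*) [NormedAddCommGroup E] [NormedSpace ℝ E] :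
    C(TimeInterval, E) →L[ℝ] C(TimeInterval, E) :=
  LinearMap.mkContinuous
    { toFun := fun w => ⟨fun t => ∫ s in (0 : ℝ)..t, extendTime w s,
        (intervalIntegral.continuous_primitive
          (fun _ _ => (continuous_extendTime w).intervalIntegrable _ _) 0).comp
            continuous_subtype_val⟩
      map_add' := fun v w => by
        ext t
        exact intervalIntegral.integral_add ((continuous_extendTime v).intervalIntegrable _ _)
          ((continuous_extendTime w).intervalIntegrable _ _)
      map_smul' := fun c w => by
        ext t
        exact intervalIntegral.integral_smul c _ } 2 (fun w => by
    rw [ContinuousMap.norm_le _ (by positivity)]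
    intro t
    have h1 := intervalIntegral.norm_integral_le_of_norm_le_const (a := (0 : ℝ)) (b := t)
      (f := extendTime w) (C := ‖w‖) (fun s _ => w.norm_coe_le_norm _)
    refine h1.trans ?_
    rw [sub_zero, mul_comm]
    exact mul_le_mul_of_nonneg_right (abs_le.2 t.2) (norm_nonneg _))

/-- Constant functions of time. -/
def constTimeCLM (E : Type*) [NormedAddCommGroup E] [NormedSpace ℝ E] :
    E →L[ℝ] C(TimeInterval, E) :=
  LinearMap.mkContinuous
    { toFun := fun z => ContinuousMap.const _ z
      map_add' := fun _ _ => rfl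
      map_smul' := fun _ _ => rfl } 1 (fun z => by
    rw [ContinuousMap.norm_le _ (by positivity)]
    intro t
    change ‖z‖ ≤ 1 * ‖z‖
    rw [one_mul])

@[simp]
theorem constTimeCLM_apply (z : E) (t : TimeInterval) : constTimeCLM E z t = z := rfl

theorem hasDerivAt_integral_extendTime [CompleteSpace E] (w : C(TimeInterval, E)) (t : ℝ) :
    HasDerivAt (fun t => ∫ s in (0 : ℝ)..t, extendTime w s) (extendTime w t) t :=
  ((continuous_extendTime w).integral_hasStrictDerivAt 0 t).hasDerivAt

end Primitive

/-! ### Second order equations as operator equations for the velocity. -/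

section SecondOrder

set_option synthInstance.maxHeartbeats 200000

/-- A smooth function on an open set agrees near a given point with a globally smooth one. -/
theorem exists_contDiff_eqOn_ball {A F : Type*} [NormedAddCommGroup A] [InnerProductSpace ℝ A]
    [FiniteDimensional ℝ A] [NormedAddCommGroup F] [NormedSpace ℝ F] {f : A → F} {S : Set A}
    (hS : IsOpen S) (hf : ContDiffOn ℝ ∞ f S) {x : A} (hx : x ∈ S) :
    ∃ (g : A → F) (ε : ℝ), 0 < ε ∧ ContDiff ℝ ∞ g ∧ Metric.ball x ε ⊆ S ∧
      EqOn g f (Metric.ball x ε) := by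
  obtain ⟨ε, hε, hεS⟩ := Metric.isOpen_iff.1 hS x hx
  let χ : ContDiffBump x := ⟨ε / 3, ε / 2, by positivity, by linarith⟩
  refine ⟨fun z => χ z • f z, ε / 3, by positivity, contDiff_iff_contDiffAt.2 fun z => ?_,
    (Metric.ball_subset_ball (by linarith)).trans hεS, fun z hz => ?_⟩
  · by_cases hz : z ∈ Metric.ball x ε
    · exact χ.contDiff.contDiffAt.smul (hf.contDiffAt (hS.mem_nhds (hεS hz)))
    · have hz' : z ∈ (Metric.closedBall x (ε / 2))ᶜ := fun h =>
        hz (Metric.closedBall_subset_ball (by linarith) h)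
      refine (contDiffAt_const (c := (0 : F))).congr_of_eventuallyEq ?_
      filter_upwards [Metric.isClosed_closedBall.isOpen_compl.mem_nhds hz'] with w hw
      have : χ w = 0 := χ.zero_of_le_dist (by
        rw [mem_compl_iff, Metric.mem_closedBall, not_le] at hw
        exact hw.le)
      rw [this, zero_smul]
  · have : χ z = 1 := χ.one_of_mem_closedBall (Metric.ball_subset_closedBall hz)
    simp [this]

variable {E : Type} [NormedAddCommGroup E] [NormedSpace ℝ E]

variable (E) in
/-- The path `(J w, w)` in the phase space, where `J` is the primitive vanishing at `0`. -/
def phaseCLM : C(TimeInterval, E) →L[ℝ] C(TimeInterval, E × E) :=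
  (ContinuousLinearMap.inl ℝ E E).compLeftContinuous ℝ TimeInterval ∘L primitiveCLM E +
    (ContinuousLinearMap.inr ℝ E E).compLeftContinuous ℝ TimeInterval

@[simp]
theorem phaseCLM_apply (w : C(TimeInterval, E)) (t : TimeInterval) :
    phaseCLM E w t = (primitiveCLM E w t, w t) := by
  simp [phaseCLM]

/-- The operator whose level sets at constant functions are the velocities of the solutions of
`u'' = - f (u, u')` with `u 0 = 0`. -/
def velocityOperator (f : C(E × E, E)) (w : C(TimeInterval, E)) : C(TimeInterval, E) :=
  w + primitiveCLM E (postcomp f (phaseCLM E w))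

theorem contDiff_velocityOperator {f : C(E × E, E)} (hf : ContDiff ℝ ∞ f) :
    ContDiff ℝ ∞ (velocityOperator f) :=
  contDiff_id.add ((primitiveCLM E).contDiff.comp
    ((contDiff_postcomp hf).comp (phaseCLM E).contDiff))

theorem velocityOperator_zero {f : C(E × E, E)} (hf : f 0 = 0) : velocityOperator f 0 = 0 := by
  have : postcomp f (phaseCLM E 0) = 0 := by
    ext t
    simp [postcomp, hf]
  rw [velocityOperator, this, map_zero, add_zero]

/-- The nonlinear part of the operator has zero derivative at the zero path because `f'` vanishes at
the origin. The inverse function theorem then applies with no restriction on the length of the time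
interval. -/
theorem hasFDerivAt_velocityOperator_zero {f : C(E × E, E)} (hf : ContDiff ℝ ∞ f)
    (hf' : fderiv ℝ f 0 = 0) :
    HasFDerivAt (velocityOperator f) (ContinuousLinearMap.id ℝ C(TimeInterval, E)) 0 := by
  let f' : C(E × E, E × E →L[ℝ] E) := ⟨fderiv ℝ f, (hf.fderiv_right (m := ∞) (by simp)).continuous⟩
  have h1 := hasFDerivAt_postcomp (K := TimeInterval) (f := f) (f' := f')
    (fun x => (hf.differentiable (by simp) x).hasFDerivAt) (phaseCLM E 0)
  have h2 : pointwiseBilinCLM TimeInterval (ContinuousLinearMap.id ℝ (E × E →L[ℝ] E))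
      (postcomp f' (phaseCLM E 0)) = 0 := by
    ext h t
    simp [postcomp, f', hf']
  rw [h2] at h1
  have h3 := (hasFDerivAt_id (𝕜 := ℝ) (0 : C(TimeInterval, E))).add
    ((primitiveCLM E).hasFDerivAt.comp (0 : C(TimeInterval, E))
      (h1.comp (0 : C(TimeInterval, E)) (phaseCLM E).hasFDerivAt))
  refine HasFDerivAt.congr_fderiv (f := velocityOperator f) h3 ?_
  rw [ContinuousLinearMap.zero_comp, ContinuousLinearMap.comp_zero, add_zero]

/-- A solution of the integrated equation is a solution of the differential equation. -/
theorem exists_solution_of_velocityOperator_eq [CompleteSpace E] {f : C(E × E, E)}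
    (hf : ContDiff ℝ ∞ f) {w : C(TimeInterval, E)} {z : E}
    (hw : velocityOperator f w = constTimeCLM E z) :
    ∃ u : ℝ → E, u 0 = 0 ∧ deriv u 0 = z ∧ (∀ t : TimeInterval, u t = primitiveCLM E w t) ∧
      ∀ t ∈ Ioo (-2 : ℝ) 2, ContDiffAt ℝ 2 u t ∧ deriv (deriv u) t = -f (u t, deriv u t) := by
  let u : ℝ → E := fun t => ∫ s in (0 : ℝ)..t, extendTime w s
  have hu : ∀ t, HasDerivAt u (extendTime w t) t := hasDerivAt_integral_extendTime w
  have hdu : deriv u = extendTime w := funext fun t => (hu t).deriv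
  let g := postcomp f (phaseCLM E w)
  have hg : ∀ t ∈ Icc (-2 : ℝ) 2, extendTime g t = f (u t, extendTime w t) := fun t ht => by
    rw [extendTime_of_mem _ ht, extendTime_of_mem _ ht]
    change f (phaseCLM E w ⟨t, ht⟩) = _
    rw [phaseCLM_apply]
    rfl
  have hw' : ∀ t ∈ Icc (-2 : ℝ) 2, extendTime w t = z - ∫ s in (0 : ℝ)..t, extendTime g s :=
    fun t ht => by
      have := congrArg (fun h : C(TimeInterval, E) => h ⟨t, ht⟩) hw
      rw [extendTime_of_mem _ ht]
      exact eq_sub_of_add_eq this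
  have hwd : ∀ t ∈ Ioo (-2 : ℝ) 2, HasDerivAt (extendTime w) (-f (u t, extendTime w t)) t :=
    fun t ht => by
      have h1 := (hasDerivAt_integral_extendTime g t).const_sub z
      rw [hg t (Ioo_subset_Icc_self ht)] at h1
      refine h1.congr_of_eventuallyEq ?_
      filter_upwards [isOpen_Ioo.mem_nhds ht] with s hs
      exact hw' s (Ioo_subset_Icc_self hs)
  have hC : ContDiffOn ℝ 2 (fun t => (u t, extendTime w t)) (Ioo (-2 : ℝ) 2) := by
    refine contDiffOn_two_of_hasDerivAt (Y := fun q : E × E => (q.2, -f q)) (O := univ)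
      (contDiff_snd.prodMk (hf.neg.of_le (by simp))).contDiffOn isOpen_Ioo (mapsTo_univ _ _)
      fun t ht => (hu t).prodMk (hwd t ht)
  refine ⟨u, intervalIntegral.integral_same, ?_, fun t => rfl, fun t ht => ⟨?_, ?_⟩⟩
  · rw [hdu, hw' 0 (by norm_num), intervalIntegral.integral_same, sub_zero]
  · exact contDiff_fst.contDiffAt.comp t (hC.contDiffAt (isOpen_Ioo.mem_nhds ht))
  · rw [hdu]
    exact (hwd t ht).deriv

end SecondOrder

/-! ### The time-one map as a local diffeomorphism. -/

section TimeOne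

set_option synthInstance.maxHeartbeats 200000

variable {E : Type} [NormedAddCommGroup E] [InnerProductSpace ℝ E] [FiniteDimensional ℝ E]

/-- The force is quadratic in the velocity, so its derivative vanishes at zero velocity. -/
theorem contDiff_quadratic_and_fderiv_zero {E : Type*} [NormedAddCommGroup E] [NormedSpace ℝ E]
    {Q : E → E →L[ℝ] E →L[ℝ] E} (hQ : ContDiff ℝ ∞ Q) (u₀ : E) :
    ContDiff ℝ ∞ (fun q : E × E => Q (u₀ + q.1) q.2 q.2) ∧
      fderiv ℝ (fun q : E × E => Q (u₀ + q.1) q.2 q.2) 0 = 0 := by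
  have h0 : ContDiff ℝ ∞ fun q : E × E => Q (u₀ + q.1) :=
    hQ.comp (contDiff_const.add contDiff_fst)
  have h1 : ContDiff ℝ ∞ fun q : E × E => Q (u₀ + q.1) q.2 := h0.clm_apply contDiff_snd
  refine ⟨h1.clm_apply contDiff_snd, ?_⟩
  have h2 := ((h1.differentiable (by simp) 0).hasFDerivAt).clm_apply
    (hasFDerivAt_snd (𝕜 := ℝ) (p := (0 : E × E)))
  rw [h2.fderiv]
  ext q <;> simp

/-- The time-one map of a second order equation `u'' = - T_u(u', u')`, with respect to the initial
velocity, is a local diffeomorphism near `0`. -/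
theorem exists_openPartialHomeomorph_timeOne {T : E → E →L[ℝ] E →L[ℝ] E} {S : Set E}
    (hS : IsOpen S) (hT : ContDiffOn ℝ ∞ T S) {u₀ : E} (hu₀ : u₀ ∈ S) :
    ∃ e : OpenPartialHomeomorph E E, 0 ∈ e.source ∧ ContDiffOn ℝ ∞ e e.source ∧
      ContDiffOn ℝ ∞ e.symm e.target ∧ ∀ z ∈ e.source, e z ∈ S ∧ ∃ u : ℝ → E, u 0 = u₀ ∧
        deriv u 0 = z ∧ u 1 = e z ∧ ∀ t ∈ Ioo (-2 : ℝ) 2, ContDiffAt ℝ 2 u t ∧ u t ∈ S ∧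
          deriv (deriv u) t = -T (u t) (deriv u t) (deriv u t) := by
  have : CompleteSpace E := FiniteDimensional.complete ℝ E
  obtain ⟨Q, ε, hε, hQ, hεS, hQT⟩ := exists_contDiff_eqOn_ball hS hT hu₀
  obtain ⟨hf, hf'⟩ := contDiff_quadratic_and_fderiv_zero hQ u₀
  let f : C(E × E, E) := ⟨fun q => Q (u₀ + q.1) q.2 q.2, hf.continuous⟩
  have hf0 : f 0 = 0 := by simp [f]
  -- Inverting the operator on constant paths gives the velocity path `W z` as a smooth function of
  -- the initial velocity `z`.
  obtain ⟨v, hv0, -, hv, hvs⟩ := exists_openPartialHomeomorph_of_contDiffOn isOpen_univ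
    (contDiff_velocityOperator (f := f) hf).contDiffOn (mem_univ 0)
    (f' := ContinuousLinearEquiv.refl ℝ C(TimeInterval, E))
    (hasFDerivAt_velocityOperator_zero hf hf')
  have hv00 : v 0 = 0 := (hv 0).trans (velocityOperator_zero hf0)
  have hvt : (0 : C(TimeInterval, E)) ∈ v.target := hv00 ▸ v.map_source hv0
  have hvs0 : v.symm 0 = 0 := by
    conv_lhs => rw [← hv00]
    exact v.left_inv hv0
  let W : E → C(TimeInterval, E) := fun z => v.symm (constTimeCLM E z)
  let U₀ : Set E := constTimeCLM E ⁻¹' v.target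
  have hU₀ : IsOpen U₀ := v.open_target.preimage (constTimeCLM E).continuous
  have hW : ContDiffOn ℝ ∞ W U₀ := hvs.comp (constTimeCLM E).contDiff.contDiffOn fun _ hz => hz
  have hW0 : W 0 = 0 := by
    change v.symm (constTimeCLM E 0) = 0
    rw [map_zero, hvs0]
  let P : E → C(TimeInterval, E) := fun z => primitiveCLM E (W z)
  have hP : ContDiffOn ℝ ∞ P U₀ := (primitiveCLM E).contDiff.comp_contDiffOn hW
  -- Restricts to initial velocities whose whole trajectory stays in the ball where the global `Q`
  -- agrees with `T`.
  let U : Set E := U₀ ∩ P ⁻¹' Metric.ball 0 ε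
  have hU : IsOpen U := hP.continuousOn.isOpen_inter_preimage hU₀ Metric.isOpen_ball
  have hU0 : (0 : E) ∈ U := by
    refine ⟨?_, ?_⟩
    · change constTimeCLM E 0 ∈ v.target
      rwa [map_zero]
    · change primitiveCLM E (W 0) ∈ Metric.ball 0 ε
      rw [hW0, map_zero]
      exact Metric.mem_ball_self hε
  let one : TimeInterval := ⟨1, by norm_num⟩
  let ev : C(TimeInterval, E) →L[ℝ] E := ContinuousMap.evalCLM ℝ one
  let F : E → E := fun z => u₀ + P z one
  have hF : ContDiffOn ℝ ∞ F U :=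
    contDiffOn_const.add (ev.contDiff.comp_contDiffOn (hP.mono inter_subset_left))
  have hF' : HasFDerivAt F ((ContinuousLinearEquiv.refl ℝ E : E ≃L[ℝ] E) : E →L[ℝ] E) 0 := by
    have h1 : HasFDerivAt v.symm
        ((ContinuousLinearEquiv.refl ℝ C(TimeInterval, E)).symm :
          C(TimeInterval, E) →L[ℝ] C(TimeInterval, E)) (constTimeCLM E 0) := by
      rw [map_zero]
      refine v.hasFDerivAt_symm hvt ?_
      rw [hvs0]
      exact (hasFDerivAt_velocityOperator_zero hf hf').congr_of_eventuallyEq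
        (Eventually.of_forall hv)
    have h2 := ((ev ∘L primitiveCLM E).hasFDerivAt.comp (0 : E)
      (h1.comp (0 : E) (constTimeCLM E).hasFDerivAt)).const_add u₀
    refine HasFDerivAt.congr_fderiv (f := F) h2 ?_
    ext z
    change _ = z
    -- To first order at `0` the velocity is constant, so the displacement at time one is `z`.
    change (∫ s in (0 : ℝ)..1, extendTime (constTimeCLM E z) s) = z
    simp [extendTime]
  obtain ⟨e, he0, heU, heF, hes⟩ := exists_openPartialHomeomorph_of_contDiffOn hU hF hU0 hF'
  have hball : ∀ z ∈ U, ∀ t : TimeInterval, u₀ + P z t ∈ Metric.ball u₀ ε := fun z hz t => by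
    rw [mem_ball_iff_norm, add_sub_cancel_left]
    exact ((P z).norm_coe_le_norm t).trans_lt (mem_ball_zero_iff.1 hz.2)
  refine ⟨e, he0, (hF.mono heU).congr fun z _ => heF z, hes, fun z hz => ⟨?_, ?_⟩⟩
  · rw [heF]
    exact hεS (hball z (heU hz) one)
  have hWz : velocityOperator f (W z) = constTimeCLM E z :=
    (hv _).symm.trans (v.right_inv (heU hz).1)
  obtain ⟨x, hx0, hx1, hxP, hx⟩ := exists_solution_of_velocityOperator_eq hf hWz
  have hd : deriv (fun t => u₀ + x t) = deriv x := funext fun t => deriv_const_add _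
  refine ⟨fun t => u₀ + x t, ?_, ?_, ?_, fun t ht => ?_⟩
  · simp only [hx0, add_zero]
  · rw [hd, hx1]
  · rw [heF]
    exact congrArg (u₀ + ·) (hxP one)
  · have hxb : u₀ + x t ∈ Metric.ball u₀ ε := by
      have := hball z (heU hz) ⟨t, Ioo_subset_Icc_self ht⟩
      rwa [← hxP] at this
    refine ⟨contDiffAt_const.add (hx t ht).1, hεS hxb, ?_⟩
    rw [hd, (hx t ht).2]
    change -(Q (u₀ + x t) (deriv x t) (deriv x t)) = _
    rw [hQT hxb]

end TimeOne

/-! ### Normal balls of positive radius. -/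

section NormalBalls

variable {d p : ℕ} {M : Type*} [TopologicalSpace M] [ChartedSpace (EuclideanSpace ℝ (Fin d)) M]
  {ι : M → EuclideanSpace ℝ (Fin p)}
  [IsManifold (𝓡 d) ∞ M] [RiemannianBundle (fun x : M => TangentSpace (𝓡 d) x)]

set_option linter.unusedSectionVars false

/-- The coordinates of a tangent vector at `y` in the preferred chart at `y`. -/
def tangentCoord (y : M) : TangentSpace (𝓡 d) y ≃L[ℝ] EuclideanSpace ℝ (Fin d) where
  toFun v := v
  invFun v := v
  map_add' _ _ := rfl
  map_smul' _ _ := rfl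
  left_inv _ := rfl
  right_inv _ := rfl
  continuous_toFun := continuous_id (X := EuclideanSpace ℝ (Fin d))
  continuous_invFun := continuous_id (X := EuclideanSpace ℝ (Fin d))

/-- The tangent space at `y` is modelled on the preferred chart at `y`, in which the manifold
derivative is the ordinary one. -/
theorem IsIsometricEmbedding.fderiv_coordEmb_tangentCoord (hι : IsIsometricEmbedding (d := d) ι)
    (y : M) (v : TangentSpace (𝓡 d) y) :
    fderiv ℝ (coordEmb (d := d) ι y) (extChartAt (𝓡 d) y y) (tangentCoord y v) =
      differential (d := d) ι y v := by
  have h : MDifferentiableAt (𝓡 d) 𝓘(ℝ, EuclideanSpace ℝ (Fin p)) ι y :=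
    hι.contMDiff.mdifferentiableAt (by simp)
  have h1 : mfderiv (𝓡 d) 𝓘(ℝ, EuclideanSpace ℝ (Fin p)) ι y =
      fderiv ℝ (coordEmb (d := d) ι y) (extChartAt (𝓡 d) y y) := by
    rw [h.mfderiv, ModelWithCorners.range_eq_univ, fderivWithin_univ]
    rfl
  change _ = mfderiv (𝓡 d) 𝓘(ℝ, EuclideanSpace ℝ (Fin p)) ι y v
  rw [h1]
  rfl

/-- Read in the chart at `y`, `Exp` is the time-one map of the geodesic equation, a diffeomorphism
near `0`. The local inverse on `M` is the chart followed by the inverse of that map. -/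
theorem IsIsometricEmbedding.exists_isNormalRadius [CompactSpace M]
    (hι : IsIsometricEmbedding (d := d) ι) (y : M) :
    ∃ r > 0, IsNormalRadius (d := d) y r := by
  obtain ⟨e, he0, hes, het, he⟩ := exists_openPartialHomeomorph_timeOne
    (isOpen_extChartAt_target (I := 𝓡 d) y)
    (contDiffOn_tangentialHessian (isOpen_extChartAt_target y) (hι.contDiffOn_coordEmb y)
      fun z hz => hι.fderiv_coordEmb_injective hz) (mem_extChartAt_target y)
  obtain ⟨r, hr, hre⟩ : ∃ r > 0, ∀ v ∈ Metric.ball (0 : TangentSpace (𝓡 d) y) r,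
      tangentCoord y v ∈ e.source := Metric.mem_nhds_iff.1
    ((e.open_source.preimage (tangentCoord y).continuous).mem_nhds
      (show (0 : TangentSpace (𝓡 d) y) ∈ tangentCoord y ⁻¹' e.source by
        rwa [mem_preimage, map_zero]))
  have hexp : ∀ v ∈ Metric.ball (0 : TangentSpace (𝓡 d) y) r,
      riemExp (d := d) y v = (extChartAt (𝓡 d) y).symm (e (tangentCoord y v)) := fun v hv => by
    obtain ⟨-, u, hu0, hu', hu1, hu⟩ := he _ (hre v hv)
    rw [show e (tangentCoord y v) = u 1 from hu1.symm]
    refine hι.riemExp_eq_of_coord_geodesic (a := -2) (b := 2) (by norm_num) (by norm_num)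
      (fun t ht => (hu t ht).1) (fun t ht => (hu t ht).2.1) (fun t ht => (hu t ht).2.2) hu0 ?_
    rw [hu0, show deriv u 0 = tangentCoord y v from hu', hι.fderiv_coordEmb_tangentCoord]
  have hmaps : MapsTo (fun v => e (tangentCoord y v)) (Metric.ball 0 r)
      (extChartAt (𝓡 d) y).target := fun v hv => (he _ (hre v hv)).1
  let Ψ : M → TangentSpace (𝓡 d) y := fun m => (tangentCoord y).symm (e.symm (extChartAt (𝓡 d) y m))
  let O : Set M := (extChartAt (𝓡 d) y).source ∩ extChartAt (𝓡 d) y ⁻¹'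
    (e.target ∩ e.symm ⁻¹' ((tangentCoord y).symm ⁻¹' Metric.ball 0 r))
  have hb : IsOpen (Metric.ball (0 : TangentSpace (𝓡 d) y) r) := Metric.isOpen_ball
  have hO : IsOpen O :=
    (continuousOn_extChartAt y).isOpen_inter_preimage (isOpen_extChartAt_source y)
      (e.isOpen_inter_preimage_symm
        (hb.preimage (tangentCoord y).symm.continuous))
  have hc : ContDiff ℝ ∞ fun v : TangentSpace (𝓡 d) y => tangentCoord y v :=
    ContinuousLinearEquiv.contDiff (F := EuclideanSpace ℝ (Fin d)) (tangentCoord y)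
  have hc' : ContDiff ℝ ∞ fun v : EuclideanSpace ℝ (Fin d) => (tangentCoord y).symm v :=
    ContinuousLinearEquiv.contDiff (E := EuclideanSpace ℝ (Fin d)) (tangentCoord y).symm
  refine ⟨r, hr, ⟨⟨fun v => (extChartAt (𝓡 d) y).symm (e (tangentCoord y v)), Ψ, Metric.ball 0 r,
    O, fun v hv => ⟨?_, ?_⟩, fun m hm => hm.2.2, fun v hv => ?_, fun m hm => ?_⟩,
    hb, hO, ?_, ?_⟩, rfl, fun v hv => (hexp v hv).symm⟩
  · exact (extChartAt (𝓡 d) y).map_target (hmaps hv)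
  · rw [mem_preimage, (extChartAt (𝓡 d) y).right_inv (hmaps hv)]
    refine ⟨e.map_source (hre v hv), ?_⟩
    rw [mem_preimage, e.left_inv (hre v hv), mem_preimage, ContinuousLinearEquiv.symm_apply_apply]
    exact hv
  · change (tangentCoord y).symm (e.symm (extChartAt (𝓡 d) y _)) = v
    rw [(extChartAt (𝓡 d) y).right_inv (hmaps hv), e.left_inv (hre v hv),
      ContinuousLinearEquiv.symm_apply_apply]
  · simp only [Ψ]
    rw [ContinuousLinearEquiv.apply_symm_apply, e.right_inv hm.2.1,
      (extChartAt (𝓡 d) y).left_inv hm.1]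
  · exact (contMDiffOn_extChartAt_symm y).comp (hes.comp hc.contDiffOn hre).contMDiffOn hmaps
  · refine hc'.contMDiff.comp_contMDiffOn (het.contMDiffOn.comp
      ((contMDiffOn_extChartAt (I := 𝓡 d) (x := y) (n := ∞)).mono fun m hm => ?_) fun m hm => hm.2.1)
    simpa only [extChartAt_source] using hm.1

end NormalBalls

/-! ### Geodesic balls up to the injectivity radius, and logarithms. -/

section GeodesicBalls

variable {d p : ℕ} {M : Type*} [TopologicalSpace M] [ChartedSpace (EuclideanSpace ℝ (Fin d)) M]
  {ι : M → EuclideanSpace ℝ (Fin p)}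
  [IsManifold (𝓡 d) ∞ M] [RiemannianBundle (fun x : M => TangentSpace (𝓡 d) x)]

set_option linter.unusedSectionVars false

/-- The radius `r` may equal the supremum without being known to be normal. Every smaller radius is
exceeded by a normal one, which suffices for injectivity and openness on the open ball. -/
theorem exists_isNormalRadius_gt {y : M} {r r' : ℝ} (hr : 0 < r)
    (hinj : ENNReal.ofReal r ≤ injRadius (d := d) y) (hr' : r' < r) :
    ∃ R > r', IsNormalRadius (d := d) y R := by
  have h := ((ENNReal.ofReal_lt_ofReal_iff hr).2 hr').trans_le hinj
  obtain ⟨R, hR⟩ := lt_iSup_iff.1 h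
  obtain ⟨hN, hR⟩ := lt_iSup_iff.1 hR
  exact ⟨R, lt_of_not_ge fun h => hR.not_ge (ENNReal.ofReal_le_ofReal h), hN⟩

theorem injOn_riemExp_ball {y : M} {r : ℝ} (hr : 0 < r)
    (hinj : ENNReal.ofReal r ≤ injRadius (d := d) y) :
    InjOn (riemExp (d := d) y) (Metric.ball 0 r) := by
  intro v hv w hw h
  rw [mem_ball_zero_iff] at hv hw
  obtain ⟨R, hR, Φ, hs, hΦ⟩ := exists_isNormalRadius_gt hr hinj (max_lt hv hw)
  have hv' : v ∈ Metric.ball 0 R := mem_ball_zero_iff.2 ((le_max_left _ _).trans_lt hR)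
  have hw' : w ∈ Metric.ball 0 R := mem_ball_zero_iff.2 ((le_max_right _ _).trans_lt hR)
  rw [← hΦ hv', ← hΦ hw'] at h
  rw [← hs] at hv' hw'
  exact Φ.toPartialEquiv.injOn hv' hw' h

theorem isOpen_image_riemExp {y : M} {r : ℝ} (hr : 0 < r)
    (hinj : ENNReal.ofReal r ≤ injRadius (d := d) y) {U : Set (TangentSpace (𝓡 d) y)}
    (hU : IsOpen U) (hUr : U ⊆ Metric.ball 0 r) : IsOpen (riemExp (d := d) y '' U) := by
  rw [isOpen_iff_mem_nhds]
  rintro _ ⟨v, hv, rfl⟩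
  obtain ⟨R, hR, Φ, hs, hΦ⟩ := exists_isNormalRadius_gt hr hinj (mem_ball_zero_iff.1 (hUr hv))
  have hv' : v ∈ Φ.source := by
    rw [hs]
    exact mem_ball_zero_iff.2 hR
  let e : OpenPartialHomeomorph (TangentSpace (𝓡 d) y) M :=
    { Φ with
      continuousOn_toFun := Φ.contMDiffOn_toFun.continuousOn
      continuousOn_invFun := Φ.contMDiffOn_invFun.continuousOn }
  have h : e '' (Φ.source ∩ U) ∈ 𝓝 (riemExp (d := d) y v) := by
    rw [← hΦ (by rwa [hs] at hv')]
    exact (e.isOpen_image_source_inter hU).mem_nhds ⟨v, ⟨hv', hv⟩, rfl⟩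
  refine mem_of_superset h ?_
  rintro _ ⟨w, ⟨hw, hwU⟩, rfl⟩
  rw [hs] at hw
  exact ⟨w, hwU, (hΦ hw).symm⟩

theorem isOpen_geodesicBall {y : M} {r : ℝ} (hr : 0 < r)
    (hinj : ENNReal.ofReal r ≤ injRadius (d := d) y) : IsOpen (geodesicBall (d := d) y r) :=
  isOpen_image_riemExp hr hinj Metric.isOpen_ball Subset.rfl

variable [CompactSpace M]

/-- The constant curve solves the geodesic equation. -/
theorem IsIsometricEmbedding.riemExp_zero (hι : IsIsometricEmbedding (d := d) ι) (y : M) :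
    riemExp (d := d) y 0 = y := by
  rw [hι.riemExp_eq_of_coord_geodesic (u := fun _ => extChartAt (𝓡 d) y y) (a := -2) (b := 2)
    (by norm_num) (by norm_num) (fun t _ => contDiffAt_const)
    (fun t _ => mem_extChartAt_target y) (fun t _ => by simp) rfl (by simp)]
  exact extChartAt_to_inv y

theorem IsIsometricEmbedding.exists_isAnchorFamily (hι : IsIsometricEmbedding (d := d) ι) :
    ∃ (N : ℕ) (y : Fin N → M) (r : Fin N → ℝ), IsAnchorFamily (d := d) y r := by
  choose r hr hN using hι.exists_isNormalRadius
  have hinj : ∀ y, ENNReal.ofReal (r y) ≤ injRadius (d := d) y := fun y =>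
    le_iSup₂ (f := fun (r : ℝ) (_ : IsNormalRadius (d := d) y r) => ENNReal.ofReal r) (r y) (hN y)
  obtain ⟨t, -, ht⟩ := isCompact_univ.elim_nhds_subcover
    (fun y => geodesicBall (d := d) y (r y)) fun y _ =>
      (isOpen_geodesicBall (hr y) (hinj y)).mem_nhds
        ⟨0, Metric.mem_ball_self (hr y), hι.riemExp_zero y⟩
  refine ⟨t.card, fun i => t.equivFin.symm i, fun i => r (t.equivFin.symm i),
    fun i => ⟨hr _, hinj _⟩, eq_univ_of_forall fun z => ?_⟩
  obtain ⟨y, hy, hz⟩ := mem_iUnion₂.1 (ht (mem_univ z))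
  refine mem_iUnion.2 ⟨t.equivFin ⟨y, hy⟩, ?_⟩
  simpa using hz

/-- The image of an open set is a difference of two compact sets. -/
theorem IsIsometricEmbedding.measurableSet_image (hι : IsIsometricEmbedding (d := d) ι)
    {U : Set M} (hU : IsOpen U) : MeasurableSet (ι '' U) := by
  have h : ι '' U = range ι \ ι '' Uᶜ := by
    rw [image_compl_eq_range_sdiff_image hι.isEmbedding.injective, sdiff_sdiff_cancel_left
      (image_subset_range _ _)]
  rw [h]
  exact (isCompact_range hι.isEmbedding.continuous).measurableSet.diff
    (hU.isClosed_compl.isCompact.image hι.isEmbedding.continuous).measurableSet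

theorem IsIsometricEmbedding.tangentialPart_differential (hι : IsIsometricEmbedding (d := d) ι)
    (y : M) (v : TangentSpace (𝓡 d) y) :
    tangentialPart (d := d) ι y (differential (d := d) ι y v) = v := by
  have : FiniteDimensional ℝ (TangentSpace (𝓡 d) y) :=
    inferInstanceAs (FiniteDimensional ℝ (EuclideanSpace ℝ (Fin d)))
  refine ext_inner_right ℝ fun w => ?_
  rw [tangentialPart, LinearMap.adjoint_inner_left]
  exact hι.inner_differential y v w

/-- The Riemannian logarithm on a geodesic ball, read in the ambient Euclidean space. -/
theorem IsIsometricEmbedding.exists_log (hι : IsIsometricEmbedding (d := d) ι) {y : M} {r : ℝ}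
    (hr : 0 < r) (hinj : ENNReal.ofReal r ≤ injRadius (d := d) y) :
    ∃ J : EuclideanSpace ℝ (Fin p) → EuclideanSpace ℝ (Fin p), Measurable J ∧
      ContinuousOn J (ι '' geodesicBall (d := d) y r) ∧ (∀ z, ‖J z‖ ≤ r) ∧
      ∀ z ∈ ι '' geodesicBall (d := d) y r,
        ι (riemExp (d := d) y (tangentialPart (d := d) ι y (J z))) = z := by
  classical
  have : Nonempty M := ⟨y⟩
  have hb : IsOpen (Metric.ball (0 : TangentSpace (𝓡 d) y) r) := Metric.isOpen_ball
  -- On the open ball `Exp` is continuous, injective and open, hence a homeomorphism onto the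
  -- geodesic ball; `e.symm` is the logarithm.
  let e : OpenPartialHomeomorph (TangentSpace (𝓡 d) y) M :=
    OpenPartialHomeomorph.ofContinuousOpenRestrict
      ((injOn_riemExp_ball hr hinj).toPartialEquiv _ _) (hι.continuous_riemExp y).continuousOn
      (fun U hU => by
        have h := isOpen_image_riemExp hr hinj (hb.isOpenMap_subtype_val U hU) (by
          rintro _ ⟨v, -, rfl⟩
          exact v.2)
        convert h using 1
        exact image_comp (riemExp (d := d) y) Subtype.val U) hb
  let L : EuclideanSpace ℝ (Fin p) → EuclideanSpace ℝ (Fin p) := fun z =>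
    differential (d := d) ι y (e.symm (Function.invFun ι z))
  have hL : ∀ m, L (ι m) = differential (d := d) ι y (e.symm m) := fun m =>
    congrArg (fun m => differential (d := d) ι y (e.symm m))
      (Function.leftInverse_invFun hι.isEmbedding.injective m)
  have hLc : ContinuousOn L (ι '' geodesicBall (d := d) y r) := by
    rintro _ ⟨m, hm, rfl⟩
    rw [ContinuousWithinAt, ← hι.isEmbedding.map_nhdsWithin_eq, tendsto_map'_iff, hL]
    refine Tendsto.congr (fun m => (hL m).symm) ?_
    exact ((differential (d := d) ι y).continuous.tendsto _).comp (e.continuousOn_symm m hm)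
  have hA := hι.measurableSet_image (isOpen_geodesicBall hr hinj)
  -- Extending by zero keeps `J` measurable and bounded; continuity is only needed on the image of
  -- the ball.
  refine ⟨(ι '' geodesicBall (d := d) y r).piecewise L 0,
    hLc.measurable_piecewise continuousOn_const hA, hLc.congr (piecewise_eqOn _ _ _),
    fun z => ?_, fun z hz => ?_⟩
  · by_cases hz : z ∈ ι '' geodesicBall (d := d) y r
    · rw [piecewise_eq_of_mem _ _ _ hz]
      obtain ⟨m, hm, rfl⟩ := hz
      rw [hL, hι.2]
      exact (mem_ball_zero_iff.1 (e.map_target hm)).le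
    · rw [piecewise_eq_of_notMem _ _ _ hz, Pi.zero_apply, norm_zero]
      exact hr.le
  · rw [piecewise_eq_of_mem _ _ _ hz]
    obtain ⟨m, hm, rfl⟩ := hz
    rw [hL, hι.tangentialPart_differential]
    exact congrArg ι (e.right_inv hm)

end GeodesicBalls

/-! ### Measurable choice of a patch. -/

section Selection

/-- The least admissible index is selected: removing the earlier sets makes the family disjoint, and
constants are glued on the pieces. -/
theorem exists_measurable_selection {X : Type*} [MeasurableSpace X] {N : ℕ} [Nonempty (Fin N)]
    {Z : Fin N → Set X} (hZ : ∀ i, MeasurableSet (Z i)) :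
    ∃ s : X → Fin N, Measurable s ∧ ∀ x, (∃ i, x ∈ Z i) → x ∈ Z (s x) := by
  let D : Fin N → Set X := fun i => Z i \ ⋃ j < i, Z j
  have hD : ∀ i, MeasurableSet (D i) := fun i =>
    (hZ i).diff (MeasurableSet.iUnion fun j => MeasurableSet.iUnion fun _ => hZ j)
  have hdisj : ∀ i j, i < j → D i ∩ D j = ∅ := fun i j hij =>
    eq_empty_of_forall_notMem fun x hx => hx.2.2 (mem_iUnion₂.2 ⟨i, hij, hx.1.1⟩)
  obtain ⟨s, hs, hsD⟩ := exists_measurable_piecewise D hD (fun i _ => i)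
    (fun i => measurable_const) (fun i j hij x hx => by
      rcases lt_or_gt_of_ne hij with h | h
      · rw [hdisj i j h] at hx
        exact hx.elim
      · rw [inter_comm, hdisj j i h] at hx
        exact hx.elim)
  refine ⟨s, hs, fun x hx => ?_⟩
  obtain ⟨i, hi, hmin⟩ := wellFounded_lt.has_min {i | x ∈ Z i} hx
  have hxi : x ∈ D i := ⟨hi, fun h => by
    obtain ⟨j, hj, hxj⟩ := mem_iUnion₂.1 h
    exact hmin j hxj hj⟩
  rw [hsD i hxi]
  exact hi

end Selection

/-! ### Controlled sets and approximation through the readout. -/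

section ManifoldOutputs

variable {d p : ℕ} {M : Type*} [TopologicalSpace M] [ChartedSpace (EuclideanSpace ℝ (Fin d)) M]
  {ι : M → EuclideanSpace ℝ (Fin p)}
  [IsManifold (𝓡 d) ∞ M] [RiemannianBundle (fun x : M => TangentSpace (𝓡 d) x)]
  [CompactSpace M] {N : ℕ} {y : Fin N → M} {r : Fin N → ℝ}

/-- A Lebesgue number for the cover of an embedded manifold by geodesic balls. -/
theorem IsAnchorFamily.exists_lebesgueNumber (hy : IsAnchorFamily (d := d) y r)
    (hι : IsIsometricEmbedding (d := d) ι) :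
    ∃ δ > 0, ∀ m : M, ∃ i,
      Metric.ball (ι m) δ ⊆ (ι '' (geodesicBall (d := d) (y i) (r i))ᶜ)ᶜ := by
  have hinj := hι.isEmbedding.injective
  have hc := hι.isEmbedding.continuous
  have hopen : ∀ i, IsOpen (ι '' (geodesicBall (d := d) (y i) (r i))ᶜ)ᶜ := fun i =>
    ((isOpen_geodesicBall (hy.1 i).1 (hy.1 i).2).isClosed_compl.isCompact.image
      hc).isClosed.isOpen_compl
  obtain ⟨δ, hδ, h⟩ := lebesgue_number_lemma_of_metric (isCompact_range hc) hopen (by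
    rintro _ ⟨m, rfl⟩
    obtain ⟨i, hi⟩ := mem_iUnion.1 (hy.2 ▸ mem_univ m)
    refine mem_iUnion.2 ⟨i, ?_⟩
    rintro ⟨m', hm', h⟩
    exact hm' (hinj h ▸ hi))
  exact ⟨δ, hδ, fun m => h _ (mem_range_self m)⟩

/-- At each time the value at a fixed `x₀` lies at distance at least `δ` from the image of the
complement of some ball. The other values, less than `δ` away, cannot leave that ball. -/
theorem IsAnchorFamily.exists_isControlled [Nonempty M] (hy : IsAnchorFamily (d := d) y r)
    (hι : IsIsometricEmbedding (d := d) ι) :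
    ∃ δ > 0, ∀ (α β : ℝ) (s : ℕ) (f : EuclideanSpace ℝ (Fin s) → FunSpace α β p),
      (∀ x, f x ∈ manifoldFun ι α β) → ∀ E : Set (EuclideanSpace ℝ (Fin s)), IsCompact E →
      ∀ η : ℝ → ℝ, Monotone η →
      (∀ x ∈ E, ∀ x' ∈ E, ∀ᵐ t ∂((volume : Measure ℝ).restrict (Icc α β)),
        ‖f x t - f x' t‖ ≤ η (dist x x')) →
      η (Metric.diam E) < δ →
      ∃ σ : ℝ → Fin N, Measurable σ ∧ IsControlled (d := d) ι y r σ f E := by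
  obtain ⟨δ, hδ, h⟩ := hy.exists_lebesgueNumber hι
  have hN : Nonempty (Fin N) := ⟨(h (Classical.arbitrary M)).choose⟩
  refine ⟨δ, hδ, fun α β s f hf E hE η hη hfη hd => ?_⟩
  rcases E.eq_empty_or_nonempty with rfl | ⟨x₀, hx₀⟩
  · exact ⟨fun _ => Classical.arbitrary _, measurable_const, fun x hx => hx.elim⟩
  let A : Fin N → Set (EuclideanSpace ℝ (Fin p)) := fun i =>
    ι '' (geodesicBall (d := d) (y i) (r i))ᶜ
  -- The admissible regions are complements of open thickenings, hence measurable, and `δ` itself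
  -- remains the margin.
  obtain ⟨τ, hτ, hτA⟩ := exists_measurable_selection
    (Z := fun i => (Metric.thickening δ (A i))ᶜ)
    (fun i => Metric.isOpen_thickening.measurableSet.compl)
  refine ⟨fun t => τ (f x₀ t), hτ.comp (Lp.stronglyMeasurable (f x₀)).measurable,
    fun x hx => ?_⟩
  filter_upwards [hf x, hf x₀, hfη x hx x₀ hx₀] with t ht ht₀ htη
  obtain ⟨m₀, hm₀⟩ := ht₀
  obtain ⟨m, hm⟩ := ht
  have h1 : f x₀ t ∈ (Metric.thickening δ (A (τ (f x₀ t))))ᶜ := by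
    refine hτA _ ?_
    obtain ⟨i, hi⟩ := h m₀
    refine ⟨i, fun hmem => ?_⟩
    obtain ⟨z, hz, hzδ⟩ := Metric.mem_thickening_iff.1 hmem
    rw [← hm₀, dist_comm] at hzδ
    exact hi hzδ hz
  by_contra hcon
  refine h1 (Metric.mem_thickening_iff.2 ⟨f x t, ⟨m, fun hmem => hcon ⟨m, hmem, hm⟩, hm⟩, ?_⟩)
  rw [dist_comm, dist_eq_norm]
  exact htη.trans_lt ((hη (Metric.dist_le_diam_of_mem hE.isBounded hx hx₀)).trans_lt hd)

/-- The lift `κ` by logarithms is a right inverse of `ρ` on the values `f x`, and `κ ∘ f` is a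
continuous map into a linear space, which decoders can approximate. -/
theorem IsAnchorFamily.exists_isReadout (hy : IsAnchorFamily (d := d) y r)
    (hι : IsIsometricEmbedding (d := d) ι) {α β : ℝ} {σ : ℝ → Fin N} (hσ : Measurable σ) :
    ∃ ρ : FunSpace α β p → FunSpace α β p, IsReadout (d := d) ι y σ ρ ∧
      ∀ (a : ℝ → ℝ), IsTauberWiener a →
      ∀ (s : ℕ) (f : EuclideanSpace ℝ (Fin s) → FunSpace α β p), Continuous f →
      ∀ ε > 0, ∀ E : Set (EuclideanSpace ℝ (Fin s)), IsCompact E →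
        IsControlled (d := d) ι y r σ f E →
        ∃ D : EuclideanSpace ℝ (Fin s) → FunSpace α β p, IsDecoder a D ∧
          ∀ x ∈ E, ‖ρ (D x) - f x‖ < ε := by
  let G : Fin N → EuclideanSpace ℝ (Fin p) → EuclideanSpace ℝ (Fin p) := fun i v =>
    ι (riemExp (d := d) (y i) (tangentialPart (d := d) ι (y i) v))
  have hG : ∀ i, Continuous (G i) := fun i =>
    (hι.isEmbedding.continuous.comp (hι.continuous_riemExp (y i))).comp
      (tangentialPart (d := d) ι (y i)).continuous_of_finiteDimensional
  obtain ⟨C, hC⟩ := (isCompact_range hι.isEmbedding.continuous).isBounded.exists_norm_le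
  have hGC : ∀ i v, ‖G i v‖ ≤ C := fun i v => hC _ (mem_range_self _)
  obtain ⟨ρ, hρ⟩ := exists_superposition (α := α) (β := β) (fun i => (hG i).measurable) hGC hσ
  have hρc : Continuous ρ := continuous_iff_continuousAt.2 fun h => by
    rw [← continuousWithinAt_univ]
    exact continuousWithinAt_superposition hGC hρ (A := fun _ => univ)
      (fun _ _ => Eventually.of_forall fun _ => mem_univ _)
      (Eventually.of_forall fun t => (hG _).continuousWithinAt)
  choose J hJm hJc hJr hJ using fun i => hι.exists_log (hy.1 i).1 (hy.1 i).2
  have hJC : ∀ i v, ‖J i v‖ ≤ ∑ j, r j := fun i v => (hJr i v).trans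
    (Finset.single_le_sum (f := r) (fun j _ => (hy.1 j).1.le) (Finset.mem_univ i))
  obtain ⟨κ, hκ⟩ := exists_superposition (α := α) (β := β) hJm hJC hσ
  refine ⟨ρ, hρ, fun a ha s f hf ε hε E hE hfE => ?_⟩
  have hκc : ContinuousOn (fun x => κ (f x)) E := by
    have h1 : ContinuousOn κ (f '' E) := by
      rintro _ ⟨x, hx, rfl⟩
      refine continuousWithinAt_superposition hJC hκ
        (A := fun i => ι '' geodesicBall (d := d) (y i) (r i)) ?_ ?_
      · rintro _ ⟨x', hx', rfl⟩
        exact hfE x' hx'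
      · filter_upwards [hfE x hx] with t ht
        exact hJc _ _ ht
    exact h1.comp hf.continuousOn (mapsTo_image f E)
  have hρκ : ∀ x ∈ E, ρ (κ (f x)) = f x := fun x hx => by
    refine Lp.ext ?_
    filter_upwards [hρ (κ (f x)), hκ (f x), hfE x hx] with t h1 h2 h3
    rw [h1, h2]
    exact hJ _ _ h3
  -- Compactness makes `δ` uniform over the values `κ (f x)`, while the nearby point `D x` need not
  -- lie in the compact set.
  have hunif := (hE.image_of_continuousOn hκc).uniformContinuousAt_of_continuousAt ρ
    (fun h _ => hρc.continuousAt) (Metric.dist_mem_uniformity hε)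
  obtain ⟨δ, hδ, hδρ⟩ := Metric.mem_uniformity_dist.1 hunif
  obtain ⟨D, hD, hDκ⟩ := exists_decoder_approx ha hE hκc hδ
  refine ⟨D, hD, fun x hx => ?_⟩
  have h1 : dist (κ (f x)) (D x) < δ := by
    rw [dist_comm, dist_eq_norm]
    exact hDκ x hx
  have h2 := hδρ h1 (mem_image_of_mem _ hx)
  simp only [mem_ofPred_eq] at h2
  rwa [hρκ x hx, dist_comm, dist_eq_norm] at h2

end ManifoldOutputs

end FunctionalDecoder

end

/-! ### The main theorem. -/

theorem theorem1 :
    -- Euclidean outputs: universal approximation, uniformly on compact sets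
    (∀ (a : ℝ → ℝ), IsTauberWiener a →
      ∀ (α β : ℝ), α ≤ β → ∀ (s p : ℕ)
        (f : EuclideanSpace ℝ (Fin s) → FunSpace α β p), Continuous f →
      ∀ ε ∈ Ioo (0 : ℝ) 1, ∀ E : Set (EuclideanSpace ℝ (Fin s)), IsCompact E →
        ∃ D : EuclideanSpace ℝ (Fin s) → FunSpace α β p,
          IsDecoder a D ∧
          ⨆ x ∈ E, ‖D x - f x‖ₑ < ENNReal.ofReal ε) ∧
    -- outputs in a compact connected Riemannian manifold isometrically embedded in `ℝ^p`
    (∀ (d p : ℕ) (M : Type*) [TopologicalSpace M] [ChartedSpace (EuclideanSpace ℝ (Fin d)) M]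
      [IsManifold (𝓡 d) ∞ M] [RiemannianBundle (fun x : M => TangentSpace (𝓡 d) x)]
      [IsContMDiffRiemannianBundle (𝓡 d) ∞ (EuclideanSpace ℝ (Fin d))
        (fun x : M => TangentSpace (𝓡 d) x)]
      [CompactSpace M] [ConnectedSpace M]
      (ι : M → EuclideanSpace ℝ (Fin p)), IsIsometricEmbedding (d := d) ι →
      -- finite families of anchor points exist
      (∃ (N : ℕ) (y : Fin N → M) (r : Fin N → ℝ), IsAnchorFamily (d := d) y r) ∧
      ∀ (N : ℕ) (y : Fin N → M) (r : Fin N → ℝ), IsAnchorFamily (d := d) y r →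
        -- compact sets of sufficiently small diameter are controlled
        (∃ δ > 0, ∀ (α β : ℝ), α ≤ β → ∀ (s : ℕ)
          (f : EuclideanSpace ℝ (Fin s) → FunSpace α β p), Continuous f →
          (∀ x, f x ∈ manifoldFun ι α β) →
          ∀ E : Set (EuclideanSpace ℝ (Fin s)), IsCompact E →
          ∀ η : ℝ → ℝ, Monotone η →
          (∀ x ∈ E, ∀ x' ∈ E, ∀ᵐ t ∂((volume : Measure ℝ).restrict (Icc α β)),
            ‖f x t - f x' t‖ ≤ η (dist x x')) →
          η (Metric.diam E) < δ →
          ∃ σ : ℝ → Fin N, Measurable σ ∧ IsControlled (d := d) ι y r σ f E) ∧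
        -- patchwise universal approximation on controlled compact sets
        (∀ (α β : ℝ), α ≤ β → ∀ σ : ℝ → Fin N, Measurable σ →
          ∃ ρ : FunSpace α β p → FunSpace α β p,
            IsReadout (d := d) ι y σ ρ ∧
            ∀ (a : ℝ → ℝ), IsTauberWiener a →
            ∀ (s : ℕ) (f : EuclideanSpace ℝ (Fin s) → FunSpace α β p),
              Continuous f → (∀ x, f x ∈ manifoldFun ι α β) →
            ∀ ε ∈ Ioo (0 : ℝ) 1, ∀ E : Set (EuclideanSpace ℝ (Fin s)), IsCompact E →
              IsControlled (d := d) ι y r σ f E →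
              ∃ D : EuclideanSpace ℝ (Fin s) → FunSpace α β p,
                IsDecoder a D ∧
                ⨆ x ∈ E, ‖ρ (D x) - f x‖ₑ < ENNReal.ofReal ε)) := by
  refine ⟨fun a ha α β _ s p f hf ε hε E hE => ?_, fun d p M _ _ _ _ _ _ _ ι hι =>
    ⟨hι.exists_isAnchorFamily, fun N y r hy => ⟨?_, fun α β _ σ hσ => ?_⟩⟩⟩
  · obtain ⟨D, hD, h⟩ := exists_decoder_approx ha hE hf.continuousOn (half_pos hε.1)
    exact ⟨D, hD, iSup_enorm_lt_of_forall_norm_lt hε.1 h⟩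
  · obtain ⟨δ, hδ, h⟩ := hy.exists_isControlled hι
    exact ⟨δ, hδ, fun α β _ s f _ hf E hE η hη hfη hd => h α β s f hf E hE η hη hfη hd⟩
  · obtain ⟨ρ, hρ, h⟩ := hy.exists_isReadout hι (α := α) (β := β) hσ
    refine ⟨ρ, hρ, fun a ha s f hf _ ε hε E hE hfE => ?_⟩
    obtain ⟨D, hD, hDf⟩ := h a ha s f hf _ (half_pos hε.1) E hE hfE
    exact ⟨D, hD, iSup_enorm_lt_of_forall_norm_lt hε.1 hDf⟩
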